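/- For every $\varepsilon>0$ there are a deterministic real-RAM program and constants $C,K$ (depending on $\varepsilon$ only) such that the following holds for every $n\ge 1$ and every $n$ pairwise disjoint closed unit disks $D_1,\dots,D_n$ in $\mathbb{R}^2$, with centers $p_1,\dots,p_n$. Given $n$ and the coordinates of $p_1,\dots,p_n$ (in arbitrary order) as input, the program halts after at most $C\,n$ elementary steps and outputs real numbers $a,b,c$ with $(a,b)\neq(0,0)$ such that the line $\ell=\{(x,y): ax+by=c\}$ intersects at most $K\,n^{5/6+\varepsilon}$ of the disks $D_1,\dots,D_n$, and each of the two closed halfplanes bounded by $\ell$ contains at least $n/2$ of the points $p_1,\dots,p_n$. Here a real RAM is a random access machine with integer and real memory cells and indirect addressing, in which each of the following takes one step: memory access, addition, (truncated) subtraction and comparison of nonnegative integers, and addition, subtraction, multiplication, division and comparison of real numbers. Its programs may use natural number and rational constants; there is no rounding, root extraction or randomness. -/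

import Mathlib

/-! A real RAM: a deterministic random access machine with integer cells (used for counting and
for indirect addressing) and real cells (holding exact real numbers), programmed in a structured
language, with every elementary operation charged one unit of time.

* Integers (natural numbers) support constants, addition, truncated subtraction, comparison.
* Reals support rational constants, the four arithmetic operations and comparison.
* There is no rounding, no conversion of reals into integers, no root, no randomness.

The memory consists of integer arrays and real arrays.  A program mentions only finitely
many of them, and addresses inside an array may be computed (indirect addressing). -/

namespace RealRAM

/-- Memory contents: `s.nat a i` is cell `i` of the integer array `a`, and
`s.real a i` is cell `i` of the real array `a`. -/
@[ext] structure State where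
  nat : ℕ → ℕ → ℕ
  real : ℕ → ℕ → ℝ

/-- Integer expressions. -/
inductive NatExpr where
  | const (k : ℕ)
  | get (a : ℕ) (i : NatExpr)
  | add (e f : NatExpr)
  | sub (e f : NatExpr)

/-- Real expressions. -/
inductive RealExpr where
  | const (q : ℚ)
  | get (a : ℕ) (i : NatExpr)
  | add (e f : RealExpr)
  | sub (e f : RealExpr)
  | mul (e f : RealExpr)
  | div (e f : RealExpr)

/-- Tests. -/
inductive Test where
  | natLt (e f : NatExpr)
  | realLt (e f : RealExpr)
  | not (b : Test)
  | and (b c : Test)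

/-- Programs. -/
inductive Prog where
  | skip
  | setNat (a : ℕ) (i e : NatExpr)
  | setReal (a : ℕ) (i : NatExpr) (e : RealExpr)
  | seq (P Q : Prog)
  | cond (b : Test) (P Q : Prog)
  | loop (b : Test) (P : Prog)

/-- Value of an integer expression. -/
def NatExpr.eval (s : State) : NatExpr → ℕ
  | .const k => k
  | .get a i => s.nat a (i.eval s)
  | .add e f => e.eval s + f.eval s
  | .sub e f => e.eval s - f.eval s

/-- Number of elementary operations in an integer expression. -/
def NatExpr.cost : NatExpr → ℕ
  | .const _ => 1
  | .get _ i => i.cost + 1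
  | .add e f => e.cost + f.cost + 1
  | .sub e f => e.cost + f.cost + 1

/-- Value of a real expression. A division by zero returns zero; as a program can test
a divisor beforehand, this convention gives the machine no additional power. -/
noncomputable def RealExpr.eval (s : State) : RealExpr → ℝ
  | .const q => (q : ℝ)
  | .get a i => s.real a (i.eval s)
  | .add e f => e.eval s + f.eval s
  | .sub e f => e.eval s - f.eval s
  | .mul e f => e.eval s * f.eval s
  | .div e f => e.eval s / f.eval s

/-- Number of elementary operations in a real expression. -/
def RealExpr.cost : RealExpr → ℕ
  | .const _ => 1
  | .get _ i => i.cost + 1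
  | .add e f => e.cost + f.cost + 1
  | .sub e f => e.cost + f.cost + 1
  | .mul e f => e.cost + f.cost + 1
  | .div e f => e.cost + f.cost + 1

/-- Truth of a test. -/
def Test.Holds (s : State) : Test → Prop
  | .natLt e f => e.eval s < f.eval s
  | .realLt e f => e.eval s < f.eval s
  | .not b => ¬ b.Holds s
  | .and b c => b.Holds s ∧ c.Holds s

/-- Number of elementary operations in a test. -/
def Test.cost : Test → ℕ
  | .natLt e f => e.cost + f.cost + 1
  | .realLt e f => e.cost + f.cost + 1
  | .not b => b.cost + 1
  | .and b c => b.cost + c.cost + 1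

/-- Write `k` into cell `i` of the integer array `a`. -/
def State.writeNat (s : State) (a i k : ℕ) : State :=
  { s with nat := Function.update s.nat a (Function.update (s.nat a) i k) }

/-- Write `x` into cell `i` of the real array `a`. -/
def State.writeReal (s : State) (a i : ℕ) (x : ℝ) : State :=
  { s with real := Function.update s.real a (Function.update (s.real a) i x) }

/-- `Run P s t s'`: started in the memory `s`, the program `P` halts after exactly `t` units
of time with memory `s'`. -/
inductive Run : Prog → State → ℕ → State → Prop where
  | skip (s : State) : Run .skip s 1 s
  | setNat (a : ℕ) (i e : NatExpr) (s : State) :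
      Run (.setNat a i e) s (i.cost + e.cost + 1) (s.writeNat a (i.eval s) (e.eval s))
  | setReal (a : ℕ) (i : NatExpr) (e : RealExpr) (s : State) :
      Run (.setReal a i e) s (i.cost + e.cost + 1) (s.writeReal a (i.eval s) (e.eval s))
  | seq {P Q : Prog} {s s' s'' : State} {t t' : ℕ} (hP : Run P s t s') (hQ : Run Q s' t' s'') :
      Run (.seq P Q) s (t + t') s''
  | condTrue {b : Test} {P Q : Prog} {s s' : State} {t : ℕ} (hb : b.Holds s)
      (hP : Run P s t s') : Run (.cond b P Q) s (b.cost + 1 + t) s'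
  | condFalse {b : Test} {P Q : Prog} {s s' : State} {t : ℕ} (hb : ¬ b.Holds s)
      (hQ : Run Q s t s') : Run (.cond b P Q) s (b.cost + 1 + t) s'
  | loopTrue {b : Test} {P : Prog} {s s' s'' : State} {t t' : ℕ} (hb : b.Holds s)
      (hP : Run P s t s') (hL : Run (.loop b P) s' t' s'') :
      Run (.loop b P) s (b.cost + 1 + t + t') s''
  | loopFalse {b : Test} {P : Prog} {s : State} (hb : ¬ b.Holds s) :
      Run (.loop b P) s (b.cost + 1) s

/-- The machine is deterministic: the time and the final memory are determined by the program
and the initial memory. -/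
theorem Run.deterministic {P : Prog} {s s₁ s₂ : State} {t₁ t₂ : ℕ}
    (h₁ : Run P s t₁ s₁) (h₂ : Run P s t₂ s₂) : t₁ = t₂ ∧ s₁ = s₂ := by
  induction h₁ generalizing t₂ s₂ with
  | skip s => cases h₂; exact ⟨rfl, rfl⟩
  | setNat a i e s => cases h₂; exact ⟨rfl, rfl⟩
  | setReal a i e s => cases h₂; exact ⟨rfl, rfl⟩
  | seq hP hQ ihP ihQ =>
    cases h₂ with
    | seq hP' hQ' =>
      obtain ⟨rfl, rfl⟩ := ihP hP'
      obtain ⟨rfl, rfl⟩ := ihQ hQ'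
      exact ⟨rfl, rfl⟩
  | condTrue hb hP ih =>
    cases h₂ with
    | condTrue _ hP' => obtain ⟨rfl, rfl⟩ := ih hP'; exact ⟨rfl, rfl⟩
    | condFalse hb' _ => exact absurd hb hb'
  | condFalse hb hQ ih =>
    cases h₂ with
    | condTrue hb' _ => exact absurd hb' hb
    | condFalse _ hQ' => obtain ⟨rfl, rfl⟩ := ih hQ'; exact ⟨rfl, rfl⟩
  | loopTrue hb hP hL ihP ihL =>
    cases h₂ with
    | loopTrue _ hP' hL' =>
      obtain ⟨rfl, rfl⟩ := ihP hP'
      obtain ⟨rfl, rfl⟩ := ihL hL'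
      exact ⟨rfl, rfl⟩
    | loopFalse hb' => exact absurd hb hb'
  | loopFalse hb =>
    cases h₂ with
    | loopTrue hb' _ _ => exact absurd hb' hb
    | loopFalse _ => exact ⟨rfl, rfl⟩

end RealRAM

/-- The Euclidean plane. -/
abbrev Plane : Type := EuclideanSpace ℝ (Fin 2)

/-- The line `a x + b y = c` (a line as soon as `a ≠ 0` or `b ≠ 0`). -/
def lineOf (a b c : ℝ) : Set Plane := {q | a * q 0 + b * q 1 = c}

/-- One of the two closed halfplanes bounded by the line `a x + b y = c`. -/
def lowerHalfplane (a b c : ℝ) : Set Plane := {q | a * q 0 + b * q 1 ≤ c}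

/-- The other closed halfplane bounded by the line `a x + b y = c`. -/
def upperHalfplane (a b c : ℝ) : Set Plane := {q | c ≤ a * q 0 + b * q 1}

/-- The initial memory of the machine on input `p 0, …, p (n - 1)`: the number `n` is in cell `0`
of the integer array `0`, the coordinates of the points are in the cells `0, …, n - 1` of the real
arrays `0` and `1`, and all other cells are zero. -/
noncomputable def inputPoints {n : ℕ} (p : Fin n → Plane) : RealRAM.State where
  nat := fun a i => if a = 0 ∧ i = 0 then n else 0
  real := fun a i =>
    if h : i < n then
      if a = 0 then p ⟨i, h⟩ 0 else if a = 1 then p ⟨i, h⟩ 1 else 0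
    else 0

/-! Let `hgt t p` be the height of `p` in direction of slope `t`. For `t` in `[0, 1]` the median
height `v` defines a halving line of slope `t`, and this line only meets disks whose centers satisfy
`|hgt t p - v| ≤ 2`. So it suffices to find a slope whose median strip contains `O(n^(5/6))`
centers. This is done by prune and search.

A stage has a list `L` of active points and an interval of slopes of length `h`. On this interval
the median level of the input is the level of some fixed rank `r` of `L`, and every point close to
that level is still in `L`. The interval is cut into `10 ^ 20` pieces. On each piece, the elements
of rank `r - e` and `r + e` at both ends, with `e = |L| / 10 ^ 9`, form a bracket. Heights are
affine in the slope, so a bracket that passes two counting tests at the ends confines the level on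
the whole piece (`LevelBox.Certifies.bounds`), and the points far below or far above it at both ends
can be dropped (`Search.step`).

As long as `h √|L|` is at least a constant, some piece keeps at most `|L| / 10 ^ 8` points
(`exists_successful`). Each pair of points changes its order at most once, so there are at most
`|L|²` crossings over all pieces. The centers lie in distinct unit cells, and two centers at cell
distance `D` lie in a common strip for only `1 + O(k / (h D))` of `k` equally spaced slopes; summing
`1 / D` over the cells gives `O(√|L|)`. Hence the squared strip sizes also sum to `O(|L|²)`
(`sum_sq_strip_le`). By pigeonhole some piece has at most `e²` crossings and at most `e` points in
each of four strips, which forces its bracket to pass the tests and to keep at most `10 e` points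
(`card_inHi`, `card_inLo`, `card_kept`).

A stage divides `h` by `10 ^ 20` and `|L|` by at least `10 ^ 8`, so `|L|^5 ≤ h² n^5` persists. When
no piece succeeds, `h² |L| = O(1)`, so `|L|^6 = O(n^5)`, and `L` contains all points near the level.

Quantiles are computed by the median of medians method in linear time (`selLoop_call`), so a stage
is linear in `|L|`; the lengths decrease geometrically, and the total time is linear. -/

namespace RealRAM

/-! ### A cost logic for programs -/

/-- Started in `s`, the program halts within `c` units of time in a memory satisfying `Q`. -/
def Exec (P : Prog) (s : State) (c : ℕ) (Q : State → Prop) : Prop :=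
  ∃ t s', Run P s t s' ∧ t ≤ c ∧ Q s'

theorem Exec.mono {P : Prog} {s : State} {c c' : ℕ} {Q Q' : State → Prop}
    (h : Exec P s c Q) (hc : c ≤ c') (hQ : ∀ s', Q s' → Q' s') : Exec P s c' Q' := by
  obtain ⟨t, s', hr, ht, hq⟩ := h
  exact ⟨t, s', hr, ht.trans hc, hQ _ hq⟩

theorem Exec.seq {P R : Prog} {s : State} {c₁ c₂ c : ℕ} {Q : State → Prop} {M : State → Prop}
    (h : Exec P s c₁ M) (h' : ∀ s', M s' → Exec R s' c₂ Q) (hc : c₁ + c₂ ≤ c) :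
    Exec (.seq P R) s c Q := by
  obtain ⟨t, s', hr, ht, hq⟩ := h
  obtain ⟨t', s'', hr', ht', hq'⟩ := h' s' hq
  exact ⟨t + t', s'', .seq hr hr', by omega, hq'⟩

/-- Weakest precondition of loop-free code. -/
def wp : Prog → (State → Prop) → State → Prop
  | .skip, Q, s => Q s
  | .setNat a i e, Q, s => Q (s.writeNat a (i.eval s) (e.eval s))
  | .setReal a i e, Q, s => Q (s.writeReal a (i.eval s) (e.eval s))
  | .seq P R, Q, s => wp P (wp R Q) s
  | .cond b P R, Q, s => (b.Holds s → wp P Q s) ∧ (¬ b.Holds s → wp R Q s)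
  | .loop _ _, _, _ => False

/-- Time bound of loop-free code. -/
def Prog.bound : Prog → ℕ
  | .skip => 1
  | .setNat _ i e => i.cost + e.cost + 1
  | .setReal _ i e => i.cost + e.cost + 1
  | .seq P R => P.bound + R.bound
  | .cond b P R => b.cost + 1 + (P.bound + R.bound)
  | .loop _ _ => 0

/-- A conditional is charged for both branches, so the bound is computed from the program text
alone. The bound zero for loops is harmless because their precondition is `False`. -/
theorem Exec.of_wp {P : Prog} {s : State} {c : ℕ} {Q : State → Prop} (hc : P.bound ≤ c)
    (h : wp P Q s) : Exec P s c Q := by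
  induction P generalizing s c Q with
  | skip => exact ⟨1, s, .skip s, hc, h⟩
  | setNat a i e => exact ⟨_, _, .setNat a i e s, hc, h⟩
  | setReal a i e => exact ⟨_, _, .setReal a i e s, hc, h⟩
  | seq P R ihP ihR =>
    exact Exec.seq (ihP le_rfl h) (fun s' hs' => ihR le_rfl hs') hc
  | cond b P R ihP ihR =>
    simp only [Prog.bound] at hc
    by_cases hb : b.Holds s
    · obtain ⟨t, s', hr, ht, hq⟩ := ihP le_rfl (h.1 hb)
      exact ⟨_, _, .condTrue hb hr, by omega, hq⟩
    · obtain ⟨t, s', hr, ht, hq⟩ := ihR le_rfl (h.2 hb)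
      exact ⟨_, _, .condFalse hb hr, by omega, hq⟩
  | loop b P => exact h.elim

theorem Exec.cond {b : Test} {P R : Prog} {s : State} {c c' : ℕ} {Q : State → Prop}
    (hP : b.Holds s → Exec P s c' Q) (hR : ¬ b.Holds s → Exec R s c' Q)
    (hc : b.cost + 1 + c' ≤ c) : Exec (.cond b P R) s c Q := by
  by_cases hb : b.Holds s
  · obtain ⟨t, s', hr, ht, hq⟩ := hP hb
    exact ⟨_, _, .condTrue hb hr, by omega, hq⟩
  · obtain ⟨t, s', hr, ht, hq⟩ := hR hb
    exact ⟨_, _, .condFalse hb hr, by omega, hq⟩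

/-- A loop that runs a number `N` of times known in advance. -/
theorem Exec.for {b : Test} {P : Prog} {s : State} {N c c' : ℕ} (Inv : ℕ → State → Prop)
    {Q : State → Prop} (h0 : Inv 0 s)
    (hb : ∀ i s', i ≤ N → Inv i s' → (b.Holds s' ↔ i < N))
    (hP : ∀ i s', i < N → Inv i s' → Exec P s' c (Inv (i + 1)))
    (hQ : ∀ s', Inv N s' → Q s')
    (hc : N * (c + b.cost + 1) + b.cost + 1 ≤ c') : Exec (.loop b P) s c' Q := by
  suffices H : ∀ M i s', i + M = N → Inv i s' →
      Exec (.loop b P) s' (M * (c + b.cost + 1) + b.cost + 1) Q from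
    (H N 0 s (by omega) h0).mono hc (fun _ h => h)
  intro M
  induction M with
  | zero =>
    intro i s' hi hs'
    obtain rfl : i = N := by omega
    refine ⟨_, _, .loopFalse (fun h => ?_), ?_, hQ _ hs'⟩
    · exact lt_irrefl _ ((hb _ _ le_rfl hs').1 h)
    · omega
  | succ M ih =>
    intro i s' hi hs'
    obtain ⟨t, s'', hr, ht, hq⟩ := hP i s' (by omega) hs'
    obtain ⟨t', s₃, hr', ht', hq'⟩ := ih (i + 1) s'' (by omega) hq
    refine ⟨_, _, .loopTrue ((hb _ _ (by omega) hs').2 (by omega)) hr hr', ?_, hq'⟩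
    rw [Nat.succ_mul]; omega

/-- A loop with a decreasing measure. -/
theorem Exec.while {b : Test} {P : Prog} {c : ℕ} (Inv : ℕ → State → Prop) {Q : State → Prop}
    (hP : ∀ m s', Inv m s' → b.Holds s' → Exec P s' c (fun s'' => ∃ m' < m, Inv m' s''))
    (hQ : ∀ m s', Inv m s' → ¬ b.Holds s' → Q s') :
    ∀ m s, Inv m s → ∀ {c'}, m * (c + b.cost + 1) + b.cost + 1 ≤ c' →
      Exec (.loop b P) s c' Q := by
  intro m
  induction m using Nat.strong_induction_on with
  | _ m ih =>
    intro s hs c' hc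
    by_cases hb : b.Holds s
    · obtain ⟨t, s', hr, ht, m', hm', hs'⟩ := hP m s hs hb
      obtain ⟨t', s'', hr', ht', hq⟩ := ih m' hm' s' hs' le_rfl
      refine ⟨_, _, .loopTrue hb hr hr', ?_, hq⟩
      have := Nat.mul_le_mul_right (c + b.cost + 1) (Nat.succ_le_of_lt hm')
      rw [Nat.succ_mul] at this
      omega
    · exact ⟨_, _, .loopFalse hb, by omega, hQ m s hs hb⟩

/-- Loop-free code followed by other code. -/
theorem Exec.step {P R : Prog} {s : State} {c' c : ℕ} {Q : State → Prop}
    (h : wp P (fun s' => Exec R s' c' Q) s) (hc : P.bound + c' ≤ c) : Exec (.seq P R) s c Q :=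
  Exec.seq (Exec.of_wp le_rfl h) (fun _ h => h) hc

/-! ### Frame conditions: which arrays a program may change -/

/-- Two memories agree outside the integer arrays in `N` and the real arrays in `R`. -/
def Same (N R : List ℕ) (s s' : State) : Prop :=
  (∀ a, a ∉ N → s'.nat a = s.nat a) ∧ (∀ a, a ∉ R → s'.real a = s.real a)

theorem Same.refl (N R : List ℕ) (s : State) : Same N R s s :=
  ⟨fun _ _ => rfl, fun _ _ => rfl⟩

theorem Same.trans {N R : List ℕ} {s s' s'' : State} (h : Same N R s s')
    (h' : Same N R s' s'') : Same N R s s'' :=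
  ⟨fun a ha => (h'.1 a ha).trans (h.1 a ha), fun a ha => (h'.2 a ha).trans (h.2 a ha)⟩

theorem Same.mono {N R N' R' : List ℕ} {s s' : State} (h : Same N R s s')
    (hN : N ⊆ N') (hR : R ⊆ R') : Same N' R' s s' :=
  ⟨fun a ha => h.1 a (fun h => ha (hN h)), fun a ha => h.2 a (fun h => ha (hR h))⟩

theorem Same.writeNat {N R : List ℕ} {s s' : State} (h : Same N R s s') {a i k : ℕ}
    (ha : a ∈ N) : Same N R s (s'.writeNat a i k) := by
  refine ⟨fun b hb => ?_, h.2⟩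
  rw [← h.1 b hb]
  exact Function.update_of_ne (by rintro rfl; exact hb ha) _ _

theorem Same.writeReal {N R : List ℕ} {s s' : State} (h : Same N R s s') {a i : ℕ} {x : ℝ}
    (ha : a ∈ R) : Same N R s (s'.writeReal a i x) := by
  refine ⟨h.1, fun b hb => ?_⟩
  rw [← h.2 b hb]
  exact Function.update_of_ne (by rintro rfl; exact hb ha) _ _

@[simp] theorem writeNat_real (s : State) (a i k : ℕ) : (s.writeNat a i k).real = s.real := rfl

@[simp] theorem writeReal_nat (s : State) (a i : ℕ) (x : ℝ) : (s.writeReal a i x).nat = s.nat := rfl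

theorem writeNat_nat (s : State) (a i k b j : ℕ) :
    (s.writeNat a i k).nat b j = if b = a then (if j = i then k else s.nat b j) else s.nat b j := by
  unfold State.writeNat
  by_cases h : b = a
  · subst h; by_cases h' : j = i
    · subst h'; simp
    · simp [h']
  · simp [h]

theorem writeReal_real (s : State) (a i : ℕ) (x : ℝ) (b j : ℕ) :
    (s.writeReal a i x).real b j =
      if b = a then (if j = i then x else s.real b j) else s.real b j := by
  unfold State.writeReal
  by_cases h : b = a
  · subst h; by_cases h' : j = i
    · subst h'; simp
    · simp [h']
  · simp [h]

theorem writeNat_nat_ne {s : State} {a i k b : ℕ} (h : b ≠ a) :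
    (s.writeNat a i k).nat b = s.nat b := Function.update_of_ne h _ _

theorem writeReal_real_ne {s : State} {a i : ℕ} {x : ℝ} {b : ℕ} (h : b ≠ a) :
    (s.writeReal a i x).real b = s.real b := Function.update_of_ne h _ _

/-! ### Abbreviations for variables -/

/-- An integer variable is cell `0` of its array. -/
def nv (a : ℕ) : NatExpr := .get a (.const 0)

/-- A real variable is cell `0` of its array. -/
def rv (a : ℕ) : RealExpr := .get a (.const 0)

def setn (a : ℕ) (e : NatExpr) : Prog := .setNat a (.const 0) e

def setr (a : ℕ) (e : RealExpr) : Prog := .setReal a (.const 0) e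

@[simp] theorem nv_eval (s : State) (a : ℕ) : (nv a).eval s = s.nat a 0 := rfl
@[simp] theorem rv_eval (s : State) (a : ℕ) : (rv a).eval s = s.real a 0 := rfl
@[simp] theorem wp_setn (s : State) (a : ℕ) (e : NatExpr) (Q : State → Prop) :
    wp (setn a e) Q s = Q (s.writeNat a 0 (e.eval s)) := rfl
@[simp] theorem wp_setr (s : State) (a : ℕ) (e : RealExpr) (Q : State → Prop) :
    wp (setr a e) Q s = Q (s.writeReal a 0 (e.eval s)) := rfl

end RealRAM

/-! ### Ranks in lists of reals -/

/-- `v` is the element of rank `r` (counted from zero) of the list `L`. -/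
def IsSel (L : List ℝ) (r : ℕ) (v : ℝ) : Prop :=
  L.countP (fun x => decide (x < v)) ≤ r ∧ r < L.countP (fun x => decide (x ≤ v))

/-- If `u < v`, the entries at most `u` are among those below `v`: there are more than `r` of the
former and at most `r` of the latter. -/
theorem IsSel.unique {L : List ℝ} {r : ℕ} {u v : ℝ} (hu : IsSel L r u) (hv : IsSel L r v) :
    u = v := by
  have key : ∀ {u v : ℝ}, IsSel L r u → IsSel L r v → ¬ u < v := by
    intro u v hu hv h
    have : L.countP (fun x => decide (x ≤ u)) ≤ L.countP (fun x => decide (x < v)) :=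
      List.countP_mono_left (fun x _ hx => by simp at hx ⊢; linarith)
    have := hu.2; have := hv.1; omega
  exact le_antisymm (not_lt.1 (key hv hu)) (not_lt.1 (key hu hv))

theorem IsSel.lt_length {L : List ℝ} {r : ℕ} {v : ℝ} (h : IsSel L r v) : r < L.length :=
  h.2.trans_le List.countP_le_length

/-- Take the least entry `v` with more than `r` entries at most `v`. If more than `r` entries were
below `v`, the largest of them would be a smaller choice. -/
theorem exists_isSel (L : List ℝ) (r : ℕ) (hr : r < L.length) : ∃ v ∈ L, IsSel L r v := by
  classical
  have hne : L.toFinset.Nonempty := by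
    rw [List.toFinset_nonempty_iff]; rintro rfl; simp at hr
  have hS : (L.toFinset.filter (fun v => r < L.countP (fun x => decide (x ≤ v)))).Nonempty := by
    refine ⟨L.toFinset.max' hne, Finset.mem_filter.2 ⟨Finset.max'_mem _ _, ?_⟩⟩
    rw [List.countP_eq_length.2]
    · exact hr
    · intro a ha
      simpa using Finset.le_max' _ a (List.mem_toFinset.2 ha)
  have hmem := Finset.min'_mem _ hS
  set v := Finset.min' _ hS with hv
  rw [Finset.mem_filter, List.mem_toFinset] at hmem
  refine ⟨v, hmem.1, ?_, hmem.2⟩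
  by_contra hlt
  push Not at hlt
  have hT : (L.toFinset.filter (fun u => u < v)).Nonempty := by
    have : 0 < L.countP (fun x => decide (x < v)) := by omega
    obtain ⟨a, ha, ha'⟩ := List.countP_pos_iff.1 this
    exact ⟨a, Finset.mem_filter.2 ⟨List.mem_toFinset.2 ha, by simpa using ha'⟩⟩
  have hm := Finset.max'_mem _ hT
  rw [Finset.mem_filter] at hm
  have h2 : L.countP (fun x => decide (x < v)) ≤
      L.countP (fun x => decide (x ≤ Finset.max' _ hT)) :=
    List.countP_mono_left (fun x hx hxv => by
      simp only [decide_eq_true_eq] at hxv ⊢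
      exact Finset.le_max' _ x (Finset.mem_filter.2 ⟨List.mem_toFinset.2 hx, hxv⟩))
  have h3 : v ≤ Finset.max' _ hT :=
    Finset.min'_le _ _ (Finset.mem_filter.2 ⟨hm.1, by omega⟩)
  exact absurd hm.2 (not_lt.2 h3)

theorem countP_add_countP_not {α : Type*} (L : List α) (p : α → Prop) [DecidablePred p] :
    L.countP (fun x => decide (p x)) + L.countP (fun x => decide (¬ p x)) = L.length := by
  rw [List.length_eq_countP_add_countP (fun x => decide (p x))]
  congr 2; funext x; simp

theorem countP_lt_add_countP_ge (L : List ℝ) (v : ℝ) :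
    L.countP (fun x => decide (x < v)) + L.countP (fun x => decide (v ≤ x)) = L.length := by
  rw [← countP_add_countP_not L (fun x => x < v)]; simp only [not_lt]

theorem countP_le_add_countP_gt (L : List ℝ) (v : ℝ) :
    L.countP (fun x => decide (x ≤ v)) + L.countP (fun x => decide (v < x)) = L.length := by
  rw [← countP_add_countP_not L (fun x => x ≤ v)]; simp only [not_le]

/-- Selection in the part of a list below a pivot. -/
theorem IsSel.of_filter_lt {L : List ℝ} {r : ℕ} {v w : ℝ}
    (hr : r < L.countP (fun x => decide (x < v)))
    (h : IsSel (L.filter (fun x => decide (x < v))) r w) : IsSel L r w := by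
  have hlt : w < v := by
    by_contra hwv
    push Not at hwv
    have h1 := h.1
    rw [List.countP_filter] at h1
    have : L.countP (fun x => decide (x < v)) ≤
        L.countP (fun x => decide (x < w) && decide (x < v)) :=
      List.countP_mono_left (fun x _ hx => by simp at hx ⊢; exact ⟨by linarith, hx⟩)
    omega
  unfold IsSel at h ⊢
  rw [List.countP_filter, List.countP_filter] at h
  have e1 : L.countP (fun x => decide (x < w) && decide (x < v)) =
      L.countP (fun x => decide (x < w)) :=
    List.countP_congr (fun x _ => by simp; intro _; linarith)
  have e2 : L.countP (fun x => decide (x ≤ w) && decide (x < v)) =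
      L.countP (fun x => decide (x ≤ w)) :=
    List.countP_congr (fun x _ => by simp; intro _; linarith)
  rwa [e1, e2] at h

/-- Selection in the part of a list above a pivot. -/
theorem IsSel.of_filter_gt {L : List ℝ} {r : ℕ} {v w : ℝ}
    (hr : L.countP (fun x => decide (x ≤ v)) ≤ r)
    (h : IsSel (L.filter (fun x => decide (v < x))) (r - L.countP (fun x => decide (x ≤ v))) w) :
    IsSel L r w := by
  have hlt : v < w := by
    by_contra hwv
    push Not at hwv
    have h1 := h.2
    rw [List.countP_filter] at h1
    have : L.countP (fun x => decide (x ≤ w) && decide (v < x)) = 0 := by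
      rw [List.countP_eq_zero]; intro x _; simp; intro _; linarith
    omega
  have split : ∀ p : ℝ → Bool, (∀ x, x ≤ v → p x = true) →
      L.countP p = L.countP (fun x => decide (x ≤ v)) +
        L.countP (fun x => p x && decide (v < x)) := by
    intro p hp
    clear h hr
    induction L with
    | nil => rfl
    | cons a L ih =>
      simp only [List.countP_cons, ih]
      by_cases ha : a ≤ v
      · simp [hp a ha, ha, not_lt.2 ha]; omega
      · simp [ha, not_le.1 ha]; omega
  unfold IsSel at h ⊢
  rw [List.countP_filter, List.countP_filter] at h
  rw [split (fun x => decide (x < w)) (fun x hx => by simp; linarith),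
    split (fun x => decide (x ≤ w)) (fun x hx => by simp; linarith)]
  omega

/-! ### Segments of arrays -/

/-- The entries `f b, …, f (b + l - 1)`. -/
def seg {α : Type*} (f : ℕ → α) (b l : ℕ) : List α := (List.range l).map (fun i => f (b + i))

@[simp] theorem seg_length {α : Type*} (f : ℕ → α) (b l : ℕ) : (seg f b l).length = l := by
  simp [seg]

@[simp] theorem seg_zero {α : Type*} (f : ℕ → α) (b : ℕ) : seg f b 0 = [] := rfl

theorem seg_succ {α : Type*} (f : ℕ → α) (b l : ℕ) : seg f b (l + 1) = seg f b l ++ [f (b + l)] := by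
  simp [seg, List.range_succ]

theorem seg_add {α : Type*} (f : ℕ → α) (b l m : ℕ) :
    seg f b (l + m) = seg f b l ++ seg f (b + l) m := by
  induction m with
  | zero => simp
  | succ m ih => rw [← add_assoc, seg_succ, ih, seg_succ, List.append_assoc, add_assoc]

theorem seg_congr {α : Type*} {f g : ℕ → α} {b l : ℕ} (h : ∀ i < l, f (b + i) = g (b + i)) :
    seg f b l = seg g b l := by
  unfold seg
  exact List.map_congr_left (fun i hi => h i (List.mem_range.1 hi))

theorem mem_seg {α : Type*} {f : ℕ → α} {b l : ℕ} {x : α} :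
    x ∈ seg f b l ↔ ∃ i < l, f (b + i) = x := by
  simp [seg]

theorem countP_seg_succ {α : Type*} (f : ℕ → α) (b l : ℕ) (p : α → Bool) :
    (seg f b (l + 1)).countP p = (seg f b l).countP p + if p (f (b + l)) then 1 else 0 := by
  rw [seg_succ, List.countP_append, List.countP_singleton]

theorem filter_seg_succ {α : Type*} (f : ℕ → α) (b l : ℕ) (p : α → Bool) :
    (seg f b (l + 1)).filter p =
      if p (f (b + l)) then (seg f b l).filter p ++ [f (b + l)] else (seg f b l).filter p := by
  rw [seg_succ, List.filter_append]
  split_ifs with h <;> simp [h]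

/-! ### Medians of groups of five -/

/-- The entries `g 0, …, g (G - 1)` are the medians of the `G` groups of five in a segment. -/
def GroupMedians (f : ℕ → ℝ) (b : ℕ) (g : ℕ → ℝ) (c G : ℕ) : Prop :=
  ∀ i < G, IsSel (seg f (b + 5 * i) 5) 2 (g (c + i))

/-- A median has rank 2 in its group, counted from zero, so a median at most `v` brings three
entries at most `v`. -/
theorem GroupMedians.count_le {f g : ℕ → ℝ} {b c G : ℕ} (h : GroupMedians f b g c G) (v : ℝ) :
    3 * (seg g c G).countP (fun x => decide (x ≤ v)) ≤
      (seg f b (5 * G)).countP (fun x => decide (x ≤ v)) := by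
  induction G with
  | zero => simp
  | succ G ih =>
    have ih := ih (fun i hi => h i (by omega))
    have hG := (h G (by omega)).2
    rw [countP_seg_succ, show 5 * (G + 1) = 5 * G + 5 by ring, seg_add, List.countP_append]
    split_ifs with hv
    · have : (seg f (b + 5 * G) 5).countP (fun x => decide (x ≤ g (c + G))) ≤
          (seg f (b + 5 * G) 5).countP (fun x => decide (x ≤ v)) :=
        List.countP_mono_left (fun x _ hx => by simp at hx hv ⊢; linarith)
      omega
    · omega

theorem GroupMedians.count_ge {f g : ℕ → ℝ} {b c G : ℕ} (h : GroupMedians f b g c G) (v : ℝ) :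
    3 * (seg g c G).countP (fun x => decide (v ≤ x)) ≤
      (seg f b (5 * G)).countP (fun x => decide (v ≤ x)) := by
  induction G with
  | zero => simp
  | succ G ih =>
    have ih := ih (fun i hi => h i (by omega))
    have hG := (h G (by omega)).1
    have hc := countP_lt_add_countP_ge (seg f (b + 5 * G) 5) (g (c + G))
    rw [seg_length] at hc
    rw [countP_seg_succ, show 5 * (G + 1) = 5 * G + 5 by ring, seg_add, List.countP_append]
    split_ifs with hv
    · have : (seg f (b + 5 * G) 5).countP (fun x => decide (g (c + G) ≤ x)) ≤
          (seg f (b + 5 * G) 5).countP (fun x => decide (v ≤ x)) :=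
        List.countP_mono_left (fun x _ hx => by simp at hx hv ⊢; linarith)
      omega
    · omega

/-- The median of the medians is a good pivot. -/
theorem GroupMedians.pivot {f g : ℕ → ℝ} {b c l : ℕ} {v : ℝ}
    (h : GroupMedians f b g c (l / 5)) (hv : IsSel (seg g c (l / 5)) (l / 5 / 2) v) :
    10 * (seg f b l).countP (fun x => decide (x < v)) ≤ 7 * l + 12 ∧
      10 * (seg f b l).countP (fun x => decide (v < x)) ≤ 7 * l + 12 := by
  have h1 := h.count_le v
  have h2 := h.count_ge v
  -- At most four entries belong to no group. With `G = l / 5`, at least `G / 2` medians lie on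
  -- either side of `v`, hence `3 G / 2` entries, and `10 (l - 3 G / 2) ≤ 7 l + 12` because `5 G ≥ l
  -- - 4`.
  have e : seg f b l = seg f b (5 * (l / 5)) ++ seg f (b + 5 * (l / 5)) (l % 5) := by
    rw [← seg_add]; congr 1; omega
  have h3 := countP_lt_add_countP_ge (seg f b l) v
  have h4 := countP_le_add_countP_gt (seg f b l) v
  have h5 := countP_lt_add_countP_ge (seg g c (l / 5)) v
  rw [seg_length] at h3 h4 h5
  have h6 : (seg f b (5 * (l / 5))).countP (fun x => decide (v ≤ x)) ≤
      (seg f b l).countP (fun x => decide (v ≤ x)) := by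
    rw [e, List.countP_append]; omega
  have h7 : (seg f b (5 * (l / 5))).countP (fun x => decide (x ≤ v)) ≤
      (seg f b l).countP (fun x => decide (x ≤ v)) := by
    rw [e, List.countP_append]; omega
  have h8 := hv.1
  have h9 := hv.2
  constructor <;> omega

namespace RealRAM

/-! ### Deterministic selection in linear time

Integer variables: `10` stack height, `11` mode, arrays `12`, `13`, `14` hold base, length and rank
of the stack frames, `15`, `16`, `17` base, length and rank of the current frame, `18` counter,
`19`, `20` counts, `21` write position, `22` to `25` used by brute force selection (counter, base,
length, rank), `26` group counter, `27` number of groups, `28` half of it.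
Real variables: array `30` is the work space, `31` the pivot, `32` the result. -/

/-- Counts the entries less than the pivot and at most the pivot. -/
def countProg : Prog :=
  .seq (.seq (setn 18 (.const 0)) <| .seq (setn 19 (.const 0)) (setn 20 (.const 0))) <|
  .loop (.natLt (nv 18) (nv 24)) <|
    .seq (.cond (.realLt (.get 30 (.add (nv 23) (nv 18))) (rv 31))
      (setn 19 (.add (nv 19) (.const 1))) .skip) <|
    .seq (.cond (.not (.realLt (rv 31) (.get 30 (.add (nv 23) (nv 18)))))
      (setn 20 (.add (nv 20) (.const 1))) .skip) <|
    setn 18 (.add (nv 18) (.const 1))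

theorem countProg_spec (s : State) :
    Exec countProg s (60 * s.nat 24 0 + 30) (fun s' => Same [18, 19, 20] [] s s' ∧
      s'.nat 19 0 = (seg (s.real 30) (s.nat 23 0) (s.nat 24 0)).countP
        (fun x => decide (x < s.real 31 0)) ∧
      s'.nat 20 0 = (seg (s.real 30) (s.nat 23 0) (s.nat 24 0)).countP
        (fun x => decide (x ≤ s.real 31 0))) := by
  unfold countProg
  refine Exec.step (c' := 60 * s.nat 24 0 + 15) ?_ (by simp only [Prog.bound, setn, NatExpr.cost]; omega)
  simp only [wp, wp_setn]
  refine Exec.for (N := s.nat 24 0) (c := 50) (fun i s' => Same [18, 19, 20] [] s s' ∧ s'.nat 18 0 = i ∧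
      s'.nat 19 0 = (seg (s.real 30) (s.nat 23 0) i).countP (fun x => decide (x < s.real 31 0)) ∧
      s'.nat 20 0 = (seg (s.real 30) (s.nat 23 0) i).countP (fun x => decide (x ≤ s.real 31 0)))
      ?_ ?_ ?_ ?_ ?_
  · refine ⟨(((Same.refl _ _ s).writeNat ?_).writeNat ?_).writeNat ?_, ?_⟩ <;>
      simp [writeNat_nat, NatExpr.eval]
  · rintro i s' hi ⟨hs, h18, -, -⟩
    simp [Test.Holds, h18, hs.1 24]
  · rintro i s' hi ⟨hs, h18, h19, h20⟩
    refine Exec.of_wp (by decide) ?_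
    have e1 := hs.1 23 (by decide)
    have e2 := hs.2 30 (by decide)
    have e3 := hs.2 31 (by decide)
    simp only [wp, wp_setn, Test.Holds, RealExpr.eval, NatExpr.eval, nv_eval, rv_eval,
      countP_seg_succ, not_lt]
    refine ⟨fun h => ⟨fun h' => ⟨?_, ?_⟩, fun h' => ⟨?_, ?_⟩⟩,
      fun h => ⟨fun h' => ⟨?_, ?_⟩, fun h' => ⟨?_, ?_⟩⟩⟩ <;>
    first
    | (repeat' first | exact hs | refine Same.writeNat ?_ (by decide)); done
    | (simp [writeNat_nat, e1, e2, e3, h18] at h h' ⊢; simp [h19, h20, h, h'])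
  · exact fun s' h => ⟨h.1, h.2.2.1, h.2.2.2⟩
  · simp only [Test.cost, NatExpr.cost, nv]; omega
/-- Brute force selection in quadratic time. -/
def bruteProg : Prog :=
  .seq (setn 22 (.const 0)) <|
  .loop (.natLt (nv 22) (nv 24)) <|
    .seq (setr 31 (.get 30 (.add (nv 23) (nv 22)))) <|
    .seq countProg <|
    .seq (.cond (.and (.not (.natLt (nv 25) (nv 19))) (.natLt (nv 25) (nv 20)))
      (setr 32 (rv 31)) .skip) <|
    setn 22 (.add (nv 22) (.const 1))

theorem bruteProg_spec (s : State) (hr : s.nat 25 0 < s.nat 24 0) :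
    Exec bruteProg s ((60 * s.nat 24 0 + 80) * s.nat 24 0 + 20) (fun s' =>
      Same [18, 19, 20, 22] [31, 32] s s' ∧
      IsSel (seg (s.real 30) (s.nat 23 0) (s.nat 24 0)) (s.nat 25 0) (s'.real 32 0)) := by
  unfold bruteProg
  refine Exec.step (c' := (60 * s.nat 24 0 + 80) * s.nat 24 0 + 10) ?_
    (by simp only [Prog.bound, setn, NatExpr.cost]; omega)
  rw [wp_setn]
  -- The invariant is conditional: the result cell is correct once a correct candidate has been
  -- tried. That one exists comes from `exists_isSel` at the end.
  refine Exec.for (N := s.nat 24 0) (c := 60 * s.nat 24 0 + 70)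
      (fun i s' => Same [18, 19, 20, 22] [31, 32] s s' ∧ s'.nat 22 0 = i ∧
      ((∃ i' < i, IsSel (seg (s.real 30) (s.nat 23 0) (s.nat 24 0)) (s.nat 25 0)
        (s.real 30 (s.nat 23 0 + i'))) →
        IsSel (seg (s.real 30) (s.nat 23 0) (s.nat 24 0)) (s.nat 25 0) (s'.real 32 0)))
      ?_ ?_ ?_ ?_ ?_
  · refine ⟨(Same.refl _ _ s).writeNat (by decide), ?_, ?_⟩ <;> simp [writeNat_nat, NatExpr.eval]
  · rintro i s' hi ⟨hs, h22, -⟩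
    simp [Test.Holds, h22, hs.1 24]
  · rintro i s' hi ⟨hs, h22, hsel⟩
    refine Exec.step (c' := 60 * s.nat 24 0 + 60) ?_
      (by simp only [Prog.bound, setr, nv, NatExpr.cost, RealExpr.cost]; omega)
    rw [wp_setr]
    have e1 := hs.1 23 (by decide)
    have e2 := hs.1 24 (by decide)
    have e3 := hs.1 25 (by decide)
    have e4 := hs.2 30 (by decide)
    refine Exec.seq (countProg_spec _) ?_ (c₂ := 30)
      (by simp only [writeReal_nat, e2]; omega)
    rintro s₁ ⟨h₁, h19, h20⟩
    rw [writeReal_real_ne (b := 30) (by decide), writeReal_nat, e1, e2, e4] at h19 h20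
    simp only [writeReal_real, RealExpr.eval, NatExpr.eval, nv_eval, e1, e4, h22, if_true]
      at h19 h20
    have f1 := h₁.1 25 (by decide)
    have f2 := h₁.1 22 (by decide)
    have f3 := h₁.2 31 (by decide)
    have f4 := h₁.2 32 (by decide)
    have hs₁ : Same [18, 19, 20, 22] [31, 32] s s₁ :=
      (hs.writeReal (by decide)).trans (h₁.mono (by decide) (by decide))
    refine Exec.of_wp (by decide) ?_
    simp only [wp, wp_setn, wp_setr, Test.Holds, NatExpr.eval, nv_eval, rv_eval, not_lt]
    refine ⟨fun h => ⟨(hs₁.writeReal (by decide)).writeNat (by decide), ?_, fun _ => ?_⟩,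
      fun h => ⟨hs₁.writeNat (by decide), ?_, ?_⟩⟩
    · simp [writeNat_nat, f2, h22]
    · simp only [writeReal_nat, e3, f1, h19, h20] at h
      have h : IsSel _ _ _ := h
      simpa [writeReal_real, f3, RealExpr.eval, NatExpr.eval, e1, e4, h22] using h
    · simp [writeNat_nat, f2, h22]
    · rintro ⟨i', hi', hi''⟩
      simp only [writeReal_nat, e3, f1, h19, h20] at h
      have : i' < i := by
        rcases Nat.lt_succ_iff_lt_or_eq.1 hi' with h' | rfl
        · exact h'
        · exact absurd hi'' h
      simpa [writeReal_real, f4] using hsel ⟨i', this, hi''⟩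
  · rintro s' ⟨hs, -, h⟩
    refine ⟨hs, h ?_⟩
    obtain ⟨v, hv, hsel⟩ := exists_isSel (seg (s.real 30) (s.nat 23 0) (s.nat 24 0)) (s.nat 25 0)
      (by simpa using hr)
    obtain ⟨i, hi, rfl⟩ := mem_seg.1 hv
    exact ⟨i, hi, hsel⟩
  · simp only [Test.cost, NatExpr.cost, nv]; ring_nf; omega

/-- Half of a number. -/
def halfProg (x y : ℕ) : Prog :=
  .seq (setn y (.const 0)) <|
  .loop (.natLt (.add (.add (nv y) (nv y)) (.const 1)) (nv x)) <| setn y (.add (nv y) (.const 1))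

/-- The machine cannot divide integers, so the half is counted up; `2 y + 1 < x` is equivalent to `y
< x / 2` with rounding down. -/
theorem halfProg_spec (s : State) (x y : ℕ) (hxy : x ≠ y) :
    Exec (halfProg x y) s (30 * s.nat x 0 + 20) (fun s' =>
      Same [y] [] s s' ∧ s'.nat y 0 = s.nat x 0 / 2) := by
  refine Exec.step (c' := 30 * s.nat x 0 + 15) ?_
    (by simp only [Prog.bound, setn, NatExpr.cost]; omega)
  rw [wp_setn]
  refine Exec.for (N := s.nat x 0 / 2) (c := 10)
    (fun i s' => Same [y] [] s s' ∧ s'.nat y 0 = i) ?_ ?_ ?_ (fun s' h => h) ?_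
  · exact ⟨(Same.refl _ _ s).writeNat (by simp), by simp [writeNat_nat, NatExpr.eval]⟩
  · rintro i s' hi ⟨hs, h⟩
    simp only [Test.Holds, NatExpr.eval, nv_eval, h, hs.1 x (by simpa using hxy)]
    omega
  · rintro i s' hi ⟨hs, h⟩
    refine Exec.of_wp (by simp [Prog.bound, setn, nv, NatExpr.cost]) ?_
    rw [wp_setn]
    exact ⟨hs.writeNat (by simp), by simp [writeNat_nat, NatExpr.eval, h]⟩
  · simp only [Test.cost, NatExpr.cost, nv]; omega

/-- In place compaction of the current segment: only the entries passing the test are kept.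
The test may refer to the counter `18`. -/
def compactProg (b : Test) : Prog :=
  .seq (.seq (setn 18 (.const 0)) (setn 21 (.const 0))) <|
  .loop (.natLt (nv 18) (nv 16)) <|
    .seq (.cond b
      (.seq (.setReal 30 (.add (nv 15) (nv 21)) (.get 30 (.add (nv 15) (nv 18))))
        (setn 21 (.add (nv 21) (.const 1)))) .skip) <|
    setn 18 (.add (nv 18) (.const 1))

theorem compactProg_spec (b : Test) (p : ℝ → Bool) (s : State) (hcost : b.cost ≤ 20)
    (hb : ∀ s', Same [18, 21] [30] s s' →
      (b.Holds s' ↔ p (s'.real 30 (s.nat 15 0 + s'.nat 18 0)) = true)) :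
    Exec (compactProg b) s (60 * s.nat 16 0 + 20) (fun s' => Same [18, 21] [30] s s' ∧
      seg (s'.real 30) (s.nat 15 0) (s'.nat 21 0) =
        (seg (s.real 30) (s.nat 15 0) (s.nat 16 0)).filter p ∧
      ∀ i < s.nat 15 0, s'.real 30 i = s.real 30 i) := by
  refine Exec.step (c' := 60 * s.nat 16 0 + 10) ?_
    (by simp only [Prog.bound, setn, NatExpr.cost]; omega)
  simp only [wp, wp_setn]
  -- The write position never overtakes the read position, so entries not yet read are still the
  -- original ones.
  refine Exec.for (N := s.nat 16 0) (c := 20 + 30) (fun i s' => Same [18, 21] [30] s s' ∧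
      s'.nat 18 0 = i ∧ s'.nat 21 0 ≤ i ∧
      seg (s'.real 30) (s.nat 15 0) (s'.nat 21 0) = (seg (s.real 30) (s.nat 15 0) i).filter p ∧
      (∀ j < s.nat 15 0, s'.real 30 j = s.real 30 j) ∧
      (∀ j, s.nat 15 0 + i ≤ j → s'.real 30 j = s.real 30 j)) ?_ ?_ ?_ ?_ ?_
  · refine ⟨((Same.refl _ _ s).writeNat (by decide)).writeNat (by decide), ?_⟩
    simp [writeNat_nat, NatExpr.eval]
  · rintro i s' hi ⟨hs, h18, -⟩
    simp [Test.Holds, h18, hs.1 16]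
  · rintro i s' hi ⟨hs, h18, h21, hseg, hlo, hhi⟩
    refine Exec.of_wp (by simp [Prog.bound, setn, nv, NatExpr.cost, RealExpr.cost]; omega) ?_
    have e1 := hs.1 15 (by decide)
    have hbs := hb s' hs
    rw [h18, hhi _ le_rfl] at hbs
    simp only [wp, wp_setn, hbs, filter_seg_succ]
    refine ⟨fun h => ⟨?_, ?_, ?_, ?_, ?_, ?_⟩, fun h => ⟨?_, ?_, ?_, ?_, ?_, ?_⟩⟩
    · exact ((hs.writeReal (by decide)).writeNat (by decide)).writeNat (by decide)
    · simp [writeNat_nat, NatExpr.eval, h18]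
    · simp [writeNat_nat, NatExpr.eval, h21]
    · simp only [h, if_true, writeNat_nat, NatExpr.eval, RealExpr.eval, writeNat_real, nv_eval,
        writeReal_nat, e1, h18]
      simp only [show (18:ℕ) ≠ 21 by decide, show (21:ℕ) ≠ 18 by decide, if_false]
      rw [seg_succ, ← hseg]
      congr 1
      · refine seg_congr (fun j hj => ?_)
        simp [writeReal_real]; omega
      · simp [writeReal_real, hhi]
    · intro j hj
      simp only [writeNat_real, writeReal_real, NatExpr.eval, nv_eval, e1, if_true]
      rw [if_neg (by omega), hlo j hj]
    · intro j hj
      simp only [writeNat_real, writeReal_real, NatExpr.eval, nv_eval, e1, if_true]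
      rw [if_neg (by omega), hhi j (by omega)]
    · exact hs.writeNat (by decide)
    · simp [writeNat_nat, NatExpr.eval, h18]
    · simp [writeNat_nat, NatExpr.eval]; omega
    · simp [writeNat_nat, NatExpr.eval, h, hseg]
    · exact hlo
    · exact fun j hj => hhi j (by omega)
  · rintro s' ⟨hs, -, -, h, h', -⟩
    exact ⟨hs, h, h'⟩
  · simp only [Test.cost, NatExpr.cost, nv]; omega

/-- Writes the medians of groups of five of the current segment behind that segment. -/
def mediansProg : Prog :=
  .seq (.seq (setn 26 (.const 0)) <| .seq (setn 24 (.const 5)) (setn 25 (.const 2))) <|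
  .loop (.natLt (.add (.const 4) (.add (nv 26) (.add (nv 26) (.add (nv 26)
      (.add (nv 26) (nv 26)))))) (nv 16)) <|
    .seq (setn 23 (.add (nv 15) (.add (nv 26) (.add (nv 26) (.add (nv 26)
      (.add (nv 26) (nv 26))))))) <|
    .seq bruteProg <|
    .seq (.setReal 30 (.add (.add (nv 15) (nv 16)) (nv 26)) (rv 32)) <|
    setn 26 (.add (nv 26) (.const 1))

theorem mediansProg_spec (s : State) :
    Exec mediansProg s (2100 * s.nat 16 0 + 50) (fun s' =>
      Same [18, 19, 20, 22, 23, 24, 25, 26] [30, 31, 32] s s' ∧ s'.nat 26 0 = s.nat 16 0 / 5 ∧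
      (∀ i < s.nat 15 0 + s.nat 16 0, s'.real 30 i = s.real 30 i) ∧
      GroupMedians (s.real 30) (s.nat 15 0) (s'.real 30) (s.nat 15 0 + s.nat 16 0)
        (s.nat 16 0 / 5)) := by
  refine Exec.step (c' := 2100 * s.nat 16 0 + 30) ?_
    (by simp only [Prog.bound, setn, NatExpr.cost]; omega)
  simp only [wp, wp_setn]
  refine Exec.for (N := s.nat 16 0 / 5) (c := 2100) (fun i s' =>
      Same [18, 19, 20, 22, 23, 24, 25, 26] [30, 31, 32] s s' ∧ s'.nat 26 0 = i ∧
      (s'.nat 24 0 = 5 ∧ s'.nat 25 0 = 2) ∧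
      (∀ i < s.nat 15 0 + s.nat 16 0, s'.real 30 i = s.real 30 i) ∧
      GroupMedians (s.real 30) (s.nat 15 0) (s'.real 30) (s.nat 15 0 + s.nat 16 0) i)
      ?_ ?_ ?_ ?_ ?_
  · refine ⟨(((Same.refl _ _ s).writeNat (by decide)).writeNat (by decide)).writeNat (by decide), ?_⟩
    simp [writeNat_nat, NatExpr.eval, GroupMedians]
  · rintro i s' hi ⟨hs, h26, -⟩
    simp only [Test.Holds, NatExpr.eval, nv_eval, h26, hs.1 16 (by decide)]
    omega
  · rintro i s' hi ⟨hs, h26, ⟨h24, h25⟩, hlo, hg⟩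
    -- Brute force on five entries costs at most `(60 * 5 + 80) * 5 + 20 = 1920`.
    refine Exec.step (c' := 2050) ?_ (by decide)
    rw [wp_setn]
    have e15 := hs.1 15 (by decide)
    have e16 := hs.1 16 (by decide)
    refine Exec.seq (bruteProg_spec _ ?_) ?_ (c₂ := 30) ?_
    · simp [writeNat_nat, h24, h25]
    · rintro s₁ ⟨h₁, hsel⟩
      simp [writeNat_nat, NatExpr.eval, h24, h25, e15, h26] at hsel
      have f15 := h₁.1 15 (by decide)
      have f16 := h₁.1 16 (by decide)
      have f24 := h₁.1 24 (by decide)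
      have f25 := h₁.1 25 (by decide)
      have f26 := h₁.1 26 (by decide)
      have f30 := h₁.2 30 (by decide)
      refine Exec.of_wp (by decide) ?_
      simp only [wp, wp_setn]
      refine ⟨?_, ?_, ⟨?_, ?_⟩, ?_, ?_⟩
      · exact (((hs.writeNat (by decide)).trans (h₁.mono (by decide) (by decide))).writeReal
          (by decide)).writeNat (by decide)
      · simp [writeNat_nat, NatExpr.eval, f26, h26]
      · simp [writeNat_nat, f24, h24]
      · simp [writeNat_nat, f25, h25]
      · intro j hj
        simp [writeReal_real, writeNat_nat, NatExpr.eval, f15, f16, f26, f30, h26, e15, e16]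
        rw [if_neg (by omega), hlo j hj]
      · intro g hg'
        simp [writeReal_real, writeNat_nat, NatExpr.eval, f15, f16, f26, f30, h26, e15, e16]
        rcases Nat.lt_succ_iff_lt_or_eq.1 hg' with h | rfl
        · rw [if_neg (by omega)]; exact hg g h
        · rw [if_pos rfl]
          convert hsel using 1
          rw [show g + (g + (g + (g + g))) = 5 * g by ring]
          exact seg_congr (fun j hj => (hlo _ (by omega)).symm)
    · simp [writeNat_nat, h24]
  · rintro s' ⟨hs, h26, -, h, h'⟩
    exact ⟨hs, h26, h, h'⟩
  · simp only [Test.cost, NatExpr.cost, nv]; omega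
/-- The call phase: small segments are handled by brute force, for large ones a call on the medians
of the groups of five is pushed. -/
def callProg : Prog :=
  .cond (.natLt (nv 16) (.const 40))
    (.seq (.seq (setn 23 (nv 15)) <| .seq (setn 24 (nv 16)) (setn 25 (nv 17))) <|
      .seq bruteProg <| .seq (setn 10 (.sub (nv 10) (.const 1))) (setn 11 (.const 1)))
    (.seq mediansProg <| .seq (halfProg 26 28) <|
      .seq (setn 10 (.add (nv 10) (.const 1))) <|
      .seq (.setNat 12 (nv 10) (.add (nv 15) (nv 16))) <|
      .seq (.setNat 13 (nv 10) (nv 26)) (.setNat 14 (nv 10) (nv 28)))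

/-- The return phase: partition by the returned pivot. -/
def returnProg : Prog :=
  .seq (.seq (setr 31 (rv 32)) <| .seq (setn 23 (nv 15)) (setn 24 (nv 16))) <|
  .seq countProg <|
  .cond (.natLt (nv 17) (nv 19))
    (.seq (compactProg (.realLt (.get 30 (.add (nv 15) (nv 18))) (rv 31))) <|
      .seq (.setNat 13 (nv 10) (nv 19)) (setn 11 (.const 0)))
    (.cond (.natLt (nv 17) (nv 20)) (setn 10 (.sub (nv 10) (.const 1)))
      (.seq (compactProg (.realLt (rv 31) (.get 30 (.add (nv 15) (nv 18))))) <|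
        .seq (.setNat 13 (nv 10) (.sub (nv 16) (nv 20))) <|
        .seq (.setNat 14 (nv 10) (.sub (nv 17) (nv 20))) (setn 11 (.const 0))))

def loadProg : Prog :=
  .seq (setn 15 (.get 12 (nv 10))) <| .seq (setn 16 (.get 13 (nv 10))) (setn 17 (.get 14 (nv 10)))

def selBody : Prog :=
  .seq loadProg <| .cond (.natLt (nv 11) (.const 1)) callProg returnProg

/-- The integer arrays used by selection. -/
def selNats : List ℕ := [10, 11, 12, 13, 14, 15, 16, 17, 18, 19, 20, 21, 22, 23, 24, 25, 26, 28]

/-- The frame at height `d` asks for rank `r` in the segment of length `l` at base `b`. -/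
def Frame (s : State) (d b l r : ℕ) : Prop :=
  s.nat 10 0 = d ∧ s.nat 12 d = b ∧ s.nat 13 d = l ∧ s.nat 14 d = r

/-- What selection leaves untouched: frames below height `d` and entries below `b`. -/
def Keeps (d b : ℕ) (s s' : State) : Prop :=
  Same selNats [30, 31, 32] s s' ∧
  (∀ i < d, s'.nat 12 i = s.nat 12 i ∧ s'.nat 13 i = s.nat 13 i ∧ s'.nat 14 i = s.nat 14 i) ∧
  ∀ i < b, s'.real 30 i = s.real 30 i

theorem Keeps.trans {d b d' b' : ℕ} {s s' s'' : State} (h : Keeps d b s s') (h' : Keeps d' b' s' s'')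
    (hd : d ≤ d') (hb : b ≤ b') : Keeps d b s s'' := by
  refine ⟨h.1.trans h'.1, fun i hi => ?_, fun i hi => ?_⟩
  · obtain ⟨a, b, c⟩ := h.2.1 i hi
    obtain ⟨a', b', c'⟩ := h'.2.1 i (by omega)
    exact ⟨a'.trans a, b'.trans b, c'.trans c⟩
  · exact (h'.2.2 i (by omega)).trans (h.2.2 i hi)

theorem loadProg_spec {s : State} {d b l r : ℕ} (h : Frame s d b l r) :
    Exec loadProg s 20 (fun s' => Same [15, 16, 17] [] s s' ∧
      s'.nat 15 0 = b ∧ s'.nat 16 0 = l ∧ s'.nat 17 0 = r) := by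
  obtain ⟨h1, h2, h3, h4⟩ := h
  refine Exec.of_wp (by decide) ?_
  simp only [wp, loadProg, wp_setn]
  refine ⟨(((Same.refl _ _ s).writeNat (by decide)).writeNat (by decide)).writeNat (by decide), ?_⟩
  simp [writeNat_nat, NatExpr.eval, h1, h2, h3, h4]

theorem Keeps.of_same {s s' : State} {d b : ℕ} {N : List ℕ} (h : Same N [31, 32] s s')
    (hN : N ⊆ selNats := by decide) (h1 : 12 ∉ N := by decide) (h2 : 13 ∉ N := by decide)
    (h3 : 14 ∉ N := by decide) : Keeps d b s s' :=
  ⟨h.mono hN (by decide), fun i _ => ⟨by rw [h.1 _ h1], by rw [h.1 _ h2], by rw [h.1 _ h3]⟩,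
    fun i _ => by rw [h.2 30 (by decide)]⟩

theorem selBody_small {s : State} {d b l r : ℕ} (h : Frame s (d + 1) b l r) (h11 : s.nat 11 0 = 0)
    (hr : r < l) (hl : l < 40) :
    Exec selBody s 150000 (fun s' => Keeps (d + 1) b s s' ∧ s'.nat 10 0 = d ∧ s'.nat 11 0 = 1 ∧
      IsSel (seg (s.real 30) b l) r (s'.real 32 0)) := by
  refine Exec.seq (loadProg_spec h) ?_ (c₂ := 140000) (by norm_num)
  rintro s₁ ⟨h₁, h15, h16, h17⟩
  refine Exec.cond ?_ ?_ (c' := 130000) (by decide)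
  swap
  · intro hn; exact absurd (by simp [Test.Holds, NatExpr.eval, h₁.1 11, h11]) hn
  intro _
  refine Exec.cond ?_ ?_ (c' := 120000) (by decide)
  swap
  · intro hn; exact absurd (by simpa [Test.Holds, NatExpr.eval, h16] using hl) hn
  intro _
  refine Exec.step (c' := 110000) ?_ (by decide)
  simp only [wp, wp_setn]
  refine Exec.seq (bruteProg_spec _ ?_) ?_ (c₂ := 20) ?_
  · simpa [writeNat_nat, h16, h17] using hr
  · rintro s₂ ⟨h₂, hsel⟩
    refine Exec.of_wp (by decide) ?_
    simp only [wp, wp_setn]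
    simp [writeNat_nat, h15, h16, h17, h₁.2 30] at hsel
    have hS : Same [10, 11, 15, 16, 17, 18, 19, 20, 22, 23, 24, 25] [31, 32] s s₂ :=
      ((((h₁.mono (by decide) (by decide)).writeNat (by decide)).writeNat (by decide)).writeNat
        (by decide)).trans (h₂.mono (by decide) (by decide))
    refine ⟨Keeps.of_same ((hS.writeNat (by decide)).writeNat (by decide)), ?_, ?_, ?_⟩
    · simp [writeNat_nat, NatExpr.eval, h₂.1 10, h₁.1 10, h.1]
    · simp [writeNat_nat, NatExpr.eval]
    · simpa using hsel
  · simp [writeNat_nat, h16]; nlinarith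

/-- The medians are stored behind the current segment and the new frame is placed above the current
one, so the call on the medians leaves the caller's segment and frame intact. -/
theorem selBody_push {s : State} {d b l r : ℕ} (h : Frame s (d + 1) b l r) (h11 : s.nat 11 0 = 0)
    (hl : 40 ≤ l) :
    Exec selBody s (3000 * l) (fun s' => Keeps (d + 2) (b + l) s s' ∧
      Frame s' (d + 2) (b + l) (l / 5) (l / 5 / 2) ∧ s'.nat 11 0 = 0 ∧
      GroupMedians (s.real 30) b (s'.real 30) (b + l) (l / 5)) := by
  refine Exec.seq (loadProg_spec h) ?_ (c₂ := 2900 * l) (by omega)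
  rintro s₁ ⟨h₁, h15, h16, h17⟩
  refine Exec.cond ?_ ?_ (c' := 2800 * l) (by simp only [Test.cost, nv, NatExpr.cost]; omega)
  swap
  · intro hn; exact absurd (by simp [Test.Holds, NatExpr.eval, h₁.1 11, h11]) hn
  intro _
  refine Exec.cond ?_ ?_ (c' := 2700 * l) (by simp only [Test.cost, nv, NatExpr.cost]; omega)
  · intro hn; simp [Test.Holds, NatExpr.eval, h16] at hn; omega
  intro _
  refine Exec.seq (mediansProg_spec _) ?_ (c₂ := 500 * l) (by omega)
  rintro s₂ ⟨h₂, h26, hlo, hg⟩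
  simp only [h15, h16, h₁.2 30 (by decide)] at h26 hlo hg
  refine Exec.seq (halfProg_spec _ 26 28 (by decide)) ?_ (c₂ := 100) (by omega)
  rintro s₃ ⟨h₃, h28⟩
  refine Exec.of_wp (by decide) ?_
  simp only [wp, wp_setn]
  have f10 : s₃.nat 10 0 = d + 1 := by
    rw [h₃.1 10 (by decide), h₂.1 10 (by decide), h₁.1 10 (by decide), h.1]
  have f11 : s₃.nat 11 0 = 0 := by
    rw [h₃.1 11 (by decide), h₂.1 11 (by decide), h₁.1 11 (by decide), h11]
  have f15 : s₃.nat 15 0 = b := by rw [h₃.1 15 (by decide), h₂.1 15 (by decide), h15]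
  have f16 : s₃.nat 16 0 = l := by rw [h₃.1 16 (by decide), h₂.1 16 (by decide), h16]
  have f26 : s₃.nat 26 0 = l / 5 := by rw [h₃.1 26 (by decide), h26]
  have f30 : s₃.real 30 = s₂.real 30 := h₃.2 30 (by decide)
  have f12 : s₃.nat 12 = s.nat 12 := by
    rw [h₃.1 12 (by decide), h₂.1 12 (by decide), h₁.1 12 (by decide)]
  have f13 : s₃.nat 13 = s.nat 13 := by
    rw [h₃.1 13 (by decide), h₂.1 13 (by decide), h₁.1 13 (by decide)]
  have f14 : s₃.nat 14 = s.nat 14 := by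
    rw [h₃.1 14 (by decide), h₂.1 14 (by decide), h₁.1 14 (by decide)]
  refine ⟨⟨?_, ?_, ?_⟩, ⟨?_, ?_, ?_, ?_⟩, ?_, ?_⟩
  · refine Same.writeNat (Same.writeNat (Same.writeNat (Same.writeNat ?_ (by decide)) (by decide))
      (by decide)) (by decide)
    exact (h₁.mono (by decide) (by decide)).trans
      ((h₂.mono (by decide) (by decide)).trans (h₃.mono (by decide) (by decide)))
  · intro i hi
    have : i ≠ d + 2 := by omega
    simp [writeNat_nat, NatExpr.eval, f10, f12, f13, f14, this]
  · intro i hi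
    simp only [writeNat_real, f30, hlo i hi]
  · simp [writeNat_nat, NatExpr.eval, f10]
  · simp [writeNat_nat, NatExpr.eval, f10, f15, f16]
  · simp [writeNat_nat, NatExpr.eval, f10, f26]
  · simp [writeNat_nat, NatExpr.eval, f10, h28, h26]
  · simp [writeNat_nat, f11]
  · simpa [f30] using hg

/-- Either the pivot is the answer and the frame is popped, or the frame is overwritten by the
request for one side of the pivot, a tail call at the same stack height. -/
theorem selBody_return {s : State} {d b l r : ℕ} (h : Frame s (d + 1) b l r)
    (h11 : s.nat 11 0 = 1) (hr : r < l) :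
    Exec selBody s (500 * l) (fun s' => Keeps (d + 1) b s s' ∧
      ((s'.nat 10 0 = d ∧ s'.nat 11 0 = 1 ∧ IsSel (seg (s.real 30) b l) r (s'.real 32 0)) ∨
      ∃ l' r', Frame s' (d + 1) b l' r' ∧ s'.nat 11 0 = 0 ∧ r' < l' ∧
        (l' = (seg (s.real 30) b l).countP (fun x => decide (x < s.real 32 0)) ∨
          l' = (seg (s.real 30) b l).countP (fun x => decide (s.real 32 0 < x))) ∧
        ∀ v, IsSel (seg (s'.real 30) b l') r' v → IsSel (seg (s.real 30) b l) r v)) := by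
  refine Exec.seq (loadProg_spec h) ?_ (c₂ := 450 * l) (by omega)
  rintro s₁ ⟨h₁, h15, h16, h17⟩
  refine Exec.cond ?_ ?_ (c' := 440 * l) (by simp only [Test.cost, nv, NatExpr.cost]; omega)
  · intro hn; simp [Test.Holds, NatExpr.eval, h₁.1 11, h11] at hn
  intro _
  refine Exec.step (c' := 420 * l) ?_ (by simp [Prog.bound, setn, setr, nv, rv, NatExpr.cost, RealExpr.cost]; omega)
  simp only [wp, wp_setn, wp_setr]
  refine Exec.seq (countProg_spec _) ?_ (c₂ := 320 * l) (by simp [writeNat_nat, h16]; omega)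
  rintro s₂ ⟨h₂, h19, h20⟩
  simp only [writeNat_real] at h19 h20
  rw [writeReal_real_ne (b := 30) (by decide), h₁.2 30 (by decide)] at h19 h20
  simp [writeNat_nat, writeReal_real, h15, h16, h₁.2 32] at h19 h20
  have f10 : s₂.nat 10 0 = d + 1 := by
    rw [h₂.1 10 (by decide)]; simp [writeNat_nat, h₁.1 10, h.1]
  have f11 : s₂.nat 11 0 = 1 := by
    rw [h₂.1 11 (by decide)]; simp [writeNat_nat, h₁.1 11, h11]
  have f15 : s₂.nat 15 0 = b := by rw [h₂.1 15 (by decide)]; simp [writeNat_nat, h15]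
  have f16 : s₂.nat 16 0 = l := by rw [h₂.1 16 (by decide)]; simp [writeNat_nat, h16]
  have f17 : s₂.nat 17 0 = r := by rw [h₂.1 17 (by decide)]; simp [writeNat_nat, h17]
  have f30 : s₂.real 30 = s.real 30 := by
    rw [h₂.2 30 (by decide), writeNat_real, writeNat_real, writeReal_real_ne (by decide),
      h₁.2 30 (by decide)]
  have f31 : s₂.real 31 0 = s.real 32 0 := by
    rw [h₂.2 31 (by decide)]; simp [writeReal_real, h₁.2 32]
  have f32 : s₂.real 32 = s.real 32 := by
    rw [h₂.2 32 (by decide), writeNat_real, writeNat_real, writeReal_real_ne (by decide),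
      h₁.2 32 (by decide)]
  have hS : Same [15, 16, 17, 18, 19, 20, 23, 24] [31] s s₂ :=
    ((((h₁.mono (by decide) (by decide)).writeReal (by decide)).writeNat (by decide)).writeNat
      (by decide)).trans (h₂.mono (by decide) (by decide))
  have f12 : s₂.nat 12 = s.nat 12 := hS.1 12 (by decide)
  have f13 : s₂.nat 13 = s.nat 13 := hS.1 13 (by decide)
  have f14 : s₂.nat 14 = s.nat 14 := hS.1 14 (by decide)
  obtain ⟨-, g12, g13, g14⟩ := h
  refine Exec.cond ?_ ?_ (c' := 300 * l) (by simp only [Test.cost, nv, NatExpr.cost]; omega)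
  · intro hlt
    simp only [Test.Holds, nv_eval, f17, h19] at hlt
    refine Exec.seq (compactProg_spec _ (fun x => decide (x < s.real 32 0)) _ (by decide) ?_) ?_
      (c₂ := 50) (by rw [f16]; omega)
    · intro s' hs'
      simp [Test.Holds, RealExpr.eval, NatExpr.eval, hs'.1 15, hs'.2 31, f31]
    rintro s₃ ⟨h₃, hseg, hlo⟩
    rw [f15, f16, f30] at hseg
    have hlen := congrArg List.length hseg
    rw [seg_length, ← List.countP_eq_length_filter] at hlen
    have k10 : s₃.nat 10 0 = d + 1 := by rw [h₃.1 10 (by decide), f10]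
    have k19 := h₃.1 19 (by decide)
    refine Exec.of_wp (by decide) ?_
    simp only [wp, wp_setn]
    refine ⟨⟨?_, ?_, ?_⟩, Or.inr ⟨s₃.nat 21 0, r, ⟨?_, ?_, ?_, ?_⟩, ?_, ?_, Or.inl hlen, ?_⟩⟩
    · exact (((hS.mono (by decide) (by decide)).trans (h₃.mono (by decide) (by decide))).writeNat
        (by decide)).writeNat (by decide)
    · intro i hi
      simp [writeNat_nat, k10, h₃.1 12, h₃.1 13, h₃.1 14, f12, f13, f14, hi.ne]
    · intro i hi
      simp [hlo i (by omega), f30]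
    · simp [writeNat_nat, k10]
    · simp [writeNat_nat, h₃.1 12, f12, g12]
    · simp [writeNat_nat, k10, k19, h19, hlen]
    · simp [writeNat_nat, h₃.1 14, f14, g14]
    · simp [writeNat_nat, NatExpr.eval]
    · omega
    · intro v hv
      simp only [writeNat_real, hseg] at hv
      exact hv.of_filter_lt hlt
  · intro hlt
    simp only [Test.Holds, nv_eval, f17, h19] at hlt
    refine Exec.cond ?_ ?_ (c' := 250 * l) (by simp only [Test.cost, nv, NatExpr.cost]; omega)
    · intro hle
      simp only [Test.Holds, nv_eval, f17, h20] at hle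
      refine Exec.of_wp (by simp only [Prog.bound, setn, nv, NatExpr.cost]; omega) ?_
      rw [wp_setn]
      refine ⟨Keeps.of_same (Same.writeNat (N := [10, 15, 16, 17, 18, 19, 20, 23, 24])
        (hS.mono (by decide) (by decide)) (by decide)), Or.inl ⟨?_, ?_, ?_⟩⟩
      · simp [writeNat_nat, NatExpr.eval, f10]
      · simp [writeNat_nat, f11]
      · simp only [writeNat_real, f32]
        exact ⟨not_lt.1 hlt, hle⟩
    · intro hle
      simp only [Test.Holds, nv_eval, f17, h20, not_lt] at hle
      refine Exec.seq (compactProg_spec _ (fun x => decide (s.real 32 0 < x)) _ (by decide) ?_) ?_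
        (c₂ := 50) (by rw [f16]; omega)
      · intro s' hs'
        simp [Test.Holds, RealExpr.eval, NatExpr.eval, hs'.1 15, hs'.2 31, f31]
      rintro s₃ ⟨h₃, hseg, hlo⟩
      rw [f15, f16, f30] at hseg
      have hlen := congrArg List.length hseg
      rw [seg_length, ← List.countP_eq_length_filter] at hlen
      have k10 : s₃.nat 10 0 = d + 1 := by rw [h₃.1 10 (by decide), f10]
      have k16 := h₃.1 16 (by decide)
      have k17 := h₃.1 17 (by decide)
      have k20 := h₃.1 20 (by decide)
      have hc := countP_le_add_countP_gt (seg (s.real 30) b l) (s.real 32 0)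
      rw [seg_length] at hc
      refine Exec.of_wp (by decide) ?_
      simp only [wp, wp_setn]
      refine ⟨⟨?_, ?_, ?_⟩, Or.inr ⟨s₃.nat 21 0, r - s₂.nat 20 0, ⟨?_, ?_, ?_, ?_⟩, ?_, ?_,
        Or.inr hlen, ?_⟩⟩
      · exact ((((hS.mono (by decide) (by decide)).trans (h₃.mono (by decide) (by decide))).writeNat
          (by decide)).writeNat (by decide)).writeNat (by decide)
      · intro i hi
        simp [writeNat_nat, k10, h₃.1 12, h₃.1 13, h₃.1 14, f12, f13, f14, hi.ne]
      · intro i hi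
        simp [hlo i (by omega), f30]
      · simp [writeNat_nat, k10]
      · simp [writeNat_nat, h₃.1 12, f12, g12]
      · simp [writeNat_nat, NatExpr.eval, k10, k16, k20, f16, h20, hlen]; omega
      · simp [writeNat_nat, NatExpr.eval, k10, k17, k20, f17]
      · simp [writeNat_nat, NatExpr.eval]
      · omega
      · intro v hv
        simp only [writeNat_real, hseg, h20] at hv
        exact hv.of_filter_gt hle

def selLoop : Prog := .loop (.natLt (.const 0) (nv 10)) selBody

/-- A recursive call is a stretch of iterations of one single loop. Its cost is therefore stated
relative to an arbitrary run of the loop that follows it; this lemma prepends one iteration to such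
a run. -/
theorem selLoop_iter {s s' s'' : State} {c t t' : ℕ} {d : ℕ} (hd : s.nat 10 0 = d + 1)
    (hr : Run selBody s t s') (ht : t ≤ c) (h' : Run selLoop s' t' s'') :
    ∃ t₁, t₁ ≤ c + 10 ∧ Run selLoop s (t₁ + t') s'' :=
  ⟨_, by simp only [Test.cost, nv, NatExpr.cost]; omega,
    .loopTrue (by simp [Test.Holds, NatExpr.eval, hd]) hr h'⟩

/-- A call on a segment of length `l` takes time linear in `l`. -/
theorem selLoop_call (l : ℕ) : ∀ (s : State) (d b r : ℕ), Frame s (d + 1) b l r → s.nat 11 0 = 0 →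
    r < l → ∃ s', Keeps (d + 1) b s s' ∧ s'.nat 10 0 = d ∧ s'.nat 11 0 = 1 ∧
      IsSel (seg (s.real 30) b l) r (s'.real 32 0) ∧
      ∀ t' s'', Run selLoop s' t' s'' → ∃ t, t ≤ 200000 * l ∧ Run selLoop s (t + t') s'' := by
  induction l using Nat.strong_induction_on with
  | _ l ih =>
  intro s d b r hF h11 hr
  rcases lt_or_ge l 40 with hl | hl
  · obtain ⟨t, s', hrun, ht, hk, h10, h11', hsel⟩ := selBody_small hF h11 hr hl
    refine ⟨s', hk, h10, h11', hsel, fun t' s'' h => ?_⟩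
    obtain ⟨t₁, ht₁, hr₁⟩ := selLoop_iter hF.1 hrun ht h
    exact ⟨t₁, by omega, hr₁⟩
  obtain ⟨t₁, s₁, hrun₁, ht₁, hk₁, hF₁, h11₁, hg⟩ := selBody_push hF h11 hl
  obtain ⟨s₂, hk₂, h10₂, h11₂, hsel₂, hcont₂⟩ := ih (l / 5) (by omega) s₁ (d + 1) (b + l) _ hF₁ h11₁
    (by omega)
  have hk12 : Keeps (d + 2) (b + l) s s₂ := hk₁.trans hk₂ le_rfl le_rfl
  have hF₂ : Frame s₂ (d + 1) b l r := by
    obtain ⟨-, g12, g13, g14⟩ := hF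
    obtain ⟨a, b, c⟩ := hk12.2.1 (d + 1) (by omega)
    exact ⟨h10₂, a.trans g12, b.trans g13, c.trans g14⟩
  have hseg : seg (s₂.real 30) b l = seg (s.real 30) b l :=
    seg_congr (fun i hi => hk12.2.2 _ (by omega))
  have hpiv := hg.pivot hsel₂
  obtain ⟨t₃, s₃, hrun₃, ht₃, hk₃, hpost⟩ := selBody_return hF₂ h11₂ hr
  rw [hseg] at hpost
  have hk13 : Keeps (d + 1) b s s₃ := Keeps.trans (d := d + 1) (b := b)
    ⟨hk12.1, fun i hi => hk12.2.1 i (by omega), fun i hi => hk12.2.2 i (by omega)⟩ hk₃ le_rfl le_rfl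
  rcases hpost with ⟨h10, h11', hsel⟩ | ⟨l', r', hF₃, h11₃, hr', hl', hsel'⟩
  · refine ⟨s₃, hk13, h10, h11', hsel, fun t' s'' h => ?_⟩
    obtain ⟨u₃, hu₃, h⟩ := selLoop_iter hF₂.1 hrun₃ ht₃ h
    obtain ⟨u₂, hu₂, h⟩ := hcont₂ _ _ h
    obtain ⟨u₁, hu₁, h⟩ := selLoop_iter hF.1 hrun₁ ht₁ h
    exact ⟨u₁ + (u₂ + u₃), by omega, by rwa [add_assoc, add_assoc]⟩
  -- The recurrence `T l ≤ T (l / 5) + T l' + 3500 l + 20` is solved by `200000 l` for `l ≥ 40`,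
  -- since `1/5 + 7/10 < 1`.
  · have hll : 10 * l' ≤ 7 * l + 12 := by rcases hl' with h | h <;> rw [h] <;> [exact hpiv.1; exact hpiv.2]
    obtain ⟨s₄, hk₄, h10₄, h11₄, hsel₄, hcont₄⟩ := ih l' (by omega) s₃ d b r' hF₃ h11₃ hr'
    refine ⟨s₄, hk13.trans hk₄ le_rfl le_rfl, h10₄, h11₄, hsel' _ hsel₄, fun t' s'' h => ?_⟩
    obtain ⟨u₄, hu₄, h⟩ := hcont₄ _ _ h
    obtain ⟨u₃, hu₃, h⟩ := selLoop_iter hF₂.1 hrun₃ ht₃ h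
    obtain ⟨u₂, hu₂, h⟩ := hcont₂ _ _ h
    obtain ⟨u₁, hu₁, h⟩ := selLoop_iter hF.1 hrun₁ ht₁ h
    exact ⟨u₁ + (u₂ + (u₃ + u₄)), by omega, by rwa [add_assoc, add_assoc, add_assoc]⟩

/-- Selects the element of rank `27` among the first `0` entries of the work space. -/
def selProg : Prog :=
  .seq (.seq (setn 10 (.const 1)) <| .seq (setn 11 (.const 0)) <|
    .seq (.setNat 12 (.const 1) (.const 0)) <| .seq (.setNat 13 (.const 1) (nv 0))
      (.setNat 14 (.const 1) (nv 27))) selLoop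

theorem selProg_spec (s : State) (hr : s.nat 27 0 < s.nat 0 0) :
    Exec selProg s (200100 * s.nat 0 0) (fun s' => Same selNats [30, 31, 32] s s' ∧
      IsSel (seg (s.real 30) 0 (s.nat 0 0)) (s.nat 27 0) (s'.real 32 0)) := by
  refine Exec.step (c' := 200070 * s.nat 0 0) ?_
    (by simp only [Prog.bound, setn, nv, NatExpr.cost]; omega)
  simp only [wp, wp_setn]
  obtain ⟨s', hk, h10, h11, hsel, hcont⟩ := selLoop_call (s.nat 0 0)
    (((((s.writeNat 10 0 1).writeNat 11 0 0).writeNat 12 1 0).writeNat 13 1 (s.nat 0 0)).writeNat 14 1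
      (s.nat 27 0)) 0 0 (s.nat 27 0) (by simp [Frame, writeNat_nat]) (by simp [writeNat_nat]) hr
  obtain ⟨t, ht, hrun⟩ := hcont _ _ (.loopFalse (by simp [Test.Holds, NatExpr.eval, h10]))
  have e : ∀ u : State, NatExpr.eval u (.const 0) = 0 ∧ NatExpr.eval u (.const 1) = 1 :=
    fun u => ⟨rfl, rfl⟩
  simp [e, writeNat_nat]
  refine ⟨_, s', hrun, ?_, ?_, hsel⟩
  · simp only [Test.cost, nv, NatExpr.cost]; omega
  · exact Same.trans (Same.writeNat (Same.writeNat (Same.writeNat (Same.writeNat (Same.writeNat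
      (Same.refl _ _ s) (by decide)) (by decide)) (by decide)) (by decide)) (by decide)) hk.1

end RealRAM

/-! ### Median levels and brackets -/

/-- Height of the point `p` in the direction of slope `t`. -/
def hgt (t : ℝ) (p : ℝ × ℝ) : ℝ := p.2 - t * p.1

/-- Two slopes with a lower and an upper threshold for each. -/
structure LevelBox where
  t₁ : ℝ
  t₂ : ℝ
  lo₁ : ℝ
  lo₂ : ℝ
  hi₁ : ℝ
  hi₂ : ℝ

namespace LevelBox

def Below (B : LevelBox) (p : ℝ × ℝ) : Prop := hgt B.t₁ p < B.lo₁ - 2 ∧ hgt B.t₂ p < B.lo₂ - 2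
def Above (B : LevelBox) (p : ℝ × ℝ) : Prop := B.hi₁ + 2 < hgt B.t₁ p ∧ B.hi₂ + 2 < hgt B.t₂ p
def Kept (B : LevelBox) (p : ℝ × ℝ) : Prop := ¬ B.Below p ∧ ¬ B.Above p
def InHi (B : LevelBox) (p : ℝ × ℝ) : Prop := hgt B.t₁ p ≤ B.hi₁ ∧ hgt B.t₂ p ≤ B.hi₂
def InLo (B : LevelBox) (p : ℝ × ℝ) : Prop := B.lo₁ ≤ hgt B.t₁ p ∧ B.lo₂ ≤ hgt B.t₂ p

noncomputable instance (B : LevelBox) : DecidablePred B.Below :=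
  fun _ => inferInstanceAs (Decidable (_ ∧ _))
noncomputable instance (B : LevelBox) : DecidablePred B.Above :=
  fun _ => inferInstanceAs (Decidable (_ ∧ _))
noncomputable instance (B : LevelBox) : DecidablePred B.Kept :=
  fun _ => inferInstanceAs (Decidable (_ ∧ _))
noncomputable instance (B : LevelBox) : DecidablePred B.InHi :=
  fun _ => inferInstanceAs (Decidable (_ ∧ _))
noncomputable instance (B : LevelBox) : DecidablePred B.InLo :=
  fun _ => inferInstanceAs (Decidable (_ ∧ _))

/-- The bracket certifies that the level of rank `r` stays between its thresholds. -/
def Certifies (B : LevelBox) (L : List (ℝ × ℝ)) (r : ℕ) : Prop :=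
  r < L.countP (fun p => decide (B.InHi p)) ∧ L.length ≤ r + L.countP (fun p => decide (B.InLo p))

/-- The height at `t` is a convex combination of the heights at the two ends, with the same weights
`u`, `w` for all points. So the level at `t` lies between the interpolated thresholds, and the
margin 2 at both ends survives interpolation. -/
theorem Certifies.bounds {B : LevelBox} {L : List (ℝ × ℝ)} {r : ℕ} (h : B.Certifies L r)
    (h12 : B.t₁ < B.t₂) {t v : ℝ} (hgt₁ : B.t₁ ≤ t) (hgt₂ : t ≤ B.t₂)
    (hv : IsSel (L.map (hgt t)) r v) :
    (∀ p, B.Below p → hgt t p < v - 2) ∧ ∀ p, B.Above p → v + 2 < hgt t p := by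
  obtain ⟨u, w, hu, hw, huw, rfl⟩ : ∃ u w : ℝ, 0 ≤ u ∧ 0 ≤ w ∧ u + w = 1 ∧
      u * B.t₁ + w * B.t₂ = t := by
    have hd : 0 < B.t₂ - B.t₁ := sub_pos.2 h12
    refine ⟨(B.t₂ - t) / (B.t₂ - B.t₁), (t - B.t₁) / (B.t₂ - B.t₁), ?_, ?_, ?_, ?_⟩
    · exact div_nonneg (by linarith) hd.le
    · exact div_nonneg (by linarith) hd.le
    · field_simp; ring
    · field_simp; ring
  have lin : ∀ p, hgt (u * B.t₁ + w * B.t₂) p = u * hgt B.t₁ p + w * hgt B.t₂ p := by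
    intro p; simp only [hgt]; linear_combination (-p.2) * huw
  have hlt := hv.1
  have hle := hv.2
  rw [List.countP_map] at hlt hle
  -- Otherwise all points of `InHi`, which are more than `r`, would lie strictly below `v`.
  have hhi : v ≤ u * B.hi₁ + w * B.hi₂ := by
    by_contra hcon
    push Not at hcon
    have : L.countP (fun p => decide (B.InHi p)) ≤
        L.countP ((fun x => decide (x < v)) ∘ hgt (u * B.t₁ + w * B.t₂)) := by
      refine List.countP_mono_left (fun p _ hp => ?_)
      simp only [Function.comp, decide_eq_true_eq, lin] at hp ⊢
      have := mul_le_mul_of_nonneg_left hp.1 hu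
      have := mul_le_mul_of_nonneg_left hp.2 hw
      linarith
    have := h.1
    omega
  have hlo : u * B.lo₁ + w * B.lo₂ ≤ v := by
    by_contra hcon
    push Not at hcon
    have h1 : L.countP ((fun x => decide (x ≤ v)) ∘ hgt (u * B.t₁ + w * B.t₂)) ≤
        L.countP (fun p => decide (¬ B.InLo p)) := by
      refine List.countP_mono_left (fun p _ hp => ?_)
      simp only [Function.comp, decide_eq_true_eq, lin] at hp ⊢
      intro hlo
      have := mul_le_mul_of_nonneg_left hlo.1 hu
      have := mul_le_mul_of_nonneg_left hlo.2 hw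
      linarith
    have h2 := countP_add_countP_not L B.InLo
    have := h.2
    omega
  have strict : ∀ {x y x' y' : ℝ}, x < x' → y < y' → u * x + w * y < u * x' + w * y' := by
    intro x y x' y' hx hy
    rcases hu.eq_or_lt with rfl | hu'
    · have : w = 1 := by linarith
      subst this; linarith
    · have := mul_lt_mul_of_pos_left hx hu'
      have := mul_le_mul_of_nonneg_left hy.le hw
      linarith
  have e2 : u * 2 + w * 2 = 2 := by linarith
  refine ⟨fun p hp => ?_, fun p hp => ?_⟩
  · rw [lin]
    have := strict hp.1 hp.2
    nlinarith
  · rw [lin]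
    have := strict hp.1 hp.2
    nlinarith

theorem countP_eq_filter_add {B : LevelBox} (L : List (ℝ × ℝ)) (q : ℝ × ℝ → Bool)
    (hb : ∀ p, B.Below p → q p = true) (ha : ∀ p, B.Above p → q p = false) :
    L.countP q = (L.filter (fun p => decide (B.Kept p))).countP q +
      L.countP (fun p => decide (B.Below p)) := by
  induction L with
  | nil => rfl
  | cons a L ih =>
    rw [List.filter_cons, List.countP_cons, List.countP_cons, ih]
    by_cases h1 : B.Below a
    · have hk : ¬ B.Kept a := fun h => h.1 h1
      simp [h1, hk, hb a h1]; omega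
    · by_cases h2 : B.Above a
      · have hk : ¬ B.Kept a := fun h => h.2 h2
        simp [h1, hk, ha a h2]
      · have hk : B.Kept a := ⟨h1, h2⟩
        simp [h1, hk, List.countP_cons]; omega

/-- All pruned points lie strictly on their side of the level, so pruning only shifts the rank by
the number of points removed from below. -/
theorem Certifies.isSel_filter {B : LevelBox} {L : List (ℝ × ℝ)} {r : ℕ} (h : B.Certifies L r)
    (h12 : B.t₁ < B.t₂) {t v : ℝ} (hgt₁ : B.t₁ ≤ t) (hgt₂ : t ≤ B.t₂)
    (hv : IsSel (L.map (hgt t)) r v) :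
    IsSel ((L.filter (fun p => decide (B.Kept p))).map (hgt t))
      (r - L.countP (fun p => decide (B.Below p))) v := by
  obtain ⟨hb, ha⟩ := h.bounds h12 hgt₁ hgt₂ hv
  unfold IsSel at hv ⊢
  rw [List.countP_map, List.countP_map] at hv ⊢
  rw [countP_eq_filter_add (B := B) L ((fun x => decide (x < v)) ∘ hgt t)
      (fun p hp => by have := hb p hp; simp; linarith)
      (fun p hp => by have := ha p hp; simp; linarith),
    countP_eq_filter_add (B := B) L ((fun x => decide (x ≤ v)) ∘ hgt t)
      (fun p hp => by have := hb p hp; simp; linarith)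
      (fun p hp => by have := ha p hp; simp; linarith)] at hv
  omega

end LevelBox

/-! ### The pruning invariant -/

/-- Invariant of the search: the active list `L` with rank `r` and the slopes in `[a, a + h]`
describe the level of rank `r₀` of the list `L₀`. -/
structure Search (L₀ : List (ℝ × ℝ)) (r₀ : ℕ) (L : List (ℝ × ℝ)) (r : ℕ) (a h : ℝ) : Prop where
  sublist : L.Sublist L₀
  rank_lt : r < L.length
  nonneg : 0 ≤ a
  pos : 0 < h
  le_one : a + h ≤ 1
  -- The second clause says that no point within 2 of the level has been pruned, as `L` is a sublist
  -- of `L₀`.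
  level : ∀ t, a ≤ t → t ≤ a + h → ∀ v, IsSel (L.map (hgt t)) r v →
    IsSel (L₀.map (hgt t)) r₀ v ∧
      L₀.countP (fun p => decide (|hgt t p - v| ≤ 2)) ≤ L.countP (fun p => decide (|hgt t p - v| ≤ 2))
  -- Preserved because `(10 ^ 8) ^ 5 = (10 ^ 20) ^ 2`. Together with `h² |L| = O(1)` at the end it
  -- yields the exponent `5/6`.
  size : (L.length : ℝ) ^ 5 ≤ h ^ 2 * (L₀.length : ℝ) ^ 5

theorem Search.step {L₀ : List (ℝ × ℝ)} {r₀ : ℕ} {L : List (ℝ × ℝ)} {r : ℕ} {a h : ℝ}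
    (hS : Search L₀ r₀ L r a h) {B : LevelBox} (hB : B.Certifies L r) (ha : a ≤ B.t₁)
    (h12 : B.t₂ = B.t₁ + h / 10 ^ 20) (hb : B.t₂ ≤ a + h)
    (hK : 10 ^ 8 * L.countP (fun p => decide (B.Kept p)) ≤ L.length) :
    Search L₀ r₀ (L.filter (fun p => decide (B.Kept p)))
      (r - L.countP (fun p => decide (B.Below p))) B.t₁ (h / 10 ^ 20) := by
  have hpos := hS.pos
  have hlt : B.t₁ < B.t₂ := by rw [h12]; linarith [div_pos hpos (by norm_num : (0:ℝ) < 10 ^ 20)]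
  have hex : ∀ t, ∃ v, IsSel (L.map (hgt t)) r v := fun t =>
    (exists_isSel (L.map (hgt t)) r (by simpa using hS.rank_lt)).imp fun _ h => h.2
  refine ⟨List.filter_sublist.trans hS.sublist, ?_, hS.nonneg.trans ha, by positivity,
    by linarith [hS.le_one], ?_, ?_⟩
  · obtain ⟨v, hv⟩ := hex B.t₁
    simpa using (hB.isSel_filter hlt le_rfl hlt.le hv).lt_length
  · intro t hgt₁ hgt₂ v hv
    rw [← h12] at hgt₂
    -- The old level exists and is selected in the pruned list too, so by uniqueness it is `v`.
    obtain ⟨u, hu⟩ := hex t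
    obtain rfl := (hB.isSel_filter hlt hgt₁ hgt₂ hu).unique hv
    obtain ⟨h1, h2⟩ := hS.level t (ha.trans hgt₁) (hgt₂.trans hb) u hu
    refine ⟨h1, h2.trans ?_⟩
    rw [List.countP_filter]
    obtain ⟨hbel, habv⟩ := hB.bounds hlt hgt₁ hgt₂ hu
    refine List.countP_mono_left (fun p _ hp => ?_)
    simp only [decide_eq_true_eq, Bool.and_eq_true] at hp ⊢
    rw [abs_le] at hp
    refine ⟨abs_le.2 hp, fun h => ?_, fun h => ?_⟩
    · linarith [hbel p h]
    · linarith [habv p h]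
  · rw [← List.countP_eq_length_filter]
    have h1 : (10 : ℝ) ^ 8 * (L.countP (fun p => decide (B.Kept p)) : ℝ) ≤ L.length := by
      exact_mod_cast hK
    have h2 := pow_le_pow_left₀ (by positivity) h1 5
    have h3 := h2.trans hS.size
    rw [mul_pow] at h3
    rw [div_pow, div_mul_eq_mul_div, le_div_iff₀ (by positivity)]
    linarith [h3]

/-! ### Points in distinct unit cells -/

/-- The unit cell of a point. -/
noncomputable def cell (p : ℝ × ℝ) : ℤ × ℤ := (⌊p.1⌋, ⌊p.2⌋)

/-- Distance of the cells of two points. -/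
noncomputable def cellDist (p q : ℝ × ℝ) : ℕ :=
  max (⌊p.1⌋ - ⌊q.1⌋).natAbs (⌊p.2⌋ - ⌊q.2⌋).natAbs

theorem cellDist_pos {p q : ℝ × ℝ} (h : cell p ≠ cell q) : 1 ≤ cellDist p q := by
  by_contra hc
  have h1 : (⌊p.1⌋ - ⌊q.1⌋).natAbs ≤ cellDist p q := le_max_left _ _
  have h2 : (⌊p.2⌋ - ⌊q.2⌋).natAbs ≤ cellDist p q := le_max_right _ _
  exact h (Prod.ext (show ⌊p.1⌋ = ⌊q.1⌋ by omega) (show ⌊p.2⌋ = ⌊q.2⌋ by omega))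

theorem natAbs_floor_sub_le (x y : ℝ) : ((⌊x⌋ - ⌊y⌋).natAbs : ℝ) ≤ |x - y| + 1 := by
  rw [Nat.cast_natAbs]
  push_cast
  have h1 := Int.floor_le x
  have h2 := Int.lt_floor_add_one x
  have h3 := Int.floor_le y
  have h4 := Int.lt_floor_add_one y
  rw [abs_le]
  constructor <;> [have := neg_abs_le (x - y); have := le_abs_self (x - y)] <;> linarith

theorem cellDist_le (p q : ℝ × ℝ) :
    (cellDist p q : ℝ) ≤ max |p.1 - q.1| |p.2 - q.2| + 1 := by
  unfold cellDist
  rw [Nat.cast_max]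
  refine max_le ?_ ?_
  · exact (natAbs_floor_sub_le _ _).trans (by linarith [le_max_left |p.1 - q.1| |p.2 - q.2|])
  · exact (natAbs_floor_sub_le _ _).trans (by linarith [le_max_right |p.1 - q.1| |p.2 - q.2|])

theorem card_cellDist_le {S : Finset (ℝ × ℝ)} (hS : Set.InjOn cell S) (p : ℝ × ℝ) (i : ℕ) :
    (S.filter (fun q => cellDist p q ≤ i)).card ≤ (2 * i + 1) ^ 2 := by
  have h : (S.filter (fun q => cellDist p q ≤ i)).card ≤
      ((Finset.Icc (⌊p.1⌋ - i) (⌊p.1⌋ + i)) ×ˢ (Finset.Icc (⌊p.2⌋ - i) (⌊p.2⌋ + i))).card := by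
    refine Finset.card_le_card_of_injOn cell ?_
      (hS.mono (fun x hx => (Finset.mem_filter.1 (Finset.mem_coe.1 hx)).1))
    intro q hq
    have hq' := (Finset.mem_filter.1 hq).2
    have h1 : (⌊p.1⌋ - ⌊q.1⌋).natAbs ≤ cellDist p q := le_max_left _ _
    have h2 : (⌊p.2⌋ - ⌊q.2⌋).natAbs ≤ cellDist p q := le_max_right _ _
    simp only [cell, Finset.coe_product, Finset.coe_Icc, Set.mem_prod, Set.mem_Icc]
    omega
  refine h.trans (le_of_eq ?_)
  rw [Finset.card_product, Int.card_Icc, Int.card_Icc, sq]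
  congr 1 <;> omega

/-- For `D ≤ M` this is the telescoping sum of `1 / i - 1 / (i + 1)` from `D` on. It turns a sum of
inverse distances into counts of points within distance `i`. -/
theorem inv_le_layers (D M : ℕ) (hD : 1 ≤ D) (hM : 1 ≤ M) :
    (1 : ℝ) / D ≤ 1 / M + ∑ i ∈ Finset.Ico 1 M, if D ≤ i then (1 : ℝ) / (i * (i + 1)) else 0 := by
  induction M, hM using Nat.le_induction with
  | base => simpa using inv_le_one_of_one_le₀ (by exact_mod_cast hD : (1 : ℝ) ≤ D)
  | succ M hM ih =>
    rw [Finset.sum_Ico_succ_top hM]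
    have hM0 : (0 : ℝ) < M := by exact_mod_cast hM
    by_cases h : D ≤ M
    · rw [if_pos h]
      have : (1 : ℝ) / M = 1 / ((M + 1 : ℕ) : ℝ) + 1 / (M * (M + 1)) := by
        push_cast; field_simp
      linarith
    · have h1 : (1 : ℝ) / D ≤ 1 / ((M + 1 : ℕ) : ℝ) :=
        one_div_le_one_div_of_le (by positivity) (by exact_mod_cast (by omega : M + 1 ≤ D))
      have h2 : (0 : ℝ) ≤ ∑ i ∈ Finset.Ico 1 M, if D ≤ i then (1 : ℝ) / (i * (i + 1)) else 0 :=
        Finset.sum_nonneg (fun i _ => by split_ifs <;> positivity)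
      rw [if_neg h]
      linarith

/-- At most `(2 i + 1)² ≤ 9 i (i + 1)` points lie within cell distance `i`, so each layer
contributes at most 9. Cutting at `M = ⌈√|S|⌉` leaves `|S| / M + 9 M ≤ 19 √|S|`. -/
theorem sum_inv_cellDist_le {S : Finset (ℝ × ℝ)} (hS : Set.InjOn cell S) {p : ℝ × ℝ} (hp : p ∈ S) :
    ∑ q ∈ S.erase p, (1 : ℝ) / cellDist p q ≤ 19 * √(S.card) := by
  have hs : (1 : ℝ) ≤ S.card := by exact_mod_cast Finset.card_pos.2 ⟨p, hp⟩
  have hr : 1 ≤ √(S.card : ℝ) := Real.one_le_sqrt.2 hs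
  set M := ⌈√(S.card : ℝ)⌉₊ with hMdef
  have hM1 : √(S.card : ℝ) ≤ M := Nat.le_ceil _
  have hM2 : (M : ℝ) < √(S.card : ℝ) + 1 := Nat.ceil_lt_add_one (by positivity)
  have hM : 1 ≤ M := by exact_mod_cast hr.trans hM1
  have h1 : ∀ q ∈ S.erase p, (1 : ℝ) / cellDist p q ≤ 1 / M +
      ∑ i ∈ Finset.Ico 1 M, if cellDist p q ≤ i then (1 : ℝ) / (i * (i + 1)) else 0 := by
    intro q hq
    rw [Finset.mem_erase] at hq
    exact inv_le_layers _ _ (cellDist_pos (fun h => hq.1 (hS hq.2 hp h.symm))) hM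
  refine (Finset.sum_le_sum h1).trans ?_
  rw [Finset.sum_add_distrib, Finset.sum_comm]
  have h2 : ∀ i ∈ Finset.Ico 1 M, (∑ q ∈ S.erase p,
      if cellDist p q ≤ i then (1 : ℝ) / (i * (i + 1)) else 0) ≤ 9 := by
    intro i hi
    have hi1 : 1 ≤ i := (Finset.mem_Ico.1 hi).1
    rw [← Finset.sum_filter, Finset.sum_const, nsmul_eq_mul]
    have h3 : ((S.erase p).filter (fun q => cellDist p q ≤ i)).card ≤ (2 * i + 1) ^ 2 :=
      card_cellDist_le (hS.mono (by simp)) p i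
    have h4 : (((S.erase p).filter (fun q => cellDist p q ≤ i)).card : ℝ) ≤ (2 * i + 1) ^ 2 := by
      exact_mod_cast h3
    have hi' : (1 : ℝ) ≤ i := by exact_mod_cast hi1
    rw [mul_one_div, div_le_iff₀ (by positivity)]
    nlinarith
  have h5 := Finset.sum_le_sum h2
  have h6 : ∑ q ∈ S.erase p, (1 : ℝ) / M ≤ √(S.card : ℝ) := by
    rw [Finset.sum_const, nsmul_eq_mul, mul_one_div, div_le_iff₀ (by linarith)]
    have : ((S.erase p).card : ℝ) ≤ S.card := by exact_mod_cast Finset.card_le_card (Finset.erase_subset _ _)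
    have := Real.mul_self_sqrt (by positivity : (0 : ℝ) ≤ S.card)
    nlinarith
  have h7 : ∑ i ∈ Finset.Ico 1 M, (9 : ℝ) ≤ 9 * M := by
    rw [Finset.sum_const, nsmul_eq_mul, Nat.card_Ico, mul_comm]
    have : ((M - 1 : ℕ) : ℝ) ≤ M := by exact_mod_cast Nat.sub_le _ _
    linarith
  linarith

/-! ### Strips around arbitrary levels at equally spaced slopes -/

/-- Few equally spaced slopes put both of two distant points into one strip. -/
theorem card_slopes_le {p q : ℝ × ℝ} (hpq : cell p ≠ cell q) {a h : ℝ} {k : ℕ} (ha : 0 ≤ a)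
    (hh : 0 < h) (hah : a + h ≤ 1) (hk : 0 < k) :
    (((Finset.range (k + 1)).filter
      (fun j : ℕ => |hgt (a + j * (h / k)) p - hgt (a + j * (h / k)) q| ≤ 4)).card : ℝ) ≤
      1 + 13 * (k / h) * (1 / cellDist p q) := by
  set F := (Finset.range (k + 1)).filter
      (fun j : ℕ => |hgt (a + j * (h / k)) p - hgt (a + j * (h / k)) q| ≤ 4) with hF
  have hD := cellDist_pos hpq
  have hD' : (0 : ℝ) < cellDist p q := by exact_mod_cast hD
  have hk' : (0 : ℝ) < k := by exact_mod_cast hk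
  rcases F.eq_empty_or_nonempty with he | hne
  · rw [he, Finset.card_empty, Nat.cast_zero]; positivity
  obtain ⟨h1, h2⟩ := Finset.mem_filter.1 (Finset.min'_mem F hne)
  obtain ⟨h3, h4⟩ := Finset.mem_filter.1 (Finset.max'_mem F hne)
  set i := F.min' hne
  set j := F.max' hne
  have hij : i ≤ j := Finset.min'_le_max' _ _
  have hsub : F ⊆ Finset.Icc i j := fun x hx =>
    Finset.mem_Icc.2 ⟨Finset.min'_le _ _ hx, Finset.le_max' _ _ hx⟩
  have hcard : (F.card : ℝ) ≤ ((j : ℝ) - i) + 1 := by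
    have := Finset.card_le_card hsub
    rw [Nat.card_Icc] at this
    have h' : F.card + i ≤ j + 1 := by omega
    have : (F.card : ℝ) + i ≤ j + 1 := by exact_mod_cast h'
    linarith
  have hjk : (j : ℝ) ≤ k := by
    have := Finset.mem_range.1 h3; exact_mod_cast (by omega : j ≤ k)
  have hij' : (0 : ℝ) ≤ (j : ℝ) - i := sub_nonneg.2 (by exact_mod_cast hij)
  set u := ((j : ℝ) - i) * (h / k) with hu
  have hu0 : 0 ≤ u := by positivity
  have hstep : (k : ℝ) * (h / k) = h := by field_simp
  have hjh : (j : ℝ) * (h / k) ≤ h :=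
    (mul_le_mul_of_nonneg_right hjk (by positivity)).trans hstep.le
  have hih : (0 : ℝ) ≤ i * (h / k) := by positivity
  have hu1 : u ≤ 1 := by rw [hu, sub_mul]; linarith
  -- The height difference of `p` and `q` is affine in the slope; between the extreme slopes `i` and
  -- `j` of `F`, which are `u` apart, it changes by `u * |p.1 - q.1|`, and at both it is at most 4
  -- in absolute value.
  have hx : u * |p.1 - q.1| ≤ 8 := by
    have e : u * (p.1 - q.1) = (hgt (a + i * (h / k)) p - hgt (a + i * (h / k)) q) -
        (hgt (a + j * (h / k)) p - hgt (a + j * (h / k)) q) := by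
      simp only [hgt, hu]; ring
    rw [← abs_of_nonneg hu0, ← abs_mul, e]
    exact (abs_sub _ _).trans (by linarith)
  have hy : |p.2 - q.2| ≤ |p.1 - q.1| + 4 := by
    set t := a + j * (h / k)
    have e : p.2 - q.2 = (hgt t p - hgt t q) + t * (p.1 - q.1) := by simp only [hgt]; ring
    have ht0 : 0 ≤ t := by positivity
    have ht1 : t ≤ 1 := by linarith
    rw [e]
    refine (abs_add_le _ _).trans ?_
    rw [abs_mul, abs_of_nonneg ht0]
    have := mul_le_mul_of_nonneg_right ht1 (abs_nonneg (p.1 - q.1))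
    linarith
  have hdist : (cellDist p q : ℝ) ≤ |p.1 - q.1| + 5 :=
    (cellDist_le p q).trans (by
      have := max_le (by linarith : |p.1 - q.1| ≤ |p.1 - q.1| + 4) hy
      linarith)
  -- `13 = 8 + 5`, using `u ≤ 1`.
  have hfin : u * cellDist p q ≤ 13 := by
    have := mul_le_mul_of_nonneg_left hdist hu0
    nlinarith
  have : (j : ℝ) - i ≤ 13 * (k / h) * (1 / cellDist p q) := by
    rw [mul_one_div, le_div_iff₀ hD']
    have e : ((j : ℝ) - i) = u * (k / h) := by rw [hu]; field_simp
    rw [e, mul_right_comm]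
    exact mul_le_mul_of_nonneg_right hfin (by positivity)
  linarith

/-- The square of a strip size counts ordered pairs inside the strip, and such pairs differ by at
most 4 in height whatever the center `c j` is. Counting slopes per pair instead, a fixed `p`
contributes `k + 1 ≤ |S|` for itself, and `|S| + 13 (k / h) * 19 √|S| ≤ 2 |S|` for the others; `247
= 13 * 19`. -/
theorem sum_sq_strip_le {S : Finset (ℝ × ℝ)} (hS : Set.InjOn cell S) {a h : ℝ} {k : ℕ} (ha : 0 ≤ a)
    (hh : 0 < h) (hah : a + h ≤ 1) (hk : 0 < k) (hlarge : 247 * (k : ℝ) ≤ h * √(S.card))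
    (c : ℕ → ℝ) :
    ∑ j ∈ Finset.range (k + 1),
      (S.filter (fun p => |hgt (a + j * (h / k)) p - c j| ≤ 2)).card ^ 2 ≤ 3 * S.card ^ 2 := by
  have hk' : (1 : ℝ) ≤ k := by exact_mod_cast hk
  have hs0 : (0 : ℝ) ≤ S.card := by positivity
  have hsq := Real.mul_self_sqrt hs0
  set w := √(S.card : ℝ) with hw
  have hw0 : 0 ≤ w := Real.sqrt_nonneg _
  have hwk : 247 * (k : ℝ) ≤ w := hlarge.trans (by
    have : h ≤ 1 := by linarith
    nlinarith)
  have hks : (k : ℝ) + 1 ≤ S.card := by nlinarith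
  let N : ℝ × ℝ → ℝ × ℝ → Finset ℕ := fun p q => (Finset.range (k + 1)).filter
      (fun j : ℕ => |hgt (a + j * (h / k)) p - hgt (a + j * (h / k)) q| ≤ 4)
  have h1 : ∑ j ∈ Finset.range (k + 1),
      (S.filter (fun p => |hgt (a + j * (h / k)) p - c j| ≤ 2)).card ^ 2 ≤
      ∑ p ∈ S, ∑ q ∈ S, (N p q).card := by
    calc _ ≤ ∑ j ∈ Finset.range (k + 1), ((S ×ˢ S).filter
          (fun z => |hgt (a + j * (h / k)) z.1 - hgt (a + j * (h / k)) z.2| ≤ 4)).card := by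
          refine Finset.sum_le_sum (fun j _ => ?_)
          rw [sq, ← Finset.card_product]
          refine Finset.card_le_card (fun z hz => ?_)
          simp only [Finset.mem_product, Finset.mem_filter] at hz ⊢
          refine ⟨⟨hz.1.1, hz.2.1⟩, ?_⟩
          have := abs_sub_le (hgt (a + j * (h / k)) z.1) (c j) (hgt (a + j * (h / k)) z.2)
          rw [abs_sub_comm (c j)] at this
          linarith [hz.1.2, hz.2.2]
      _ = ∑ j ∈ Finset.range (k + 1), ∑ p ∈ S, ∑ q ∈ S,
          if |hgt (a + j * (h / k)) p - hgt (a + j * (h / k)) q| ≤ 4 then 1 else 0 := by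
          refine Finset.sum_congr rfl (fun j _ => ?_)
          rw [Finset.card_filter, Finset.sum_product]
      _ = ∑ p ∈ S, ∑ q ∈ S, (N p q).card := by
          rw [Finset.sum_comm]
          refine Finset.sum_congr rfl (fun p _ => ?_)
          rw [Finset.sum_comm]
          refine Finset.sum_congr rfl (fun q _ => ?_)
          rw [Finset.card_filter]
  have h2 : ∀ p ∈ S, ∑ q ∈ S, ((N p q).card : ℝ) ≤
      (k + 1) + S.card + 13 * (k / h) * (19 * w) := by
    intro p hp
    rw [← Finset.add_sum_erase _ _ hp]
    have e1 : ((N p p).card : ℝ) ≤ k + 1 := by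
      have := Finset.card_filter_le (Finset.range (k + 1))
        (fun j : ℕ => |hgt (a + j * (h / k)) p - hgt (a + j * (h / k)) p| ≤ 4)
      rw [Finset.card_range] at this
      exact_mod_cast this
    have e2 : ∑ q ∈ S.erase p, ((N p q).card : ℝ) ≤
        ∑ q ∈ S.erase p, (1 + 13 * (k / h) * (1 / cellDist p q)) := by
      refine Finset.sum_le_sum (fun q hq => ?_)
      rw [Finset.mem_erase] at hq
      exact card_slopes_le (fun h => hq.1 (hS hq.2 hp h.symm)) ha hh hah hk
    rw [Finset.sum_add_distrib, ← Finset.mul_sum, Finset.sum_const, nsmul_eq_mul, mul_one] at e2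
    have e3 : ((S.erase p).card : ℝ) ≤ S.card := by
      exact_mod_cast Finset.card_le_card (Finset.erase_subset _ _)
    have e4 := mul_le_mul_of_nonneg_left (sum_inv_cellDist_le hS hp)
      (by positivity : (0 : ℝ) ≤ 13 * (k / h))
    linarith
  have h3 : ∑ p ∈ S, ∑ q ∈ S, ((N p q).card : ℝ) ≤ 3 * (S.card : ℝ) ^ 2 := by
    refine (Finset.sum_le_sum h2).trans ?_
    rw [Finset.sum_const, nsmul_eq_mul]
    have e : 13 * ((k : ℝ) / h) * (19 * w) ≤ S.card := by
      rw [show 13 * ((k : ℝ) / h) * (19 * w) = 247 * k * w / h by ring, div_le_iff₀ hh, ← hsq]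
      nlinarith
    have : (S.card : ℝ) * (k + 1 + S.card + 13 * (k / h) * (19 * w)) ≤
        S.card * (S.card + S.card + S.card) :=
      mul_le_mul_of_nonneg_left (by linarith) hs0
    linarith
  have h4 : (((∑ p ∈ S, ∑ q ∈ S, (N p q).card : ℕ)) : ℝ) ≤ ((3 * S.card ^ 2 : ℕ) : ℝ) := by
    push_cast; exact h3
  exact h1.trans (by exact_mod_cast h4)

/-! ### Crossings -/

/-- Ordered pairs of points of `S` whose heights change order between two slopes. -/
noncomputable def crossings (S : Finset (ℝ × ℝ)) (t₁ t₂ : ℝ) : Finset ((ℝ × ℝ) × (ℝ × ℝ)) :=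
  (S ×ˢ S).filter (fun z => hgt t₁ z.1 < hgt t₁ z.2 ∧ hgt t₂ z.2 < hgt t₂ z.1)

/-- The height difference of a pair is affine in the slope, so an ordered pair changes from
increasing to decreasing in at most one of the consecutive intervals. -/
theorem sum_card_crossings_le (S : Finset (ℝ × ℝ)) {T : ℕ → ℝ} (hT : StrictMono T) (k : ℕ) :
    ∑ j ∈ Finset.range k, (crossings S (T j) (T (j + 1))).card ≤ S.card ^ 2 := by
  have : ∀ j, (crossings S (T j) (T (j + 1))).card = ∑ z ∈ S ×ˢ S,
      if hgt (T j) z.1 < hgt (T j) z.2 ∧ hgt (T (j + 1)) z.2 < hgt (T (j + 1)) z.1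
        then 1 else 0 := fun j => Finset.card_filter _ _
  simp only [this]
  rw [Finset.sum_comm, sq, ← Finset.card_product, Finset.card_eq_sum_ones]
  refine Finset.sum_le_sum (fun z _ => ?_)
  rw [← Finset.card_filter, Finset.card_le_one]
  have key : ∀ i j : ℕ, hgt (T i) z.1 < hgt (T i) z.2 → hgt (T (i + 1)) z.2 < hgt (T (i + 1)) z.1 →
      hgt (T j) z.1 < hgt (T j) z.2 → ¬ i < j := by
    intro i j h1 h2 h3 hij
    have h4 : T i < T (i + 1) := hT (Nat.lt_succ_self i)
    have h5 : T (i + 1) ≤ T j := hT.monotone hij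
    simp only [hgt] at h1 h2 h3
    have h6 : 0 < (T (i + 1) - T i) * (z.2.1 - z.1.1) := by nlinarith
    have h7 : 0 < z.2.1 - z.1.1 := pos_of_mul_pos_right h6 (by linarith)
    nlinarith
  intro i hi j hj
  simp only [Finset.mem_filter] at hi hj
  have a := key i j hi.2.1 hi.2.2 hj.2.1
  have b := key j i hj.2.1 hj.2.2 hi.2.1
  omega

theorem List.Nodup.countP_eq_card {α : Type*} [DecidableEq α] {L : List α} (hL : L.Nodup)
    (P : α → Prop) [DecidablePred P] :
    L.countP (fun p => decide (P p)) = (L.toFinset.filter P).card := by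
  rw [List.countP_eq_length_filter, ← List.toFinset_card_of_nodup (hL.filter _), List.toFinset_filter]
  congr 1; ext; simp

/-- Among the pairs of consecutive slopes there is one with few crossings and few points near
the four given levels. -/
theorem exists_good_slopes {S : Finset (ℝ × ℝ)} (hS : Set.InjOn cell S) {a h : ℝ} {k : ℕ}
    (ha : 0 ≤ a) (hh : 0 < h) (hah : a + h ≤ 1) (hk : 0 < k)
    (hlarge : 247 * (k : ℝ) ≤ h * √(S.card)) (lo₁ lo₂ hi₁ hi₂ : ℕ → ℝ) {e : ℕ}
    (he : 13 * S.card ^ 2 ≤ k * e ^ 2) :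
    ∃ j < k,
      (crossings S (a + j * (h / k)) (a + (j + 1 : ℕ) * (h / k))).card ≤ e ^ 2 ∧
      (S.filter (fun p => |hgt (a + j * (h / k)) p - lo₁ j| ≤ 2)).card ≤ e ∧
      (S.filter (fun p => |hgt (a + j * (h / k)) p - hi₁ j| ≤ 2)).card ≤ e ∧
      (S.filter (fun p => |hgt (a + (j + 1 : ℕ) * (h / k)) p - lo₂ j| ≤ 2)).card ≤ e ∧
      (S.filter (fun p => |hgt (a + (j + 1 : ℕ) * (h / k)) p - hi₂ j| ≤ 2)).card ≤ e := by
  have hk' : (0 : ℝ) < k := by exact_mod_cast hk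
  have hT : StrictMono (fun j : ℕ => a + j * (h / k)) := fun i j hij => by
    have : (i : ℝ) < j := by exact_mod_cast hij
    have := mul_lt_mul_of_pos_right this (div_pos hh hk')
    simpa using this
  have h0 := sum_card_crossings_le S hT k
  have left : ∀ c : ℕ → ℝ, ∑ j ∈ Finset.range k,
      (S.filter (fun p => |hgt (a + j * (h / k)) p - c j| ≤ 2)).card ^ 2 ≤ 3 * S.card ^ 2 := by
    intro c
    have := sum_sq_strip_le hS ha hh hah hk hlarge c
    rw [Finset.sum_range_succ] at this
    omega
  have right : ∀ c : ℕ → ℝ, ∑ j ∈ Finset.range k,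
      (S.filter (fun p => |hgt (a + (j + 1 : ℕ) * (h / k)) p - c j| ≤ 2)).card ^ 2 ≤
        3 * S.card ^ 2 := by
    intro c
    -- Right ends are left ends shifted by one; the value of the truncated `j - 1` at `0` is
    -- irrelevant, since that term is discarded.
    have := sum_sq_strip_le hS ha hh hah hk hlarge (fun j => c (j - 1))
    rw [Finset.sum_range_succ'] at this
    simp only [Nat.add_sub_cancel] at this
    omega
  have h1 := left lo₁
  have h2 := left hi₁
  have h3 := right lo₂
  have h4 := right hi₂
  -- Pigeonhole: the crossings and the four squared strip sizes sum to at most `(1 + 4 * 3) |S|² =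
  -- 13 |S|² ≤ k e²`, whereas each bad `j` contributes at least `e² + 1`.
  by_contra hcon
  push Not at hcon
  have hbig : ∀ j ∈ Finset.range k, e ^ 2 + 1 ≤
      (crossings S (a + j * (h / k)) (a + (j + 1 : ℕ) * (h / k))).card +
      (S.filter (fun p => |hgt (a + j * (h / k)) p - lo₁ j| ≤ 2)).card ^ 2 +
      (S.filter (fun p => |hgt (a + j * (h / k)) p - hi₁ j| ≤ 2)).card ^ 2 +
      (S.filter (fun p => |hgt (a + (j + 1 : ℕ) * (h / k)) p - lo₂ j| ≤ 2)).card ^ 2 +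
      (S.filter (fun p => |hgt (a + (j + 1 : ℕ) * (h / k)) p - hi₂ j| ≤ 2)).card ^ 2 := by
    intro j hj
    by_contra hlt
    have small : ∀ x : ℕ, x ^ 2 ≤ e ^ 2 → x ≤ e := fun x => (Nat.pow_le_pow_iff_left two_ne_zero).1
    have := hcon j (Finset.mem_range.1 hj) (by omega) (small _ (by omega)) (small _ (by omega))
      (small _ (by omega))
    exact absurd (small _ (by omega)) (not_le.2 this)
  have hsum := Finset.sum_le_sum hbig
  simp only [Finset.sum_add_distrib, Finset.sum_const, Finset.card_range, smul_eq_mul] at hsum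
  omega

/-! ### Brackets whose thresholds are quantiles -/

namespace LevelBox

variable {B : LevelBox} {S : Finset (ℝ × ℝ)} {r e : ℕ}

/-- The thresholds of a bracket are elements of rank about `r - e` and `r + e` at both slopes. -/
structure IsQuantile (B : LevelBox) (S : Finset (ℝ × ℝ)) (r e : ℕ) : Prop where
  lo₁ : (S.filter (fun p => hgt B.t₁ p < B.lo₁)).card ≤ r - e
  lo₁' : r - e < (S.filter (fun p => hgt B.t₁ p ≤ B.lo₁)).card
  lo₂ : (S.filter (fun p => hgt B.t₂ p < B.lo₂)).card ≤ r - e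
  lo₂' : r - e < (S.filter (fun p => hgt B.t₂ p ≤ B.lo₂)).card
  hi₁ : (S.filter (fun p => hgt B.t₁ p < B.hi₁)).card ≤ min (r + e) (S.card - 1)
  hi₁' : min (r + e) (S.card - 1) < (S.filter (fun p => hgt B.t₁ p ≤ B.hi₁)).card
  hi₂ : (S.filter (fun p => hgt B.t₂ p < B.hi₂)).card ≤ min (r + e) (S.card - 1)
  hi₂' : min (r + e) (S.card - 1) < (S.filter (fun p => hgt B.t₂ p ≤ B.hi₂)).card

theorem card_mul_le_crossings {S X Y : Finset (ℝ × ℝ)} {t₁ t₂ : ℝ} (hX : X ⊆ S) (hY : Y ⊆ S)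
    (h : ∀ p ∈ X, ∀ q ∈ Y, hgt t₁ p < hgt t₁ q ∧ hgt t₂ q < hgt t₂ p) :
    X.card * Y.card ≤ (crossings S t₁ t₂).card := by
  rw [← Finset.card_product]
  refine Finset.card_le_card (fun z hz => ?_)
  rw [Finset.mem_product] at hz
  exact Finset.mem_filter.2 ⟨Finset.mem_product.2 ⟨hX hz.1, hY hz.2⟩, h _ hz.1 _ hz.2⟩

theorem card_filter_lt_add (S : Finset (ℝ × ℝ)) (t v : ℝ) :
    (S.filter (fun p => hgt t p < v)).card + (S.filter (fun p => v ≤ hgt t p)).card = S.card := by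
  rw [← Finset.card_filter_add_card_filter_not (s := S) (fun p => hgt t p < v)]
  simp only [not_lt]

theorem card_filter_and_add (S : Finset (ℝ × ℝ)) (P Q : ℝ × ℝ → Prop) [DecidablePred P]
    [DecidablePred Q] :
    (S.filter (fun p => P p ∧ Q p)).card + (S.filter (fun p => P p ∧ ¬ Q p)).card =
      (S.filter P).card := by
  rw [← Finset.filter_filter, ← Finset.filter_filter]
  exact Finset.card_filter_add_card_filter_not _

/-- At each end at least `r + e + 1` points lie at most at the upper threshold. If at most `r` did
so at both ends, each end would have `e + 1` points of its own, and these would give `(e + 1)²`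
crossings. -/
theorem IsQuantile.card_inHi (hq : B.IsQuantile S r e) (hr : r < S.card)
    (hcr : (crossings S B.t₁ B.t₂).card ≤ e ^ 2) : r < (S.filter B.InHi).card := by
  have h1 := hq.hi₁'
  have h2 := hq.hi₂'
  have e1 := card_filter_and_add S (fun p => hgt B.t₁ p ≤ B.hi₁) (fun p => hgt B.t₂ p ≤ B.hi₂)
  have e2 := card_filter_and_add S (fun p => hgt B.t₂ p ≤ B.hi₂) (fun p => hgt B.t₁ p ≤ B.hi₁)
  have e3 : (S.filter B.InHi).card =
      (S.filter (fun p => hgt B.t₁ p ≤ B.hi₁ ∧ hgt B.t₂ p ≤ B.hi₂)).card := by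
    congr 1
  have e4 : (S.filter (fun p => hgt B.t₂ p ≤ B.hi₂ ∧ hgt B.t₁ p ≤ B.hi₁)).card =
      (S.filter (fun p => hgt B.t₁ p ≤ B.hi₁ ∧ hgt B.t₂ p ≤ B.hi₂)).card := by
    congr 1; ext; simp [and_comm]
  have e5 := Finset.card_filter_le S (fun p => hgt B.t₁ p ≤ B.hi₁)
  have e6 := Finset.card_filter_le S (fun p => hgt B.t₂ p ≤ B.hi₂)
  -- For the case that `r + e` exceeds the last rank: then the upper thresholds are maxima.
  have e7 : (S.filter (fun p => hgt B.t₂ p ≤ B.hi₂)).card = S.card →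
      (S.filter (fun p => hgt B.t₁ p ≤ B.hi₁ ∧ ¬ hgt B.t₂ p ≤ B.hi₂)).card = 0 := by
    intro h
    rw [Finset.card_filter_eq_iff] at h
    rw [Finset.card_eq_zero, Finset.filter_eq_empty_iff]
    exact fun p hp h' => h'.2 (h p hp)
  have hX := card_mul_le_crossings (S := S) (t₁ := B.t₁) (t₂ := B.t₂)
    (X := S.filter (fun p => hgt B.t₁ p ≤ B.hi₁ ∧ ¬ hgt B.t₂ p ≤ B.hi₂))
    (Y := S.filter (fun p => hgt B.t₂ p ≤ B.hi₂ ∧ ¬ hgt B.t₁ p ≤ B.hi₁))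
    (Finset.filter_subset _ _) (Finset.filter_subset _ _) (fun p hp q hq => by
      simp only [Finset.mem_filter] at hp hq
      exact ⟨by linarith [hp.2.1, hq.2.2], by linarith [hp.2.2, hq.2.1]⟩)
  by_contra hcon
  rcases le_total (S.card - 1) (r + e) with h | h
  · rw [min_eq_right h] at h1 h2
    have := e7 (by omega)
    omega
  · rw [min_eq_left h] at h1 h2
    have := (Nat.mul_le_mul (by omega : e + 1 ≤ _) (by omega : e + 1 ≤ _)).trans (hX.trans hcr)
    nlinarith

theorem IsQuantile.card_inLo (hq : B.IsQuantile S r e)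
    (hcr : (crossings S B.t₁ B.t₂).card ≤ e ^ 2) : S.card ≤ r + (S.filter B.InLo).card := by
  have h1 := hq.lo₁
  have h2 := hq.lo₂
  have h3 := card_filter_lt_add S B.t₁ B.lo₁
  have h4 := card_filter_lt_add S B.t₂ B.lo₂
  have e1 := card_filter_and_add S (fun p => B.lo₁ ≤ hgt B.t₁ p) (fun p => B.lo₂ ≤ hgt B.t₂ p)
  have e2 := card_filter_and_add S (fun p => B.lo₂ ≤ hgt B.t₂ p) (fun p => B.lo₁ ≤ hgt B.t₁ p)
  have e3 : (S.filter B.InLo).card =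
      (S.filter (fun p => B.lo₁ ≤ hgt B.t₁ p ∧ B.lo₂ ≤ hgt B.t₂ p)).card := by
    congr 1
  have e4 : (S.filter (fun p => B.lo₂ ≤ hgt B.t₂ p ∧ B.lo₁ ≤ hgt B.t₁ p)).card =
      (S.filter (fun p => B.lo₁ ≤ hgt B.t₁ p ∧ B.lo₂ ≤ hgt B.t₂ p)).card := by
    congr 1; ext; simp [and_comm]
  have e7 : (S.filter (fun p => B.lo₂ ≤ hgt B.t₂ p)).card = S.card →
      (S.filter (fun p => B.lo₁ ≤ hgt B.t₁ p ∧ ¬ B.lo₂ ≤ hgt B.t₂ p)).card = 0 := by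
    intro h
    rw [Finset.card_filter_eq_iff] at h
    rw [Finset.card_eq_zero, Finset.filter_eq_empty_iff]
    exact fun p hp h' => h'.2 (h p hp)
  have hX := card_mul_le_crossings (S := S) (t₁ := B.t₁) (t₂ := B.t₂)
    (X := S.filter (fun p => B.lo₂ ≤ hgt B.t₂ p ∧ ¬ B.lo₁ ≤ hgt B.t₁ p))
    (Y := S.filter (fun p => B.lo₁ ≤ hgt B.t₁ p ∧ ¬ B.lo₂ ≤ hgt B.t₂ p))
    (Finset.filter_subset _ _) (Finset.filter_subset _ _) (fun p hp q hq => by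
      simp only [Finset.mem_filter] at hp hq
      exact ⟨by linarith [hp.2.2, hq.2.1], by linarith [hp.2.1, hq.2.2]⟩)
  by_contra hcon
  rcases le_total r e with h | h
  · have := e7 (by omega)
    omega
  · have := (Nat.mul_le_mul (by omega : e + 1 ≤ _) (by omega : e + 1 ≤ _)).trans (hX.trans hcr)
    nlinarith

/-- Fewer than `2 e` ranks are strictly between `r - e` and `r + e`; a truncated `r - e` only helps.
-/
theorem card_mid_le {t lo hi : ℝ} (hlo : r - e < (S.filter (fun p => hgt t p ≤ lo)).card)
    (hhi : (S.filter (fun p => hgt t p < hi)).card ≤ r + e) :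
    (S.filter (fun p => lo < hgt t p ∧ hgt t p < hi)).card ≤ 2 * e := by
  rcases (S.filter (fun p => lo < hgt t p ∧ hgt t p < hi)).eq_empty_or_nonempty with h | ⟨p, hp⟩
  · rw [h]; simp
  have hlh : lo < hi := by
    have := (Finset.mem_filter.1 hp).2
    exact this.1.trans this.2
  have hd : Disjoint (S.filter (fun p => lo < hgt t p ∧ hgt t p < hi))
      (S.filter (fun p => hgt t p ≤ lo)) :=
    Finset.disjoint_filter.2 (fun p _ h h' => absurd h.1 (not_lt.2 h'))
  have hsub : (S.filter (fun p => lo < hgt t p ∧ hgt t p < hi)) ∪ (S.filter (fun p => hgt t p ≤ lo)) ⊆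
      S.filter (fun p => hgt t p < hi) := by
    intro p hp
    simp only [Finset.mem_union, Finset.mem_filter] at hp ⊢
    rcases hp with h | h
    · exact ⟨h.1, h.2.2⟩
    · exact ⟨h.1, h.2.trans_lt hlh⟩
  have := Finset.card_le_card hsub
  rw [Finset.card_union_of_disjoint hd] at this
  omega

theorem card_sdiff_ge {X Y : Finset (ℝ × ℝ)} : Y.card - X.card ≤ (Y \ X).card :=
  Finset.le_card_sdiff _ _

theorem card_le_of_mul {x y e c : ℕ} (h : x * y ≤ c) (hc : c ≤ e ^ 2) (hy : 2 * e + 1 ≤ y) :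
    x ≤ e := by
  by_contra hx
  push Not at hx
  nlinarith

/-- A kept point is near one of the four thresholds (at most `4 e`), strictly between the thresholds
at one end (at most `2 * 2 e`), or below at one end and above at the other (at most `2 * e`). A
point of the last kind crosses each of at least `2 e + 1` points in the middle, so `x` of them give
`x (2 e + 1) ≤ e²`. -/
theorem IsQuantile.card_kept (hq : B.IsQuantile S r e) (hr : r < S.card)
    (hcr : (crossings S B.t₁ B.t₂).card ≤ e ^ 2)
    (h1 : (S.filter (fun p => |hgt B.t₁ p - B.lo₁| ≤ 2)).card ≤ e)
    (h2 : (S.filter (fun p => |hgt B.t₁ p - B.hi₁| ≤ 2)).card ≤ e)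
    (h3 : (S.filter (fun p => |hgt B.t₂ p - B.lo₂| ≤ 2)).card ≤ e)
    (h4 : (S.filter (fun p => |hgt B.t₂ p - B.hi₂| ≤ 2)).card ≤ e) :
    (S.filter B.Kept).card ≤ 10 * e := by
  have m1 := card_mid_le (e := e) hq.lo₁' (hq.hi₁.trans (min_le_left _ _))
  have m2 := card_mid_le (e := e) hq.lo₂' (hq.hi₂.trans (min_le_left _ _))
  have x1 : (S.filter (fun p => hgt B.t₁ p < B.lo₁ ∧ B.hi₂ < hgt B.t₂ p)).card ≤ e := by
    have hm := card_mul_le_crossings (S := S) (t₁ := B.t₁) (t₂ := B.t₂)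
      (X := S.filter (fun p => hgt B.t₁ p < B.lo₁ ∧ B.hi₂ < hgt B.t₂ p))
      (Y := S.filter (fun p => hgt B.t₂ p ≤ B.hi₂) \ S.filter (fun p => hgt B.t₁ p < B.lo₁))
      (Finset.filter_subset _ _) (Finset.sdiff_subset.trans (Finset.filter_subset _ _))
      (fun p hp q hq => by
        simp only [Finset.mem_filter, Finset.mem_sdiff, not_and, not_lt] at hp hq
        have := hq.2 hq.1.1
        exact ⟨by linarith [hp.2.1], by linarith [hp.2.2, hq.1.2]⟩)
    have l1 : (S.filter (fun p => hgt B.t₁ p < B.lo₁ ∧ B.hi₂ < hgt B.t₂ p)).card ≤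
        (S.filter (fun p => hgt B.t₁ p < B.lo₁)).card :=
      Finset.card_le_card (fun p hp => by
        simp only [Finset.mem_filter] at hp ⊢; exact ⟨hp.1, hp.2.1⟩)
    have a1 := hq.lo₁
    have a2 := hq.hi₂'
    have a3 := card_sdiff_ge (X := S.filter (fun p => hgt B.t₁ p < B.lo₁))
      (Y := S.filter (fun p => hgt B.t₂ p ≤ B.hi₂))
    have a4 := Finset.card_filter_le S (fun p => hgt B.t₂ p ≤ B.hi₂)
    -- If `r ≤ e`, the lower threshold has rank 0 and nothing lies below it; if `r + e` is at least
    -- the last rank, nothing lies above the upper one.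
    rcases le_total r e with h | h
    · omega
    rcases le_total (S.card - 1) (r + e) with h' | h'
    · have hall : (S.filter (fun p => hgt B.t₂ p ≤ B.hi₂)).card = S.card := by
        rw [min_eq_right h'] at a2; omega
      rw [Finset.card_filter_eq_iff] at hall
      rw [Finset.filter_eq_empty_iff.2]
      · simp
      · exact fun p hp h => absurd (hall p hp) (not_le.2 h.2)
    · rw [min_eq_left h'] at a2
      exact card_le_of_mul hm hcr (by omega)
  have x2 : (S.filter (fun p => B.hi₁ < hgt B.t₁ p ∧ hgt B.t₂ p < B.lo₂)).card ≤ e := by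
    have hm := card_mul_le_crossings (S := S) (t₁ := B.t₁) (t₂ := B.t₂)
      (Y := S.filter (fun p => B.hi₁ < hgt B.t₁ p ∧ hgt B.t₂ p < B.lo₂))
      (X := S.filter (fun p => hgt B.t₁ p ≤ B.hi₁) \ S.filter (fun p => hgt B.t₂ p < B.lo₂))
      (Finset.sdiff_subset.trans (Finset.filter_subset _ _)) (Finset.filter_subset _ _)
      (fun p hp q hq => by
        simp only [Finset.mem_filter, Finset.mem_sdiff, not_and, not_lt] at hp hq
        have := hp.2 hp.1.1
        exact ⟨by linarith [hq.2.1, hp.1.2], by linarith [hq.2.2]⟩)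
    rw [mul_comm] at hm
    have l1 : (S.filter (fun p => B.hi₁ < hgt B.t₁ p ∧ hgt B.t₂ p < B.lo₂)).card ≤
        (S.filter (fun p => hgt B.t₂ p < B.lo₂)).card :=
      Finset.card_le_card (fun p hp => by
        simp only [Finset.mem_filter] at hp ⊢; exact ⟨hp.1, hp.2.2⟩)
    have a1 := hq.lo₂
    have a2 := hq.hi₁'
    have a3 := card_sdiff_ge (X := S.filter (fun p => hgt B.t₂ p < B.lo₂))
      (Y := S.filter (fun p => hgt B.t₁ p ≤ B.hi₁))
    have a4 := Finset.card_filter_le S (fun p => hgt B.t₁ p ≤ B.hi₁)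
    rcases le_total r e with h | h
    · omega
    rcases le_total (S.card - 1) (r + e) with h' | h'
    · have hall : (S.filter (fun p => hgt B.t₁ p ≤ B.hi₁)).card = S.card := by
        rw [min_eq_right h'] at a2; omega
      rw [Finset.card_filter_eq_iff] at hall
      rw [Finset.filter_eq_empty_iff.2]
      · simp
      · exact fun p hp h => absurd (hall p hp) (not_le.2 h.1)
    · rw [min_eq_left h'] at a2
      exact card_le_of_mul hm hcr (by omega)
  have hsub : S.filter B.Kept ⊆
      (S.filter (fun p => |hgt B.t₁ p - B.lo₁| ≤ 2) ∪ S.filter (fun p => |hgt B.t₁ p - B.hi₁| ≤ 2) ∪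
      (S.filter (fun p => |hgt B.t₂ p - B.lo₂| ≤ 2) ∪ S.filter (fun p => |hgt B.t₂ p - B.hi₂| ≤ 2))) ∪
      ((S.filter (fun p => B.lo₁ < hgt B.t₁ p ∧ hgt B.t₁ p < B.hi₁) ∪
        S.filter (fun p => B.lo₂ < hgt B.t₂ p ∧ hgt B.t₂ p < B.hi₂)) ∪
      (S.filter (fun p => hgt B.t₁ p < B.lo₁ ∧ B.hi₂ < hgt B.t₂ p) ∪
        S.filter (fun p => B.hi₁ < hgt B.t₁ p ∧ hgt B.t₂ p < B.lo₂))) := by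
    intro p hp
    obtain ⟨hpS, hb, ha⟩ := Finset.mem_filter.1 hp
    simp only [Finset.mem_union, Finset.mem_filter, hpS, true_and]
    by_contra hcon
    simp only [not_or] at hcon
    obtain ⟨⟨⟨n1, n2⟩, n3, n4⟩, ⟨n5, n6⟩, n7, n8⟩ := hcon
    have far : ∀ x lo hi : ℝ, ¬ |x - lo| ≤ 2 → ¬ |x - hi| ≤ 2 → ¬ (lo < x ∧ x < hi) →
        x < lo - 2 ∨ hi + 2 < x := by
      intro x lo hi n1 n2 n3
      by_contra hc
      simp only [not_or, not_lt] at hc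
      have h1 : lo + 2 < x := by
        by_contra h; exact n1 (abs_le.2 ⟨by linarith, by linarith⟩)
      have h2 : x < hi - 2 := by
        by_contra h; exact n2 (abs_le.2 ⟨by linarith, by linarith⟩)
      exact n3 ⟨by linarith, by linarith⟩
    rcases far _ _ _ n1 n2 n5 with c1 | c1 <;> rcases far _ _ _ n3 n4 n6 with c2 | c2
    · exact hb ⟨c1, c2⟩
    · exact n7 ⟨by linarith, by linarith⟩
    · exact n8 ⟨by linarith, by linarith⟩
    · exact ha ⟨c1, c2⟩
  refine (Finset.card_le_card hsub).trans ?_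
  refine (Finset.card_union_le _ _).trans ?_
  have u1 := Finset.card_union_le
    (S.filter (fun p => |hgt B.t₁ p - B.lo₁| ≤ 2) ∪ S.filter (fun p => |hgt B.t₁ p - B.hi₁| ≤ 2))
    (S.filter (fun p => |hgt B.t₂ p - B.lo₂| ≤ 2) ∪ S.filter (fun p => |hgt B.t₂ p - B.hi₂| ≤ 2))
  have u2 := Finset.card_union_le
    (S.filter (fun p => |hgt B.t₁ p - B.lo₁| ≤ 2)) (S.filter (fun p => |hgt B.t₁ p - B.hi₁| ≤ 2))
  have u3 := Finset.card_union_le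
    (S.filter (fun p => |hgt B.t₂ p - B.lo₂| ≤ 2)) (S.filter (fun p => |hgt B.t₂ p - B.hi₂| ≤ 2))
  have u4 := Finset.card_union_le
    (S.filter (fun p => B.lo₁ < hgt B.t₁ p ∧ hgt B.t₁ p < B.hi₁) ∪
        S.filter (fun p => B.lo₂ < hgt B.t₂ p ∧ hgt B.t₂ p < B.hi₂))
    (S.filter (fun p => hgt B.t₁ p < B.lo₁ ∧ B.hi₂ < hgt B.t₂ p) ∪
        S.filter (fun p => B.hi₁ < hgt B.t₁ p ∧ hgt B.t₂ p < B.lo₂))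
  have u5 := Finset.card_union_le (S.filter (fun p => B.lo₁ < hgt B.t₁ p ∧ hgt B.t₁ p < B.hi₁))
    (S.filter (fun p => B.lo₂ < hgt B.t₂ p ∧ hgt B.t₂ p < B.hi₂))
  have u6 := Finset.card_union_le (S.filter (fun p => hgt B.t₁ p < B.lo₁ ∧ B.hi₂ < hgt B.t₂ p))
    (S.filter (fun p => B.hi₁ < hgt B.t₁ p ∧ hgt B.t₂ p < B.lo₂))
  omega

/-- The thresholds are elements of rank `r - e` and `r + e` (as far as these exist). -/
structure Selects (B : LevelBox) (L : List (ℝ × ℝ)) (r e : ℕ) : Prop where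
  lo₁ : IsSel (L.map (hgt B.t₁)) (r - e) B.lo₁
  lo₂ : IsSel (L.map (hgt B.t₂)) (r - e) B.lo₂
  hi₁ : IsSel (L.map (hgt B.t₁)) (min (r + e) (L.length - 1)) B.hi₁
  hi₂ : IsSel (L.map (hgt B.t₂)) (min (r + e) (L.length - 1)) B.hi₂

theorem Selects.isQuantile {L : List (ℝ × ℝ)} (hL : L.Nodup) (h : B.Selects L r e) :
    B.IsQuantile L.toFinset r e := by
  have key : ∀ {t v : ℝ} {ρ : ℕ}, IsSel (L.map (hgt t)) ρ v →
      (L.toFinset.filter (fun p => hgt t p < v)).card ≤ ρ ∧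
      ρ < (L.toFinset.filter (fun p => hgt t p ≤ v)).card := by
    intro t v ρ h
    unfold IsSel at h
    rw [List.countP_map, List.countP_map] at h
    rw [← hL.countP_eq_card, ← hL.countP_eq_card]
    exact h
  have hl : L.toFinset.card = L.length := List.toFinset_card_of_nodup hL
  refine ⟨(key h.lo₁).1, (key h.lo₁).2, (key h.lo₂).1, (key h.lo₂).2, ?_, ?_, ?_, ?_⟩ <;> rw [hl]
  exacts [(key h.hi₁).1, (key h.hi₁).2, (key h.hi₂).1, (key h.hi₂).2]

end LevelBox

/-- If the active list is large, then one of the brackets is successful. -/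
theorem exists_successful {L : List (ℝ × ℝ)} (hL : L.Nodup) (hcell : Set.InjOn cell {p | p ∈ L})
    {r : ℕ} (hr : r < L.length) {a h : ℝ} (ha : 0 ≤ a) (hh : 0 < h) (hah : a + h ≤ 1)
    (hlarge : 247 * (10 : ℝ) ^ 20 ≤ h * √(L.length)) (B : ℕ → LevelBox)
    (hB₁ : ∀ j, (B j).t₁ = a + j * (h / 10 ^ 20))
    (hB₂ : ∀ j, (B j).t₂ = a + (j + 1 : ℕ) * (h / 10 ^ 20))
    (hsel : ∀ j < 10 ^ 20, (B j).Selects L r (L.length / 10 ^ 9)) :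
    ∃ j < 10 ^ 20, (B j).Certifies L r ∧
      L.countP (fun p => decide ((B j).Kept p)) ≤ 10 * (L.length / 10 ^ 9) := by
  have hl : L.toFinset.card = L.length := List.toFinset_card_of_nodup hL
  have hs : (10 : ℝ) ^ 9 ≤ L.length := by
    have h1 : h ≤ 1 := by linarith
    have h2 : 247 * (10 : ℝ) ^ 20 ≤ √(L.length) := hlarge.trans (by nlinarith [Real.sqrt_nonneg (L.length : ℝ)])
    have h3 := Real.mul_self_sqrt (Nat.cast_nonneg (α := ℝ) L.length)
    nlinarith
  have hs' : 10 ^ 9 ≤ L.length := by exact_mod_cast hs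
  set e := L.length / 10 ^ 9 with he
  -- As `e ≥ 1`, rounding down costs at most a factor 2, and `13 * 4 * 10 ^ 18 ≤ 10 ^ 20` is what
  -- the pigeonhole needs.
  have he2 : L.length ≤ 2 * 10 ^ 9 * e := by omega
  have hke : 13 * L.length ^ 2 ≤ 10 ^ 20 * e ^ 2 := by
    calc 13 * L.length ^ 2 ≤ 13 * (2 * 10 ^ 9 * e) ^ 2 :=
          Nat.mul_le_mul_left _ (Nat.pow_le_pow_left he2 2)
      _ = (52 * 10 ^ 18) * e ^ 2 := by ring
      _ ≤ 10 ^ 20 * e ^ 2 := Nat.mul_le_mul_right _ (by norm_num)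
  obtain ⟨j, hj, hcr, h1, h2, h3, h4⟩ := exists_good_slopes (S := L.toFinset) (k := 10 ^ 20) (e := e)
    (by intro x hx y hy h; exact hcell (by simpa using hx) (by simpa using hy) h) ha hh hah (by norm_num)
    (by rw [hl]; exact_mod_cast hlarge) (fun j => (B j).lo₁) (fun j => (B j).lo₂)
    (fun j => (B j).hi₁) (fun j => (B j).hi₂) (by rw [hl]; exact hke)
  simp only [Nat.cast_pow, Nat.cast_ofNat] at hcr h1 h2 h3 h4
  rw [← hB₁ j, ← hB₂ j] at hcr
  rw [← hB₁ j] at h1 h2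
  rw [← hB₂ j] at h3 h4
  have hq := (hsel j hj).isQuantile hL
  refine ⟨j, hj, ⟨?_, ?_⟩, ?_⟩
  · rw [hL.countP_eq_card]; exact hq.card_inHi (by rwa [hl]) hcr
  · rw [hL.countP_eq_card, ← hl]; exact hq.card_inLo hcr
  · rw [hL.countP_eq_card]; exact hq.card_kept (by rwa [hl]) hcr h1 h2 h3 h4

namespace RealRAM

/-! ### The search program

Integer variables: `0` number of active points, `1` rank, `2` slack `e`, `3` subinterval, `4` success
flag, `5` termination flag, `6`, `7`, `8` counts, `9` counter, `27` rank of the requested quantile,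
`29` write position.
Real variables: arrays `0`, `1` hold the active points, array `2` the output, `20` left end and `21`
length of the interval of slopes, `22`, `23` the two slopes, `24`, `25` and `26`, `27` lower and upper
threshold at these, `28` slope of the requested quantile. -/

/-- The point with index `i`. -/
def pt (s : State) (i : ℕ) : ℝ × ℝ := (s.real 0 i, s.real 1 i)

/-- The active points. -/
def pts (s : State) : List (ℝ × ℝ) := seg (pt s) 0 (s.nat 0 0)

theorem pts_length (s : State) : (pts s).length = s.nat 0 0 := by simp [pts]

theorem pt_congr {s s' : State} (h0 : s'.real 0 = s.real 0) (h1 : s'.real 1 = s.real 1) :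
    pt s' = pt s := by
  funext i; simp [pt, h0, h1]

theorem pts_congr {s s' : State} (h : s'.nat 0 = s.nat 0) (h0 : s'.real 0 = s.real 0)
    (h1 : s'.real 1 = s.real 1) : pts s' = pts s := by
  simp [pts, h, pt_congr h0 h1]

/-- The height of the point with the index in the counter `9`. -/
def hExpr (t : ℕ) : RealExpr := .sub (.get 1 (nv 9)) (.mul (rv t) (.get 0 (nv 9)))

@[simp] theorem hExpr_eval (s : State) (t : ℕ) :
    (hExpr t).eval s = hgt (s.real t 0) (pt s (s.nat 9 0)) := rfl

/-- The heights are copied into the work space because selection overwrites its input. -/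
def quantProg : Prog :=
  .seq (.seq (setn 9 (.const 0)) <|
    .loop (.natLt (nv 9) (nv 0)) <|
      .seq (.setReal 30 (nv 9) (hExpr 28)) (setn 9 (.add (nv 9) (.const 1))))
  selProg

theorem quantProg_spec (s : State) (hr : s.nat 27 0 < s.nat 0 0) :
    Exec quantProg s (200200 * s.nat 0 0) (fun s' =>
      Same (9 :: selNats) [30, 31, 32] s s' ∧
      IsSel ((pts s).map (hgt (s.real 28 0))) (s.nat 27 0) (s'.real 32 0)) := by
  refine Exec.seq (c₁ := 50 * s.nat 0 0 + 20) (c₂ := 200100 * s.nat 0 0)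
    (M := fun s' => Same [9] [30] s s' ∧
      seg (s'.real 30) 0 (s.nat 0 0) = (pts s).map (hgt (s.real 28 0))) ?_ ?_ (by omega)
  · refine Exec.step (c' := 50 * s.nat 0 0 + 10) ?_
      (by simp only [Prog.bound, setn, NatExpr.cost]; omega)
    rw [wp_setn]
    refine Exec.for (N := s.nat 0 0) (c := 30) (fun i s' => Same [9] [30] s s' ∧ s'.nat 9 0 = i ∧
      seg (s'.real 30) 0 i = (seg (pt s) 0 i).map (hgt (s.real 28 0))) ?_ ?_ ?_ ?_ ?_
    · exact ⟨(Same.refl _ _ s).writeNat (by decide), by simp [writeNat_nat, NatExpr.eval], rfl⟩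
    · rintro i s' hi ⟨hs, h9, -⟩
      simp [Test.Holds, h9, hs.1 0]
    · rintro i s' hi ⟨hs, h9, hseg⟩
      refine Exec.of_wp (by decide) ?_
      simp only [wp, wp_setn]
      refine ⟨(hs.writeReal (by decide)).writeNat (by decide), ?_, ?_⟩
      · simp [writeNat_nat, NatExpr.eval, h9]
      · rw [seg_succ, seg_succ, List.map_append, ← hseg]
        congr 1
        · refine seg_congr (fun j hj => ?_)
          simp [writeReal_real, h9]; omega
        · simp [writeReal_real, h9, hs.2 28, pt_congr (hs.2 0 (by decide)) (hs.2 1 (by decide))]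
    · exact fun s' h => ⟨h.1, h.2.2⟩
    · simp only [Test.cost, nv, NatExpr.cost]; omega
  · rintro s₁ ⟨h₁, hseg⟩
    have f0 := h₁.1 0 (by decide)
    have f27 := h₁.1 27 (by decide)
    refine (selProg_spec s₁ (by rw [f0, f27]; exact hr)).mono (by rw [f0]) ?_
    rintro s' ⟨hs, hsel⟩
    rw [f0, f27, hseg] at hsel
    exact ⟨(h₁.mono (by decide) (by decide)).trans (hs.mono (by decide) (by decide)), hsel⟩

/-- Stores a quantile of the active points. -/
def quantTo (t : ℕ) (ρ : NatExpr) (d : ℕ) : Prog :=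
  .seq (.seq (setr 28 (rv t)) (setn 27 ρ)) <| .seq quantProg (setr d (rv 32))

/-- The integer arrays used by quantiles. -/
def quantNats : List ℕ := 9 :: 27 :: selNats

theorem quantTo_spec (s : State) (t d : ℕ) (ρ : NatExpr) {r c : ℕ}
    (hρ : ∀ s' : State, s'.nat = s.nat → ρ.eval s' = r) (hr : r < s.nat 0 0)
    (hc : 200300 * s.nat 0 0 + ρ.cost ≤ c) :
    Exec (quantTo t ρ d) s c (fun s' =>
      Same quantNats [28, 30, 31, 32, d] s s' ∧
      IsSel ((pts s).map (hgt (s.real t 0))) r (s'.real d 0)) := by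
  refine Exec.step (c' := 200240 * s.nat 0 0) ?_
    (by simp only [Prog.bound, setn, setr, rv, RealExpr.cost, NatExpr.cost]; omega)
  simp only [wp, wp_setn, wp_setr, hρ (s.writeReal 28 0 _) rfl]
  refine Exec.seq (quantProg_spec _ ?_) (c₂ := 40) ?_ ?_
  · simpa [writeNat_nat] using hr
  · rintro s₁ ⟨h₁, hsel⟩
    refine Exec.of_wp (by simp [Prog.bound, setr, rv, RealExpr.cost, NatExpr.cost]) ?_
    rw [wp_setr]
    rw [pts_congr (s := s) (by rw [writeNat_nat_ne (by decide), writeReal_nat])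
      (by rw [writeNat_real, writeReal_real_ne (by decide)])
      (by rw [writeNat_real, writeReal_real_ne (by decide)])] at hsel
    refine ⟨?_, ?_⟩
    · refine Same.writeReal ?_ (by simp)
      refine Same.trans (Same.writeNat (Same.writeReal (Same.refl _ _ s) (by simp)) (by decide))
        (h₁.mono (by decide) ?_)
      intro x hx; simp at hx ⊢; tauto
    · simpa [writeReal_real, writeNat_nat] using hsel
  · simp [writeNat_nat]; omega

/-! ### Computing a bracket, counting and pruning with it -/

/-- The thresholds stored in memory. -/
def box (s : State) : LevelBox :=
  ⟨s.real 22 0, s.real 23 0, s.real 24 0, s.real 26 0, s.real 25 0, s.real 27 0⟩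

theorem box_congr {s s' : State} (h : ∀ a ∈ [22, 23, 24, 25, 26, 27], s'.real a = s.real a) :
    box s' = box s := by
  simp only [List.forall_mem_cons] at h
  obtain ⟨h1, h2, h3, h4, h5, h6, -⟩ := h
  simp [box, h1, h2, h3, h4, h5, h6]

def loRank : NatExpr := .sub (nv 1) (nv 2)
-- Truncated subtraction expresses a minimum: `x - (x - y) = min x y`.
def hiRank : NatExpr := .sub (.add (nv 1) (nv 2)) (.sub (.add (nv 1) (nv 2)) (.sub (nv 0) (.const 1)))

def thresholdsProg : Prog :=
  .seq (quantTo 22 loRank 24) <| .seq (quantTo 22 hiRank 25) <|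
  .seq (quantTo 23 loRank 26) (quantTo 23 hiRank 27)

theorem thresholdsProg_spec (s : State) (hr : s.nat 1 0 < s.nat 0 0) :
    Exec thresholdsProg s (802000 * s.nat 0 0) (fun s' =>
      Same quantNats [24, 25, 26, 27, 28, 30, 31, 32] s s' ∧
      (box s').Selects (pts s) (s.nat 1 0) (s.nat 2 0)) := by
  have key : ∀ s' : State, Same quantNats [24, 25, 26, 27, 28, 30, 31, 32] s s' →
      pts s' = pts s ∧ (∀ s'' : State, s''.nat = s'.nat → loRank.eval s'' = s.nat 1 0 - s.nat 2 0) ∧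
      (∀ s'' : State, s''.nat = s'.nat →
        hiRank.eval s'' = min (s.nat 1 0 + s.nat 2 0) ((pts s).length - 1)) ∧
      s'.nat 0 0 = s.nat 0 0 := by
    intro s' h
    have f0 := h.1 0 (by decide)
    have f1 := h.1 1 (by decide)
    have f2 := h.1 2 (by decide)
    refine ⟨pts_congr f0 (h.2 0 (by decide)) (h.2 1 (by decide)), fun s'' h' => ?_, fun s'' h' => ?_,
      by rw [f0]⟩
    · simp [loRank, NatExpr.eval, h', f1, f2]
    · simp only [hiRank, NatExpr.eval, nv_eval, h', f0, f1, f2, pts_length]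
      omega
  have hl := pts_length s
  obtain ⟨-, k2, k3, k4⟩ := key s (Same.refl _ _ s)
  refine Exec.seq (quantTo_spec s 22 24 loRank k2 (by omega) le_rfl) (c₂ := 601400 * s.nat 0 0) ?_
    (by simp only [loRank, nv, NatExpr.cost]; omega)
  rintro s₁ ⟨h₁, q₁⟩
  have h₁ := h₁.mono (R' := [24, 25, 26, 27, 28, 30, 31, 32]) (List.Subset.refl _) (by decide)
  obtain ⟨-, k2, k3, k4⟩ := key s₁ h₁
  refine Exec.seq (quantTo_spec s₁ 22 25 hiRank k3 (by omega) le_rfl) (c₂ := 400900 * s.nat 0 0) ?_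
    (by simp only [hiRank, nv, NatExpr.cost]; omega)
  rintro s₂ ⟨h₂', q₂⟩
  have h₂ := h₁.trans (h₂'.mono (List.Subset.refl _) (by decide))
  obtain ⟨-, k2, k3, k4⟩ := key s₂ h₂
  refine Exec.seq (quantTo_spec s₂ 23 26 loRank k2 (by omega) le_rfl) (c₂ := 200500 * s.nat 0 0) ?_
    (by simp only [loRank, nv, NatExpr.cost]; omega)
  rintro s₃ ⟨h₃', q₃⟩
  have h₃ := h₂.trans (h₃'.mono (List.Subset.refl _) (by decide))
  obtain ⟨-, k2, k3, k4⟩ := key s₃ h₃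
  refine (quantTo_spec s₃ 23 27 hiRank k3 (by omega) le_rfl).mono
    (by simp only [hiRank, nv, NatExpr.cost]; omega) ?_
  rintro s₄ ⟨h₄', q₄⟩
  have h₄ := h₃.trans (h₄'.mono (List.Subset.refl _) (by decide))
  rw [(key s₁ h₁).1] at q₂
  rw [(key s₂ h₂).1] at q₃
  rw [(key s₃ h₃).1] at q₄
  refine ⟨h₄, ?_, ?_, ?_, ?_⟩
  · simpa [box, h₄.2 22, h₄'.2 24, h₃'.2 24, h₂'.2 24] using q₁
  · simpa [box, h₄.2 23, h₂.2 23, h₄'.2 26] using q₃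
  · simpa [box, h₄.2 22, h₁.2 22, h₄'.2 25, h₃'.2 25] using q₂
  · simpa [box, h₄.2 23, h₃.2 23] using q₄

def inHiTest : Test :=
  .and (.not (.realLt (rv 25) (hExpr 22))) (.not (.realLt (rv 27) (hExpr 23)))
def inLoTest : Test :=
  .and (.not (.realLt (hExpr 22) (rv 24))) (.not (.realLt (hExpr 23) (rv 26)))
def belowTest : Test :=
  .and (.realLt (hExpr 22) (.sub (rv 24) (.const 2))) (.realLt (hExpr 23) (.sub (rv 26) (.const 2)))
def aboveTest : Test :=
  .and (.realLt (.add (rv 25) (.const 2)) (hExpr 22)) (.realLt (.add (rv 27) (.const 2)) (hExpr 23))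
def keptTest : Test := .and (.not belowTest) (.not aboveTest)

theorem inHiTest_holds (s : State) : inHiTest.Holds s ↔ (box s).InHi (pt s (s.nat 9 0)) := by
  simp [inHiTest, Test.Holds, LevelBox.InHi, box]
theorem inLoTest_holds (s : State) : inLoTest.Holds s ↔ (box s).InLo (pt s (s.nat 9 0)) := by
  simp [inLoTest, Test.Holds, LevelBox.InLo, box]
theorem belowTest_holds (s : State) : belowTest.Holds s ↔ (box s).Below (pt s (s.nat 9 0)) := by
  simp [belowTest, Test.Holds, LevelBox.Below, box, RealExpr.eval]
theorem aboveTest_holds (s : State) : aboveTest.Holds s ↔ (box s).Above (pt s (s.nat 9 0)) := by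
  simp [aboveTest, Test.Holds, LevelBox.Above, box, RealExpr.eval]
theorem keptTest_holds (s : State) : keptTest.Holds s ↔ (box s).Kept (pt s (s.nat 9 0)) := by
  simp only [keptTest, Test.Holds, belowTest_holds, aboveTest_holds, LevelBox.Kept]

/-- Increases a counter if a test succeeds. -/
def countIf (b : Test) (c : ℕ) : Prog := .cond b (setn c (.add (nv c) (.const 1))) .skip

theorem writeNat_self (s : State) (a i : ℕ) : s.writeNat a i (s.nat a i) = s := by
  simp [State.writeNat]

/-- A failed test acts like adding zero, so both branches become one write and consecutive counters
need no case distinction. -/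
theorem wp_countIf (b : Test) (c : ℕ) (Q : State → Prop) (s : State) (p : Prop) [Decidable p]
    (hp : b.Holds s ↔ p) (h : Q (s.writeNat c 0 (s.nat c 0 + if p then 1 else 0))) :
    wp (countIf b c) Q s := by
  refine ⟨fun hb => ?_, fun hb => ?_⟩
  · rw [if_pos (hp.1 hb)] at h; exact h
  · rw [if_neg (fun h => hb (hp.2 h)), add_zero, writeNat_self] at h; exact h

def countPtsProg : Prog :=
  .seq (.seq (setn 9 (.const 0)) <| .seq (setn 6 (.const 0)) <| .seq (setn 7 (.const 0))
    (setn 8 (.const 0))) <|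
  .loop (.natLt (nv 9) (nv 0)) <|
    .seq (countIf inHiTest 6) <| .seq (countIf inLoTest 7) <| .seq (countIf keptTest 8) <|
    setn 9 (.add (nv 9) (.const 1))

theorem countPtsProg_spec (s : State) :
    Exec countPtsProg s (200 * s.nat 0 0 + 50) (fun s' => Same [6, 7, 8, 9] [] s s' ∧
      s'.nat 6 0 = (pts s).countP (fun p => decide ((box s).InHi p)) ∧
      s'.nat 7 0 = (pts s).countP (fun p => decide ((box s).InLo p)) ∧
      s'.nat 8 0 = (pts s).countP (fun p => decide ((box s).Kept p))) := by
  refine Exec.step (c' := 200 * s.nat 0 0 + 20) ?_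
    (by simp only [Prog.bound, setn, NatExpr.cost]; omega)
  simp only [wp, wp_setn]
  refine Exec.for (N := s.nat 0 0) (c := 190) (fun i s' => Same [6, 7, 8, 9] [] s s' ∧ s'.nat 9 0 = i ∧
      s'.nat 6 0 = (seg (pt s) 0 i).countP (fun p => decide ((box s).InHi p)) ∧
      s'.nat 7 0 = (seg (pt s) 0 i).countP (fun p => decide ((box s).InLo p)) ∧
      s'.nat 8 0 = (seg (pt s) 0 i).countP (fun p => decide ((box s).Kept p))) ?_ ?_ ?_ ?_ ?_
  · refine ⟨((((Same.refl _ _ s).writeNat (by decide)).writeNat (by decide)).writeNat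
      (by decide)).writeNat (by decide), ?_⟩
    simp [writeNat_nat, NatExpr.eval]
  · rintro i s' hi ⟨hs, h9, -⟩
    simp [Test.Holds, h9, hs.1 0]
  · rintro i s' hi ⟨hs, h9, h6, h7, h8⟩
    refine Exec.of_wp (by decide) ?_
    have hb : ∀ s'' : State, s''.real = s'.real → box s'' = box s := fun s'' h =>
      (box_congr (fun a _ => by rw [h])).trans (box_congr (fun a _ => hs.2 a (by simp)))
    have hp : ∀ s'' : State, s''.real = s'.real → pt s'' = pt s := fun s'' h =>
      (pt_congr (by rw [h]) (by rw [h])).trans (pt_congr (hs.2 0 (by decide)) (hs.2 1 (by decide)))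
    refine wp_countIf _ _ _ _ ((box s).InHi (pt s i))
      (by rw [inHiTest_holds, hb _ rfl, hp _ rfl, h9]) ?_
    refine wp_countIf _ _ _ _ ((box s).InLo (pt s i))
      (by rw [inLoTest_holds, hb (s'.writeNat _ _ _) rfl, hp (s'.writeNat _ _ _) rfl, writeNat_nat_ne (by decide), h9]) ?_
    refine wp_countIf _ _ _ _ ((box s).Kept (pt s i))
      (by rw [keptTest_holds, hb ((s'.writeNat _ _ _).writeNat _ _ _) rfl,
        hp ((s'.writeNat _ _ _).writeNat _ _ _) rfl, writeNat_nat_ne (by decide), writeNat_nat_ne (by decide), h9]) ?_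
    rw [wp_setn]
    refine ⟨(((hs.writeNat (by decide)).writeNat (by decide)).writeNat (by decide)).writeNat
      (by decide), ?_⟩
    simp [writeNat_nat, NatExpr.eval, h9, countP_seg_succ, h6, h7, h8]
  · exact fun s' h => ⟨h.1, h.2.2⟩
  · simp only [Test.cost, nv, NatExpr.cost]; omega

/-- Removes the points above and below the thresholds, and counts those below. -/
def prunePtsProg : Prog :=
  .seq (.seq (setn 9 (.const 0)) <| .seq (setn 6 (.const 0)) (setn 29 (.const 0))) <|
  .loop (.natLt (nv 9) (nv 0)) <|
    .seq (countIf belowTest 6) <|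
    .seq (.cond keptTest (.seq (.setReal 0 (nv 29) (.get 0 (nv 9))) <|
      .seq (.setReal 1 (nv 29) (.get 1 (nv 9))) (setn 29 (.add (nv 29) (.const 1)))) .skip) <|
    setn 9 (.add (nv 9) (.const 1))

theorem prunePtsProg_spec (s : State) :
    Exec prunePtsProg s (200 * s.nat 0 0 + 50) (fun s' => Same [6, 9, 29] [0, 1] s s' ∧
      s'.nat 6 0 = (pts s).countP (fun p => decide ((box s).Below p)) ∧
      seg (pt s') 0 (s'.nat 29 0) = (pts s).filter (fun p => decide ((box s).Kept p))) := by
  refine Exec.step (c' := 200 * s.nat 0 0 + 30) ?_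
    (by simp only [Prog.bound, setn, NatExpr.cost]; omega)
  simp only [wp, wp_setn]
  -- Pruning in place is safe since the write position stays at most the read position.
  refine Exec.for (N := s.nat 0 0) (c := 190) (fun i s' => Same [6, 9, 29] [0, 1] s s' ∧
      s'.nat 9 0 = i ∧ s'.nat 29 0 ≤ i ∧
      s'.nat 6 0 = (seg (pt s) 0 i).countP (fun p => decide ((box s).Below p)) ∧
      seg (pt s') 0 (s'.nat 29 0) = (seg (pt s) 0 i).filter (fun p => decide ((box s).Kept p)) ∧
      ∀ j, i ≤ j → pt s' j = pt s j) ?_ ?_ ?_ ?_ ?_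
  · refine ⟨(((Same.refl _ _ s).writeNat (by decide)).writeNat (by decide)).writeNat (by decide), ?_⟩
    simp [writeNat_nat, NatExpr.eval, pt]
  · rintro i s' hi ⟨hs, h9, -⟩
    simp [Test.Holds, h9, hs.1 0]
  · rintro i s' hi ⟨hs, h9, h29, h6, hseg, hpt⟩
    refine Exec.of_wp (by decide) ?_
    have hb : ∀ s'' : State, s''.real = s'.real → box s'' = box s := fun s'' h =>
      (box_congr (fun a _ => by rw [h])).trans
        (box_congr (fun a ha => hs.2 a (by revert a; decide)))
    have hp : ∀ s'' : State, s''.real = s'.real → pt s'' i = pt s i := fun s'' h =>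
      (congrFun (pt_congr (s := s') (s' := s'') (by rw [h]) (by rw [h])) i).trans (hpt i le_rfl)
    refine wp_countIf _ _ _ _ ((box s).Below (pt s i))
      (by rw [belowTest_holds, hb _ rfl, h9, hp _ rfl]) ?_
    have hk : ∀ k, keptTest.Holds (s'.writeNat 6 0 k) ↔ (box s).Kept (pt s i) := fun k => by
      rw [keptTest_holds, hb (s'.writeNat _ _ _) rfl, writeNat_nat_ne (by decide), h9, hp (s'.writeNat _ _ _) rfl]
    simp only [wp, wp_setn, hk]
    have hpi := hpt i le_rfl
    simp only [pt, Prod.mk.injEq] at hpi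
    refine ⟨fun h => ⟨?_, ?_, ?_, ?_, ?_, ?_⟩, fun h => ⟨?_, ?_, ?_, ?_, ?_, ?_⟩⟩
    · exact ((((hs.writeNat (by decide)).writeReal (by decide)).writeReal (by decide)).writeNat
        (by decide)).writeNat (by decide)
    · simp [writeNat_nat, NatExpr.eval, h9]
    · simp [writeNat_nat, NatExpr.eval]; omega
    · simp [writeNat_nat, h6, countP_seg_succ]
    · rw [filter_seg_succ, zero_add,
        if_pos (c := decide ((box s).Kept (pt s i)) = true) (by simpa using h), ← hseg]
      simp only [writeNat_nat, NatExpr.eval, writeReal_nat, nv_eval, RealExpr.eval,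
        show (29 : ℕ) ≠ 9 by decide, show (29 : ℕ) ≠ 6 by decide, show (9 : ℕ) ≠ 29 by decide,
        show (9 : ℕ) ≠ 6 by decide, if_true, if_false, h9]
      rw [seg_succ]
      congr 1
      · refine seg_congr (fun j hj => ?_)
        simp [pt, writeReal_real]
        exact ⟨fun h => by omega, fun h => by omega⟩
      · simp [pt, writeReal_real, hpi]
    · intro j hj
      rw [← hpt j (by omega)]
      simp [pt, writeReal_real, writeNat_nat]
      exact ⟨fun h => by omega, fun h => by omega⟩
    · exact (hs.writeNat (by decide)).writeNat (by decide)
    · simp [writeNat_nat, NatExpr.eval, h9]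
    · simp [writeNat_nat]; omega
    · simp [writeNat_nat, h6, countP_seg_succ]
    · rw [filter_seg_succ, zero_add,
        if_neg (c := decide ((box s).Kept (pt s i)) = true) (by simpa using h), ← hseg]
      rfl
    · intro j hj
      exact hpt j (by omega)
  · exact fun s' h => ⟨h.1, h.2.2.2.1, h.2.2.2.2.1⟩
  · simp only [Test.cost, nv, NatExpr.cost]; omega

/-! ### Trying all pieces of the slope interval -/

/-- Computes the slack. -/
def slackProg : Prog :=
  .seq (.seq (setn 2 (.const 0)) (setn 8 (.const (10 ^ 9)))) <|
  .loop (.not (.natLt (nv 0) (nv 8))) <|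
    .seq (setn 2 (.add (nv 2) (.const 1))) (setn 8 (.add (nv 8) (.const (10 ^ 9))))

theorem slackProg_spec (s : State) :
    Exec slackProg s (50 * s.nat 0 0 + 50) (fun s' => Same [2, 8] [] s s' ∧
      s'.nat 2 0 = s.nat 0 0 / 10 ^ 9) := by
  refine Exec.step (c' := 50 * s.nat 0 0 + 30) ?_
    (by simp only [Prog.bound, setn, NatExpr.cost]; omega)
  simp only [wp, wp_setn]
  refine Exec.for (N := s.nat 0 0 / 10 ^ 9) (c := 20) (fun i s' => Same [2, 8] [] s s' ∧
      s'.nat 2 0 = i ∧ s'.nat 8 0 = 10 ^ 9 * (i + 1)) ?_ ?_ ?_ ?_ ?_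
  · refine ⟨((Same.refl _ _ s).writeNat (by decide)).writeNat (by decide), ?_⟩
    simp [writeNat_nat, NatExpr.eval]
  · rintro i s' hi ⟨hs, h2, h8⟩
    simp only [Test.Holds, nv_eval, h8, hs.1 0 (by decide), not_lt]
    omega
  · rintro i s' hi ⟨hs, h2, h8⟩
    refine Exec.of_wp (by decide) ?_
    simp only [wp, wp_setn]
    refine ⟨(hs.writeNat (by decide)).writeNat (by decide), ?_⟩
    simp [writeNat_nat, NatExpr.eval, h2, h8]
    ring
  · exact fun s' h => ⟨h.1, h.2.1⟩
  · simp only [Test.cost, nv, NatExpr.cost]; omega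

/-- Ten times the slack. -/
def tenSlack : NatExpr :=
  .add (.add (nv 2) (nv 2)) (.add (.add (nv 2) (nv 2)) (.add (.add (nv 2) (nv 2))
    (.add (.add (nv 2) (nv 2)) (.add (nv 2) (nv 2)))))

/-- The test that a subinterval is successful. -/
def successTest : Test :=
  .and (.natLt (nv 1) (nv 6)) (.and (.not (.natLt (.add (nv 1) (nv 7)) (nv 0)))
    (.not (.natLt tenSlack (nv 8))))

/-- The right slope of one piece becomes the left slope of the next. -/
def tryBody : Prog :=
  .seq (.seq (setr 22 (rv 23)) (setr 23 (.add (rv 22) (.div (rv 21) (.const (10 ^ 20)))))) <|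
  .seq thresholdsProg <| .seq countPtsProg <|
  .seq (.cond successTest (setn 4 (.const 1)) .skip) (setn 3 (.add (nv 3) (.const 1)))

def tryLoop : Prog :=
  .seq (.seq (setn 3 (.const 0)) <| .seq (setn 4 (.const 0)) (setr 23 (rv 20))) <|
  .loop (.and (.natLt (nv 3) (.const (10 ^ 20))) (.natLt (nv 4) (.const 1))) tryBody

/-- The bracket is successful for the points `L`. -/
def Successful (B : LevelBox) (L : List (ℝ × ℝ)) (r : ℕ) : Prop :=
  B.Certifies L r ∧ L.countP (fun p => decide (B.Kept p)) ≤ 10 * (L.length / 10 ^ 9)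

/-- The `j`-th subinterval is unsuccessful. -/
def Fails (L : List (ℝ × ℝ)) (r : ℕ) (a h : ℝ) (j : ℕ) : Prop :=
  ∃ B : LevelBox, B.t₁ = a + j * (h / 10 ^ 20) ∧ B.t₂ = a + (j + 1 : ℕ) * (h / 10 ^ 20) ∧
    B.Selects L r (L.length / 10 ^ 9) ∧ ¬ Successful B L r

def tryNats : List ℕ := [3, 4, 6, 7, 8] ++ quantNats
def tryReals : List ℕ := [22, 23, 24, 25, 26, 27, 28, 30, 31, 32]

/-- Brackets are overwritten, so for an unsuccessful piece only the existence of a failing bracket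
is remembered. The number of passes is bounded by the constant `10 ^ 20`. -/
theorem tryLoop_spec (s : State) (hr : s.nat 1 0 < s.nat 0 0) (he : s.nat 2 0 = s.nat 0 0 / 10 ^ 9)
    (hh : 0 < s.real 21 0) :
    Exec tryLoop s (10 ^ 26 * s.nat 0 0) (fun s' => Same tryNats tryReals s s' ∧
      ((s'.nat 4 0 = 1 ∧ s.real 20 0 ≤ (box s').t₁ ∧
        (box s').t₂ = (box s').t₁ + s.real 21 0 / 10 ^ 20 ∧
        (box s').t₂ ≤ s.real 20 0 + s.real 21 0 ∧ Successful (box s') (pts s) (s.nat 1 0)) ∨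
      (s'.nat 4 0 = 0 ∧ ∀ j < 10 ^ 20, Fails (pts s) (s.nat 1 0) (s.real 20 0) (s.real 21 0) j))) := by
  set a := s.real 20 0 with hadef
  set h := s.real 21 0 with hhdef
  refine Exec.step (c' := 10 ^ 26 * s.nat 0 0 - 20) ?_
    (by simp only [Prog.bound, setn, setr, rv, RealExpr.cost, NatExpr.cost]; omega)
  simp only [wp, wp_setn, wp_setr]
  refine Exec.while (c := 10 ^ 5 * 9 * s.nat 0 0) (fun m s' => Same tryNats tryReals s s' ∧
    s'.nat 3 0 ≤ 10 ^ 20 ∧ m = 10 ^ 20 - s'.nat 3 0 ∧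
    ((s'.nat 4 0 = 1 ∧ a ≤ (box s').t₁ ∧ (box s').t₂ = (box s').t₁ + h / 10 ^ 20 ∧
        (box s').t₂ ≤ a + h ∧ Successful (box s') (pts s) (s.nat 1 0)) ∨
      (s'.nat 4 0 = 0 ∧ s'.real 23 0 = a + s'.nat 3 0 * (h / 10 ^ 20) ∧
        ∀ j < s'.nat 3 0, Fails (pts s) (s.nat 1 0) a h j))) ?_ ?_ (10 ^ 20) _ ?_ ?_
  · rintro m s' ⟨hs, hj, hm, hst⟩ hb
    simp only [Test.Holds, NatExpr.eval, nv_eval] at hb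
    obtain ⟨h4, h23, hfail⟩ : s'.nat 4 0 = 0 ∧ s'.real 23 0 = a + s'.nat 3 0 * (h / 10 ^ 20) ∧
        ∀ j < s'.nat 3 0, Fails (pts s) (s.nat 1 0) a h j := by
      rcases hst with h | h
      · omega
      · exact h
    have f0 := hs.1 0 (by decide)
    have f1 := hs.1 1 (by decide)
    have f2 := hs.1 2 (by decide)
    have f21 := hs.2 21 (by decide)
    refine Exec.step (c' := 10 ^ 5 * 9 * s.nat 0 0 - 20) ?_
      (by simp only [Prog.bound, setr, rv, RealExpr.cost, NatExpr.cost]; omega)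
    simp only [wp, wp_setr]
    set s₁ := (s'.writeReal 22 0 (RealExpr.eval s' (rv 23))).writeReal 23 0 (RealExpr.eval
      (s'.writeReal 22 0 (RealExpr.eval s' (rv 23)))
      (.add (rv 22) (.div (rv 21) (.const (10 ^ 20))))) with hs₁
    have S₁ : Same tryNats tryReals s s₁ := (hs.writeReal (by decide)).writeReal (by decide)
    have g0 : s₁.nat 0 0 = s.nat 0 0 := by rw [S₁.1 0 (by decide)]
    have g1 : s₁.nat 1 0 = s.nat 1 0 := by rw [S₁.1 1 (by decide)]
    have g2 : s₁.nat 2 0 = s.nat 2 0 := by rw [S₁.1 2 (by decide)]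
    have gp : pts s₁ = pts s :=
      pts_congr (S₁.1 0 (by decide)) (S₁.2 0 (by decide)) (S₁.2 1 (by decide))
    have g22 : s₁.real 22 0 = a + s'.nat 3 0 * (h / 10 ^ 20) := by
      simp [hs₁, writeReal_real, h23]
    have g23 : s₁.real 23 0 = s₁.real 22 0 + h / 10 ^ 20 := by
      simp [hs₁, writeReal_real, RealExpr.eval, f21, hhdef]
    refine Exec.seq (thresholdsProg_spec s₁ (by omega)) (c₂ := 10 ^ 4 * s.nat 0 0) ?_ (by omega)
    rintro s₂ ⟨h₂, hsel⟩
    rw [gp, g1, g2, he, ← pts_length s] at hsel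
    have S₂ : Same tryNats tryReals s s₂ := S₁.trans (h₂.mono (by decide) (by decide))
    have gp₂ : pts s₂ = pts s :=
      pts_congr (S₂.1 0 (by decide)) (S₂.2 0 (by decide)) (S₂.2 1 (by decide))
    refine Exec.seq (countPtsProg_spec s₂) (c₂ := 200) ?_ (by rw [S₂.1 0 (by decide)]; omega)
    rintro s₃ ⟨h₃, c6, c7, c8⟩
    have S₃ : Same tryNats tryReals s s₃ := S₂.trans (h₃.mono (by decide) (by decide))
    rw [gp₂] at c6 c7 c8
    have hbox : box s₃ = box s₂ := box_congr (fun a _ => h₃.2 a (by simp))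
    have t₁ : (box s₃).t₁ = a + s'.nat 3 0 * (h / 10 ^ 20) := by
      rw [hbox, ← g22, ← h₂.2 22 (by decide)]; rfl
    have t₂ : (box s₃).t₂ = (box s₃).t₁ + h / 10 ^ 20 := by
      rw [t₁, ← g22, ← g23, hbox, ← h₂.2 23 (by decide)]; rfl
    have hsucc : successTest.Holds s₃ ↔ Successful (box s₃) (pts s) (s.nat 1 0) := by
      have k0 := S₃.1 0 (by decide)
      have k1 := S₃.1 1 (by decide)
      have k2 := S₃.1 2 (by decide)
      simp only [successTest, Test.Holds, tenSlack, NatExpr.eval, nv_eval, k0, k1, k2, c6, c7, c8,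
        Successful, LevelBox.Certifies, hbox, pts_length, he, not_lt]
      omega
    have k3 : s₃.nat 3 0 = s'.nat 3 0 := by
      rw [h₃.1 3 (by decide), h₂.1 3 (by decide)]; simp [hs₁]
    have k4 : s₃.nat 4 0 = 0 := by
      rw [h₃.1 4 (by decide), h₂.1 4 (by decide)]; simp [hs₁, h4]
    have k23 : s₃.real 23 0 = a + (s'.nat 3 0 + 1 : ℕ) * (h / 10 ^ 20) := by
      have : s₃.real 23 0 = (box s₃).t₂ := rfl
      rw [this, t₂, t₁]; push_cast; ring
    have hle : (box s₃).t₂ ≤ a + h := by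
      have e : (box s₃).t₂ = a + (s'.nat 3 0 + 1 : ℕ) * (h / 10 ^ 20) := k23
      have : ((s'.nat 3 0 + 1 : ℕ) : ℝ) ≤ 10 ^ 20 := by exact_mod_cast hb.1
      have := mul_le_mul_of_nonneg_right this (by positivity : 0 ≤ h / 10 ^ 20)
      rw [e]
      have e2 : (10 : ℝ) ^ 20 * (h / 10 ^ 20) = h := by field_simp
      linarith
    have hge : a ≤ (box s₃).t₁ := by rw [t₁]; have : 0 ≤ (s'.nat 3 0 : ℝ) * (h / 10 ^ 20) := by positivity
                                     linarith
    refine Exec.of_wp (by decide) ?_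
    simp only [wp, wp_setn, hsucc]
    refine ⟨fun hok => ⟨10 ^ 20 - (s'.nat 3 0 + 1), by omega, ?_, ?_, ?_, Or.inl ⟨?_, ?_⟩⟩,
      fun hok => ⟨10 ^ 20 - (s'.nat 3 0 + 1), by omega, ?_, ?_, ?_, Or.inr ⟨?_, ?_, ?_⟩⟩⟩
    · exact (S₃.writeNat (by decide)).writeNat (by decide)
    · simp only [writeNat_nat, NatExpr.eval, nv_eval]; simp [k3]; omega
    · simp [writeNat_nat, NatExpr.eval, k3]
    · simp [writeNat_nat, NatExpr.eval]
    · exact ⟨hge, t₂, hle, hok⟩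
    · exact S₃.writeNat (by decide)
    · simp only [writeNat_nat, NatExpr.eval, nv_eval]; simp [k3]; omega
    · simp [writeNat_nat, NatExpr.eval, k3]
    · simp [writeNat_nat, k4]
    · simp only [writeNat_nat, NatExpr.eval, nv_eval, writeNat_real, k3, if_true, k23]
    · intro j hj
      simp only [writeNat_nat, NatExpr.eval, nv_eval, k3, if_true] at hj
      rcases Nat.lt_succ_iff_lt_or_eq.1 hj with h' | rfl
      · exact hfail j h'
      · exact ⟨box s₃, t₁, by rw [← k23]; rfl, by rw [hbox]; exact hsel, hok⟩
  · rintro m s' ⟨hs, hj, hm, hst⟩ hb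
    refine ⟨hs, ?_⟩
    rcases hst with h | ⟨h4, -, hf⟩
    · exact Or.inl h
    · refine Or.inr ⟨h4, fun j hj' => hf j ?_⟩
      simp only [Test.Holds, NatExpr.eval, nv_eval, h4] at hb
      omega
  · refine ⟨(((Same.refl _ _ s).writeNat (by decide)).writeNat (by decide)).writeReal (by decide),
      ?_, ?_, Or.inr ⟨?_, ?_, ?_⟩⟩ <;> simp [writeNat_nat, writeReal_real, NatExpr.eval, hadef]
  · simp only [Test.cost, nv, NatExpr.cost]; omega

/-! ### Stages and the main loop -/

def stageProg : Prog :=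
  .seq slackProg <| .seq tryLoop <|
  .cond (.natLt (.const 0) (nv 4))
    (.seq prunePtsProg <| .seq (setn 0 (nv 29)) <| .seq (setn 1 (.sub (nv 1) (nv 6))) <|
      .seq (setr 20 (rv 22)) (setr 21 (.div (rv 21) (.const (10 ^ 20)))))
    (setn 5 (.const 1))

/-- The search state stored in memory. -/
def Searching (L₀ : List (ℝ × ℝ)) (r₀ : ℕ) (s : State) : Prop :=
  Search L₀ r₀ (pts s) (s.nat 1 0) (s.real 20 0) (s.real 21 0)

theorem stageProg_spec {L₀ : List (ℝ × ℝ)} {r₀ : ℕ} (hL₀ : L₀.Nodup)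
    (hcell : Set.InjOn cell {p | p ∈ L₀}) {s : State} (hS : Searching L₀ r₀ s)
    (h5 : s.nat 5 0 = 0) :
    Exec stageProg s (10 ^ 27 * s.nat 0 0) (fun s' => Searching L₀ r₀ s' ∧
      ((s'.nat 5 0 = 0 ∧ 2 * s'.nat 0 0 ≤ s.nat 0 0) ∨
      (s'.nat 5 0 = 1 ∧ s'.real 21 0 * √(s'.nat 0 0) < 247 * 10 ^ 20))) := by
  have hr : s.nat 1 0 < s.nat 0 0 := by rw [← pts_length]; exact hS.rank_lt
  refine Exec.seq (slackProg_spec s) (c₂ := 2 * 10 ^ 26 * s.nat 0 0) ?_ (by omega)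
  rintro s₁ ⟨h₁, he⟩
  have f0 : s₁.nat 0 0 = s.nat 0 0 := by rw [h₁.1 0 (by decide)]
  have f1 : s₁.nat 1 0 = s.nat 1 0 := by rw [h₁.1 1 (by decide)]
  have f20 : s₁.real 20 0 = s.real 20 0 := by rw [h₁.2 20 (by decide)]
  have f21 : s₁.real 21 0 = s.real 21 0 := by rw [h₁.2 21 (by decide)]
  have fp : pts s₁ = pts s :=
    pts_congr (h₁.1 0 (by decide)) (h₁.2 0 (by decide)) (h₁.2 1 (by decide))
  refine Exec.seq (tryLoop_spec s₁ (by omega) (by rw [he, f0]) (by rw [f21]; exact hS.pos))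
    (c₂ := 10 ^ 25 * s.nat 0 0) ?_ (by omega)
  rintro s₂ ⟨h₂, hres⟩
  rw [f20, f21, f1, fp] at hres
  have S₂ : Same (2 :: tryNats) tryReals s s₂ :=
    (h₁.mono (by decide) (by decide)).trans (h₂.mono (by decide) (List.Subset.refl _))
  have g0 : s₂.nat 0 0 = s.nat 0 0 := by rw [S₂.1 0 (by decide)]
  have g1 : s₂.nat 1 0 = s.nat 1 0 := by rw [S₂.1 1 (by decide)]
  have g5 : s₂.nat 5 0 = 0 := by rw [S₂.1 5 (by decide), h5]
  have g20 : s₂.real 20 0 = s.real 20 0 := by rw [S₂.2 20 (by decide)]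
  have g21 : s₂.real 21 0 = s.real 21 0 := by rw [S₂.2 21 (by decide)]
  have gp : pts s₂ = pts s :=
    pts_congr (S₂.1 0 (by decide)) (S₂.2 0 (by decide)) (S₂.2 1 (by decide))
  refine Exec.cond ?_ ?_ (c' := 10 ^ 24 * s.nat 0 0)
    (by simp only [Test.cost, nv, NatExpr.cost]; omega)
  · intro h4
    simp only [Test.Holds, NatExpr.eval, nv_eval] at h4
    obtain ⟨-, ha, h12, hb, hcert, hkept⟩ : s₂.nat 4 0 = 1 ∧ _ := by
      rcases hres with h | h
      · exact h
      · omega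
    -- Ten times the slack `⌊|L| / 10 ^ 9⌋` is at most `|L| / 10 ^ 8`.
    have hK : 10 ^ 8 * (pts s).countP (fun p => decide ((box s₂).Kept p)) ≤ (pts s).length := by
      omega
    have hnew := hS.step hcert ha h12 hb hK
    refine Exec.seq (prunePtsProg_spec s₂) (c₂ := 100) ?_ (by rw [g0]; omega)
    rintro s₃ ⟨h₃, h6, hseg⟩
    rw [gp] at h6 hseg
    have hlen := congrArg List.length hseg
    rw [seg_length, ← List.countP_eq_length_filter] at hlen
    refine Exec.of_wp (by decide) ?_
    simp only [wp, wp_setn, wp_setr]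
    have p0 : s₃.real 21 0 = s.real 21 0 := by rw [h₃.2 21 (by decide), g21]
    have p1 : s₃.nat 1 0 = s.nat 1 0 := by rw [h₃.1 1 (by decide), g1]
    have p5 : s₃.nat 5 0 = 0 := by rw [h₃.1 5 (by decide), g5]
    have p22 : s₃.real 22 0 = (box s₂).t₁ := by rw [h₃.2 22 (by decide)]; rfl
    refine ⟨?_, Or.inl ⟨?_, ?_⟩⟩
    · unfold Searching
      rw [← hseg] at hnew
      convert hnew using 1
      · unfold pts
        congr 1
      · simp [writeNat_nat, NatExpr.eval, p1, h6]
      · simp [writeReal_real, p22]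
      · simp [writeReal_real, RealExpr.eval, p0]
    · simp [writeNat_nat, p5]
    · simp [writeNat_nat, hlen]
      rw [pts_length] at hK
      omega
  · intro h4
    simp only [Test.Holds, NatExpr.eval, nv_eval] at h4
    obtain ⟨-, hf⟩ : s₂.nat 4 0 = 0 ∧ _ := by
      rcases hres with h | h
      · omega
      · exact h
    refine Exec.of_wp (by simp only [Prog.bound, setn, NatExpr.cost]; omega) ?_
    rw [wp_setn]
    refine ⟨?_, Or.inr ⟨?_, ?_⟩⟩
    · unfold Searching
      rw [pts_congr (s := s₂) (writeNat_nat_ne (by decide)) rfl rfl, gp]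
      simp only [writeNat_nat, writeNat_real, g1, g20, g21]
      exact hS
    · simp [writeNat_nat, NatExpr.eval]
    · simp only [writeNat_nat, writeNat_real, g21]
      simp only [g0, OfNat.zero_ne_ofNat, if_false]
      by_contra hlarge
      push Not at hlarge
      have : Nonempty LevelBox := ⟨⟨0, 0, 0, 0, 0, 0⟩⟩
      choose! B hB using hf
      -- The failing brackets exist for `j < 10 ^ 20` only; beyond, arbitrary thresholds at the
      -- right slopes fill up the sequence. If the list were still large, `exists_successful` would
      -- contradict the failures.
      let B' : ℕ → LevelBox := fun j => if j < 10 ^ 20 then B j else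
        ⟨s.real 20 0 + j * (s.real 21 0 / 10 ^ 20),
          s.real 20 0 + (j + 1 : ℕ) * (s.real 21 0 / 10 ^ 20), 0, 0, 0, 0⟩
      have hB' : ∀ j < 10 ^ 20, B' j = B j := fun j hj => if_pos hj
      obtain ⟨j, hj, hc, hk⟩ := exists_successful (hS.sublist.nodup hL₀)
        (hcell.mono (fun p hp => hS.sublist.subset hp)) hS.rank_lt hS.nonneg hS.pos hS.le_one
        (by rw [pts_length]; exact hlarge) B'
        (fun j => by
          by_cases hj : j < 10 ^ 20
          · rw [hB' j hj]; exact (hB j hj).1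
          · simp only [B', if_neg hj])
        (fun j => by
          by_cases hj : j < 10 ^ 20
          · rw [hB' j hj]; exact (hB j hj).2.1
          · simp only [B', if_neg hj])
        (fun j hj => by rw [hB' j hj]; exact (hB j hj).2.2.1)
      rw [hB' j hj] at hc hk
      exact (hB j hj).2.2.2 ⟨hc, hk⟩

def searchLoop : Prog := .loop (.natLt (nv 5) (.const 1)) stageProg

/-- Each stage that prunes at least halves the list, so the linear stage costs form a geometric
series. -/
theorem searchLoop_spec {L₀ : List (ℝ × ℝ)} {r₀ : ℕ} (hL₀ : L₀.Nodup)
    (hcell : Set.InjOn cell {p | p ∈ L₀}) (N : ℕ) : ∀ s : State, s.nat 0 0 = N →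
      Searching L₀ r₀ s → s.nat 5 0 = 0 →
    Exec searchLoop s (10 ^ 28 * N) (fun s' => Searching L₀ r₀ s' ∧
      s'.real 21 0 * √(s'.nat 0 0) < 247 * 10 ^ 20) := by
  induction N using Nat.strong_induction_on with
  | _ N ih =>
  intro s hN hS h5
  have hpos : 0 < N := by
    have := hS.rank_lt; rw [pts_length] at this; omega
  obtain ⟨t, s', hrun, ht, hS', hres⟩ := stageProg_spec hL₀ hcell hS h5
  have hb : Test.Holds s (.natLt (nv 5) (.const 1)) := by simp [Test.Holds, NatExpr.eval, h5]
  rcases hres with ⟨h5', hhalf⟩ | ⟨h5', hlt⟩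
  · obtain ⟨t', s'', hrun', ht', hpost⟩ := ih _ (by omega) s' rfl hS' h5'
    refine ⟨_, s'', .loopTrue hb hrun hrun', ?_, hpost⟩
    simp only [Test.cost, nv, NatExpr.cost]; omega
  · refine ⟨_, s', .loopTrue hb hrun (.loopFalse ?_), ?_, hS', hlt⟩
    · simp [Test.Holds, NatExpr.eval, h5']
    · simp only [Test.cost, nv, NatExpr.cost]; omega

/-! ### The whole program and the exponent -/

/-- The whole program. -/
def halvingProg : Prog :=
  .seq (halfProg 0 1) <| .seq (setr 21 (.const 1)) <| .seq searchLoop <|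
  .seq (quantTo 20 (nv 1) 33) <|
  .seq (.setReal 2 (.const 0) (.sub (.const 0) (rv 20))) <|
  .seq (.setReal 2 (.const 1) (.const 1)) (.setReal 2 (.const 2) (rv 33))

/-- The points of the input. -/
def inputList {n : ℕ} (p : Fin n → Plane) : List (ℝ × ℝ) := List.ofFn (fun i => (p i 0, p i 1))

theorem pts_inputPoints {n : ℕ} (p : Fin n → Plane) : pts (inputPoints p) = inputList p := by
  refine List.ext_getElem ?_ (fun i h1 h2 => ?_)
  · simp [pts, inputList, inputPoints]
  · have hi : i < n := by simpa [inputList] using h2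
    simp [pts, inputList, seg, pt, inputPoints, hi]

theorem halvingProg_spec {n : ℕ} (p : Fin n → Plane) (hn : 1 ≤ n) (hnodup : (inputList p).Nodup)
    (hcell : Set.InjOn cell {q | q ∈ inputList p}) :
    Exec halvingProg (inputPoints p) (10 ^ 29 * n) (fun s' => ∃ t v : ℝ, ∃ m : ℕ,
      s'.real 2 0 = -t ∧ s'.real 2 1 = 1 ∧ s'.real 2 2 = v ∧ 0 ≤ t ∧ t ≤ 1 ∧
      IsSel ((inputList p).map (hgt t)) (n / 2) v ∧
      (inputList p).countP (fun q => decide (|hgt t q - v| ≤ 2)) ≤ m ∧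
      (m : ℝ) ^ 6 ≤ (247 * 10 ^ 20) ^ 2 * (n : ℝ) ^ 5) := by
  set s := inputPoints p with hs
  have hn0 : s.nat 0 0 = n := by simp [hs, inputPoints]
  have hlen : (inputList p).length = n := by simp [inputList]
  refine Exec.seq (halfProg_spec s 0 1 (by decide)) (c₂ := 10 ^ 28 * 9 * n) ?_ (by omega)
  rintro s₁ ⟨h₁, h1⟩
  refine Exec.step (c' := 10 ^ 28 * 8 * n) ?_
    (by simp only [Prog.bound, setr, RealExpr.cost, NatExpr.cost]; omega)
  rw [wp_setr]
  set s₂ := s₁.writeReal 21 0 (RealExpr.eval s₁ (.const 1)) with hs₂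
  have S₂ : Same [1] [21] s s₂ := (h₁.mono (by decide) (by decide)).writeReal (by decide)
  have f0 : s₂.nat 0 0 = n := by rw [S₂.1 0 (by decide), hn0]
  have f1 : s₂.nat 1 0 = n / 2 := by rw [hs₂, writeReal_nat, h1, hn0]
  have f5 : s₂.nat 5 0 = 0 := by rw [S₂.1 5 (by decide)]; simp [hs, inputPoints]
  have f20 : s₂.real 20 0 = 0 := by rw [S₂.2 20 (by decide)]; simp [hs, inputPoints]
  have f21 : s₂.real 21 0 = 1 := by simp [hs₂, writeReal_real, RealExpr.eval]
  have fp : pts s₂ = inputList p := by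
    rw [pts_congr (S₂.1 0 (by decide)) (S₂.2 0 (by decide)) (S₂.2 1 (by decide)), hs,
      pts_inputPoints]
  -- All points are active and the slopes are `[0, 1]`; the left end `0` is the initial content of
  -- its cell.
  have hS : Searching (inputList p) (n / 2) s₂ := by
    unfold Searching
    rw [f1, f20, f21, fp]
    exact ⟨List.Sublist.refl _, by rw [hlen]; omega, le_rfl, one_pos, by norm_num,
      fun t _ _ v hv => ⟨hv, le_rfl⟩, by simp⟩
  refine Exec.seq (searchLoop_spec hnodup hcell n s₂ f0 hS f5) (c₂ := 10 ^ 28 * n) ?_ (by omega)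
  rintro s₃ ⟨hS₃, hlt⟩
  have hr := hS₃.rank_lt
  rw [pts_length] at hr
  have hle := hS₃.sublist.length_le
  rw [pts_length, hlen] at hle
  refine Exec.seq (quantTo_spec s₃ 20 33 (nv 1) (r := s₃.nat 1 0)
    (c := 10 ^ 27 * n) (fun s' h => by simp [h]) hr (by simp only [nv, NatExpr.cost]; omega))
    (c₂ := 100) ?_ (by omega)
  rintro s₄ ⟨h₄, hsel⟩
  refine Exec.of_wp (by decide) ?_
  simp only [wp]
  obtain ⟨hsel₀, hnear⟩ := hS₃.level (s₃.real 20 0) le_rfl (by linarith [hS₃.pos]) _ hsel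
  refine ⟨s₃.real 20 0, s₄.real 33 0, s₃.nat 0 0, ?_, ?_, ?_, hS₃.nonneg,
    by linarith [hS₃.pos, hS₃.le_one], hsel₀, ?_, ?_⟩
  · simp [writeReal_real, NatExpr.eval, RealExpr.eval, h₄.2 20]
  · simp [writeReal_real, NatExpr.eval, RealExpr.eval]
  · simp [writeReal_real, NatExpr.eval]
  · refine hnear.trans ?_
    rw [← pts_length s₃]
    exact List.countP_le_length
  · have hsz := hS₃.size
    rw [pts_length, hlen] at hsz
    have h0 := hS₃.pos
    have hm0 : (0 : ℝ) ≤ s₃.nat 0 0 := by positivity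
    have hsq : (s₃.real 21 0) ^ 2 * s₃.nat 0 0 ≤ (247 * 10 ^ 20) ^ 2 := by
      have := pow_le_pow_left₀ (by positivity) hlt.le 2
      rwa [mul_pow, Real.sq_sqrt hm0] at this
    -- The size invariant `|L|^5 ≤ h² n^5` is multiplied by `|L|`, and `h² |L|` is bounded by the
    -- stopping rule.
    calc ((s₃.nat 0 0 : ℕ) : ℝ) ^ 6 = (s₃.nat 0 0 : ℝ) ^ 5 * s₃.nat 0 0 := by ring
      _ ≤ ((s₃.real 21 0) ^ 2 * (n : ℝ) ^ 5) * s₃.nat 0 0 := mul_le_mul_of_nonneg_right hsz hm0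
      _ = ((s₃.real 21 0) ^ 2 * s₃.nat 0 0) * (n : ℝ) ^ 5 := by ring
      _ ≤ _ := mul_le_mul_of_nonneg_right hsq (by positivity)

end RealRAM

/-! ### From heights to the plane -/

theorem ncard_eq_countP {α : Type*} {n : ℕ} (f : Fin n → α) (P : α → Prop) [DecidablePred P] :
    {i : Fin n | P (f i)}.ncard = (List.ofFn f).countP (fun x => decide (P x)) := by
  rw [Set.ncard_eq_toFinset_card', List.ofFn_eq_map, List.countP_map, List.countP_eq_length_filter,
    ← List.toFinset_card_of_nodup ((List.nodup_finRange n).filter _)]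
  congr 1
  ext i
  simp

theorem abs_coord_sub_le {x y : Plane} {r : ℝ} (h : dist x y ≤ r) (i : Fin 2) : |x i - y i| ≤ r := by
  rw [dist_eq_norm] at h
  exact (PiLp.norm_apply_le (x - y) i).trans h

/-- Two centers in one unit cell have distance at most 2, so the midpoint lies in both disks. -/
theorem cell_ne {x y : Plane} (h : Disjoint (Metric.closedBall x 1) (Metric.closedBall y 1)) :
    cell (x 0, x 1) ≠ cell (y 0, y 1) := by
  intro hc
  simp only [cell, Prod.mk.injEq] at hc
  have h0 := Int.abs_sub_lt_one_of_floor_eq_floor hc.1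
  have h1 := Int.abs_sub_lt_one_of_floor_eq_floor hc.2
  have hd : dist x y ≤ 2 := by
    rw [EuclideanSpace.dist_eq, Fin.sum_univ_two, Real.dist_eq, Real.dist_eq]
    refine Real.sqrt_le_iff.2 ⟨by norm_num, ?_⟩
    nlinarith [abs_nonneg (x 0 - y 0), abs_nonneg (x 1 - y 1)]
  refine Set.disjoint_left.1 h (show midpoint ℝ x y ∈ _ from ?_) ?_
  · rw [Metric.mem_closedBall, dist_midpoint_left]; norm_num; linarith
  · rw [Metric.mem_closedBall, dist_midpoint_right]; norm_num; linarith

theorem theorem3 (ε : ℝ) (hε : 0 < ε) :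
    ∃ (P : RealRAM.Prog) (C K : ℝ),
      ∀ (n : ℕ) (p : Fin n → Plane), 1 ≤ n →
        Pairwise (fun i j : Fin n =>
          Disjoint (Metric.closedBall (p i) 1) (Metric.closedBall (p j) 1)) →
        ∃ (t : ℕ) (s : RealRAM.State) (a b c : ℝ),
          RealRAM.Run P (inputPoints p) t s ∧
          (t : ℝ) ≤ C * (n : ℝ) ∧
          a = s.real 2 0 ∧ b = s.real 2 1 ∧ c = s.real 2 2 ∧
          (a ≠ 0 ∨ b ≠ 0) ∧
          ({i : Fin n | (Metric.closedBall (p i) 1 ∩ lineOf a b c).Nonempty}.ncard : ℝ)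
            ≤ K * (n : ℝ) ^ ((5 : ℝ) / 6 + ε) ∧
          (n : ℝ) / 2 ≤ ({i : Fin n | p i ∈ lowerHalfplane a b c}.ncard : ℝ) ∧
          (n : ℝ) / 2 ≤ ({i : Fin n | p i ∈ upperHalfplane a b c}.ncard : ℝ) := by
  refine ⟨RealRAM.halvingProg, 10 ^ 29, (247 * 10 ^ 20) ^ 2, fun n p hn hdisj => ?_⟩
  have hcells : ∀ i j : Fin n, i ≠ j → cell (p i 0, p i 1) ≠ cell (p j 0, p j 1) :=
    fun i j hij => cell_ne (hdisj hij)
  have hinj : ∀ i j : Fin n, cell (p i 0, p i 1) = cell (p j 0, p j 1) → i = j := fun i j h => by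
    by_contra hij
    exact hcells i j hij h
  obtain ⟨T, s, hrun, hT, t, v, m, ha, hb, hc, ht0, ht1, hsel, hnear, hm⟩ :=
    RealRAM.halvingProg_spec p hn
      (List.nodup_ofFn.2 (fun i j h => hinj i j (congrArg cell h)))
      (by
        intro x hx y hy h
        obtain ⟨i, rfl⟩ := (List.mem_ofFn' _ _).1 hx
        obtain ⟨j, rfl⟩ := (List.mem_ofFn' _ _).1 hy
        rw [hinj i j h])
  have hn1 : (1 : ℝ) ≤ n := by exact_mod_cast hn
  have hlen : ((RealRAM.inputList p).map (hgt t)).length = n := by simp [RealRAM.inputList]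
  refine ⟨T, s, _, _, _, hrun, by exact_mod_cast hT, rfl, rfl, rfl, Or.inr (by rw [hb]; norm_num),
    ?_, ?_, ?_⟩ <;> rw [ha, hb, hc]
  -- Within a unit disk the height at slope `t` deviates from that of the center by at most `1 + t ≤
  -- 2`.
  · have hsub : {i : Fin n | (Metric.closedBall (p i) 1 ∩ lineOf (-t) 1 v).Nonempty} ⊆
        {i : Fin n | |hgt t (p i 0, p i 1) - v| ≤ 2} := by
      rintro i ⟨q, hq, hline⟩
      have h0 := abs_coord_sub_le (Metric.mem_closedBall.1 hq) 0
      have h1 := abs_coord_sub_le (Metric.mem_closedBall.1 hq) 1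
      rw [abs_le] at h0 h1
      simp only [lineOf, Set.mem_ofPred_eq] at hline
      simp only [Set.mem_ofPred_eq, hgt, abs_le]
      constructor <;> nlinarith
    have h1 := (Set.ncard_le_ncard hsub (Set.toFinite _)).trans_eq
      (ncard_eq_countP (fun i => (p i 0, p i 1)) (fun q => |hgt t q - v| ≤ 2))
    have h2 : ({i : Fin n | (Metric.closedBall (p i) 1 ∩ lineOf (-t) 1 v).Nonempty}.ncard : ℝ) ≤
        m := by exact_mod_cast h1.trans hnear
    refine h2.trans ?_
    have hmain : (m : ℝ) ≤ (247 * 10 ^ 20) ^ 2 * (n : ℝ) ^ ((5 : ℝ) / 6) := by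
      -- After taking sixth powers, the constant has exponent 12 instead of the required 2.
      refine le_of_pow_le_pow_left₀ (n := 6) (by norm_num) (by positivity) (hm.trans ?_)
      rw [mul_pow _ ((n : ℝ) ^ ((5 : ℝ) / 6)) 6, ← Real.rpow_natCast ((n : ℝ) ^ ((5 : ℝ) / 6)) 6, ← Real.rpow_mul (by positivity)]
      have : (5 : ℝ) / 6 * (6 : ℕ) = (5 : ℕ) := by norm_num
      rw [this, Real.rpow_natCast]
      refine mul_le_mul_of_nonneg_right ?_ (by positivity)
      norm_num
    refine hmain.trans (mul_le_mul_of_nonneg_left ?_ (by positivity))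
    exact Real.rpow_le_rpow_of_exponent_le hn1 (by linarith)
  -- Rank `n / 2` means more than `n / 2` heights (rounded down) are at most `v`, and at most that
  -- many are below `v`; both closed sides get at least half.
  · have h1 := hsel.2
    rw [List.countP_map] at h1
    have h2 := ncard_eq_countP (fun i => (p i 0, p i 1)) (fun q => hgt t q ≤ v)
    have h3 : {i : Fin n | p i ∈ lowerHalfplane (-t) 1 v} =
        {i : Fin n | hgt t (p i 0, p i 1) ≤ v} := by
      ext i
      simp only [lowerHalfplane, Set.mem_ofPred_eq, hgt]
      constructor <;> intro h <;> linarith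
    rw [h3, h2]
    have h4 : n / 2 < (List.ofFn (fun i => (p i 0, p i 1))).countP (fun q => decide (hgt t q ≤ v)) := h1
    have h5 : (n : ℝ) ≤ 2 * ((List.ofFn (fun i => (p i 0, p i 1))).countP
      (fun q => decide (hgt t q ≤ v)) : ℕ) := by exact_mod_cast (by omega)
    linarith
  · have h1 := hsel.1
    have h0 := countP_lt_add_countP_ge ((RealRAM.inputList p).map (hgt t)) v
    rw [hlen, List.countP_map, List.countP_map] at h0
    rw [List.countP_map] at h1
    have h2 := ncard_eq_countP (fun i => (p i 0, p i 1)) (fun q => v ≤ hgt t q)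
    have h3 : {i : Fin n | p i ∈ upperHalfplane (-t) 1 v} =
        {i : Fin n | v ≤ hgt t (p i 0, p i 1)} := by
      ext i
      simp only [upperHalfplane, Set.mem_ofPred_eq, hgt]
      constructor <;> intro h <;> linarith
    rw [h3, h2]
    have h4 : n ≤ 2 * (List.ofFn (fun i => (p i 0, p i 1))).countP
        (fun q => decide (v ≤ hgt t q)) := by
      have : (RealRAM.inputList p).countP ((fun x => decide (v ≤ x)) ∘ hgt t) =
        (List.ofFn (fun i => (p i 0, p i 1))).countP (fun q => decide (v ≤ hgt t q)) := rfl
      omega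
    have h5 : (n : ℝ) ≤ 2 * ((List.ofFn (fun i => (p i 0, p i 1))).countP
      (fun q => decide (v ≤ hgt t q)) : ℕ) := by exact_mod_cast h4
    linarith
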